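/- **Setting.** Let $\gamma=(\gamma_r)_{r\ge 2}$ be real numbers. For each $N\in\mathbb N$ let $J^{(r)}_{i_1,\ldots,i_r}$ ($r\ge 2$, $i_1,\ldots,i_r\in\{1,\ldots,N\}$) be independent real random variables with mean $0$ and variance $1$ (their laws may differ and may depend on $N$). Assume (M) for all $p\ge 2$ and $k\in\mathbb N$ there is a constant $C(p,k)<\infty$, not depending on $N$, such that $\mathbb E\,|J^{(r)}_{i_1,\ldots,i_r}|^k\le C(p,k)$ for all $N$, all $2\le r\le p$ and all $i_1,\ldots,i_r\in\{1,\ldots,N\}$. Let $B^N=\{x\in\mathbb R^N:\|x\|\le\sqrt N\}$ and $\rho_x=\|x\|^2/N$. For $p\ge 2$ put $\xi_p(z)=\sum_{r=2}^p\gamma_r^2z^r$ and $$H_N^{\le p}(x)=\sum_{r=2}^p\frac{\gamma_r}{N^{(r-1)/2}}\sum_{i_1,\ldots,i_r=1}^N J^{(r)}_{i_1,\ldots,i_r}x_{i_1}\cdots x_{i_r}.$$ Let $\nabla_E^2H_N^{\le p}(x)=(\partial_j\partial_kH_N^{\le p}(x))_{j,k=1}^N$ be the Euclidean Hessian, and $\nabla^2H_N^{\le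 p}(x)=P_x^{\intercal}\,\nabla_E^2H_N^{\le p}(x)\,P_x$ the spherical Hessian, where $P_x=I_N-xx^{\intercal}/\|x\|^2$ is the orthogonal projection onto $x^\perp$ (so $P_0=I_N$). Let $\bar\mu_{N,p,x}=\mathbb E\big[\frac1N\sum_{i=1}^N\delta_{\lambda_i}\big]$ be the mean empirical spectral distribution of $\nabla^2H_N^{\le p}(x)$, where $\lambda_1,\ldots,\lambda_N$ are its eigenvalues. For $R>0$ let $\mu_{sc,R}$ be the semicircular law with density $\frac{2}{\pi R^2}\sqrt{R^2-y^2}\,\mathbf 1_{|y|\le R}$, and let $\mu_{sc,0}=\delta_0$. Let $C_k=\frac{1}{k/2+1}\binom{k}{k/2}$ for even $k$ and $C_k=0$ for odd $k$. **Proposition 3.1.** For every $p\ge 2$ the following hold. 1. For every $k\in\mathbb N$ the expectations below are finite, and $$\lim_{N\to\infty}\ \sup_{\substack{x\in B^N\\ \xi_p''(\rho_x)>0}}\left|\frac{1}{\xi_p''(\rho_x)^{k/2}N}\,\mathbb E\Big[\operatorname{Tr}\big(\nabla_E^2H_N^{\le p}(x)\big)^k\Big]-C_k\right|=0.$$ 2.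 For every bounded function $f:\mathbb R\to\mathbb R$ that is Lipschitz with constant $1$, $$\lim_{N\to\infty}\ \sup_{x\in B^N}\left|\int_{\mathbb R}f\,d\bar\mu_{N,p,x}-\int_{\mathbb R}f\,d\mu_{sc,\,2\xi_p''(\rho_x)^{1/2}}\right|=0.$$ (An empty supremum is $0$.) -/

import Mathlib

open MeasureTheory ProbabilityTheory Filter Topology
open scoped ENNReal

noncomputable section

namespace SphericalGlass

/-- The disorder for dimension `N`: the variables `J r (i₁, …, iᵣ)`, for `r ≥ 2` and
`i₁, …, iᵣ` among the `N` coordinates, are independent random variables with mean `0` and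
variance `1` (not necessarily identically distributed). The values of `J` at `r < 2` play
no role. -/
structure IsDisorder {Ω : Type*} [MeasurableSpace Ω] (P : Measure Ω) (N : ℕ)
    (J : (r : ℕ) → (Fin r → Fin N) → Ω → ℝ) : Prop where
  measurable : ∀ r, 2 ≤ r → ∀ i, Measurable (J r i)
  indep : iIndepFun
    (fun a : (Σ r : {r : ℕ // 2 ≤ r}, (Fin (r : ℕ) → Fin N)) => J (a.1 : ℕ) a.2) P
  mean_zero : ∀ r, 2 ≤ r → ∀ i, ∫ ω, J r i ω ∂P = 0
  variance_one : ∀ r, 2 ≤ r → ∀ i, variance (J r i) P = 1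

/-- Existence of moments: for all `p ≥ 2` and `k`, the absolute `k`-th moments of the
variables with at most `p` indices are finite and bounded by a constant which depends
on `p` and `k` only (not on the dimension `N`). -/
def HasUniformMoments {Ω : ℕ → Type*} [∀ N, MeasurableSpace (Ω N)]
    (P : (N : ℕ) → Measure (Ω N))
    (J : (N : ℕ) → (r : ℕ) → (Fin r → Fin N) → Ω N → ℝ) : Prop :=
  ∀ p : ℕ, 2 ≤ p → ∀ k : ℕ, ∃ C : ℝ, 0 < C ∧ ∀ N r : ℕ, 2 ≤ r → r ≤ p →
    ∀ i : Fin r → Fin N,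
      Integrable (fun ω => |J N r i ω| ^ k) (P N) ∧ ∫ ω, |J N r i ω| ^ k ∂(P N) ≤ C

/-- The partial derivative `∂ⱼ f` of a function on `ℝᴺ`. -/
def partialDeriv {N : ℕ} (j : Fin N) (f : EuclideanSpace ℝ (Fin N) → ℝ)
    (x : EuclideanSpace ℝ (Fin N)) : ℝ :=
  lineDeriv ℝ f x (EuclideanSpace.single j 1)

/-- The Euclidean Hessian at `x` of the pure `r`-spin Hamiltonian
`N^{-(r-1)/2} ∑ J_{i₁…iᵣ} x_{i₁} ⋯ x_{iᵣ}` with coefficients `J`, entrywise. -/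
def pureHessian {N : ℕ} (r : ℕ) (J : (Fin r → Fin N) → ℝ)
    (x : EuclideanSpace ℝ (Fin N)) : Matrix (Fin N) (Fin N) ℝ :=
  Matrix.of fun j k =>
    1 / (N : ℝ) ^ (((r : ℝ) - 1) / 2) *
      ∑ i : Fin r → Fin N, J i * partialDeriv j (partialDeriv k fun y => ∏ l, y (i l)) x

/-- The Euclidean Hessian at `x` of the mixed Hamiltonian truncated at level `p`. -/
def euclHessian {N : ℕ} (γ : ℕ → ℝ) (p : ℕ) (J : (r : ℕ) → (Fin r → Fin N) → ℝ)
    (x : EuclideanSpace ℝ (Fin N)) : Matrix (Fin N) (Fin N) ℝ :=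
  ∑ r ∈ Finset.Icc 2 p, γ r • pureHessian r (J r) x

/-- The matrix `I - x xᵀ / ‖x‖²` of the orthogonal projection onto the orthogonal
complement of `x`. At `x = 0`, where this complement is the whole space, the formula returns
the identity matrix, as it should. -/
def projPerp {N : ℕ} (x : EuclideanSpace ℝ (Fin N)) : Matrix (Fin N) (Fin N) ℝ :=
  1 - (‖x‖ ^ 2)⁻¹ • Matrix.vecMulVec (fun j => x j) (fun j => x j)

/-- The spherical Hessian at `x` of the mixed Hamiltonian truncated at level `p`. -/
def sphHessian {N : ℕ} (γ : ℕ → ℝ) (p : ℕ) (J : (r : ℕ) → (Fin r → Fin N) → ℝ)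
    (x : EuclideanSpace ℝ (Fin N)) : Matrix (Fin N) (Fin N) ℝ :=
  (projPerp x).transpose * euclHessian γ p J x * projPerp x

/-- The empirical spectral distribution `N⁻¹ ∑ δ_λ` of an `N × N` real matrix, where `λ` runs
over its eigenvalues, i.e. the roots of the characteristic polynomial, with multiplicity.
For a symmetric matrix there are `N` of them. -/
def empiricalSpectral {N : ℕ} (A : Matrix (Fin N) (Fin N) ℝ) : Measure ℝ :=
  (N : ℝ≥0∞)⁻¹ • (A.charpoly.roots.map fun a => Measure.dirac a).sum

/-- The mean `B ↦ E[μ_A(B)]` of the empirical spectral distributions `μ_A` of a random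
matrix `A`. -/
def meanEmpiricalSpectral {Ω : Type*} [MeasurableSpace Ω] (P : Measure Ω) {N : ℕ}
    (A : Ω → Matrix (Fin N) (Fin N) ℝ) : Measure ℝ :=
  P.bind fun ω => empiricalSpectral (A ω)

/-- The semicircular law with radius `R > 0`, with density
`2 / (π R²) √(R² - y²)` on `[-R, R]`; for `R = 0` it is read as the point mass at `0`. -/
def semicircle (R : ℝ) : Measure ℝ :=
  if R = 0 then Measure.dirac 0
  else volume.withDensity fun y =>
    ENNReal.ofReal (if |y| ≤ R then 2 / (Real.pi * R ^ 2) * √(R ^ 2 - y ^ 2) else 0)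

/-- The truncated mixture `ξ_p(z) = ∑_{r=2}^p γᵣ² zʳ`, a polynomial. -/
def mixture (γ : ℕ → ℝ) (p : ℕ) : Polynomial ℝ :=
  ∑ r ∈ Finset.Icc 2 p, Polynomial.C (γ r ^ 2) * Polynomial.X ^ r

/-- The number `ξ_p''(ρ_x)`, where `ρ_x = ‖x‖² / N`. -/
def xiSecond {N : ℕ} (γ : ℕ → ℝ) (p : ℕ) (x : EuclideanSpace ℝ (Fin N)) : ℝ :=
  (mixture γ p).derivative.derivative.eval (‖x‖ ^ 2 / N)

/-- `C_k`: the `k/2`-th Catalan number for even `k`, and `0` for odd `k`. -/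
def semicircleMoment (k : ℕ) : ℝ :=
  if Even k then 1 / ((k : ℝ) / 2 + 1) * (k.choose (k / 2) : ℝ) else 0

/-- The closed Euclidean ball of radius `√N` in `ℝᴺ`. -/
def ball (N : ℕ) : Set (EuclideanSpace ℝ (Fin N)) := {x | ‖x‖ ≤ √(N : ℝ)}

end SphericalGlass

end

/-! After division by $\sqrt{\xi_p''(\rho_x)}$, the Hessian, compressed by `Q = 1` or by `Q =
projPerp x`, is a sum $A=\sum_\alpha Z_\alpha W_\alpha$ of deterministic symmetric matrices whose
coefficients are the independent disorder variables. The pure `r`-spin monomials have kernel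
$\langle x,y\rangle^r$; differentiating it shows that $\sum_\alpha \mathrm{tr}(W_\alpha XW_\alpha
Y)=N^{-1}\,\mathrm{tr}X\,\mathrm{tr}Y+O(\|X\|\|Y\|)$, with a constant depending on `p` only
(`cov_spin`). To leading order this is the covariance of a Wigner matrix. `IsWignerSeries` records
what is needed, with constants free of `x`, so every limit is uniform in the base point.

Let $m_k=N^{-1}\mathrm{tr}A^k$, let $c_k$ be the semicircle moments and $G=m_{n+1}-c_{n+1}$.
Removing one summand at a time replaces Gaussian integration by parts and gives the approximate
Schwinger–Dyson equation $E[m_{n+1}G]\approx E[\sum_i m_im_{n-1-i}\,G]$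
(`exists_abs_integral_trMoment_sub_le`). The $c_k$ satisfy the same recursion exactly, so
subtracting it leaves $E[G^2]$ on the left and deviations of lower moments on the right. Induction
yields mean-square convergence without a separate variance estimate
(`exists_forall_integral_trMoment_sub_sq_le`). The remainders contain powers of $\|A\|$; the a
priori bound $E\,\mathrm{tr}A^{2l}\le DN$ (`exists_integral_trace_pow_le`) makes them cost $N^{1/4}$
against a gain of $N^{-1/2}$.

For the spectral law, a quantitative moment method (`exists_abs_integral_sub_le_of_moments`) needs
finitely many moments and a common bound on the supports of the limits. This bound exists because
$\xi_p''$ is bounded on the ball. Where $\xi_p''(\rho_x)=0$ the Hessian vanishes, in agreement with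
the limit $\delta_0$. -/

namespace SphericalGlass

/-! ### Trace inequalities for symmetric matrices. -/

section LinearAlgebra

open Matrix

variable {n : Type*} [Fintype n] [DecidableEq n]

theorem pow_sub_pow_eq_sum {R : Type*} [Ring R] (a b : R) (m : ℕ) :
    a ^ m - b ^ m = ∑ i ∈ Finset.range m, a ^ i * (a - b) * b ^ (m - 1 - i) := by
  induction m with
  | zero => simp
  | succ m ih =>
    rw [Finset.sum_range_succ]
    have h : ∑ i ∈ Finset.range m, a ^ i * (a - b) * b ^ (m + 1 - 1 - i)
        = (∑ i ∈ Finset.range m, a ^ i * (a - b) * b ^ (m - 1 - i)) * b := by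
      rw [Finset.sum_mul]
      refine Finset.sum_congr rfl fun i hi => ?_
      have hi := Finset.mem_range.1 hi
      rw [mul_assoc _ _ b, ← pow_succ]
      congr 2
      omega
    rw [h, ← ih, pow_succ, pow_succ]
    simp
    noncomm_ring

theorem pow_mul_pow_le_add {x y : ℝ} (hx : 0 ≤ x) (hy : 0 ≤ y) (i j : ℕ) :
    x ^ i * y ^ j ≤ x ^ (i + j) + y ^ (i + j) := by
  rcases le_total x y with h | h
  · calc x ^ i * y ^ j ≤ y ^ i * y ^ j := by gcongr
      _ ≤ _ := by rw [← pow_add]; linarith [pow_nonneg hx (i + j)]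
  · calc x ^ i * y ^ j ≤ x ^ i * x ^ j := by gcongr
      _ ≤ _ := by rw [← pow_add]; linarith [pow_nonneg hy (i + j)]

/-- Simultaneous diagonalization of the trace form `W ↦ tr (W f(A) W g(B))` for Hermitian
`A`, `B` and monomials `f`, `g`. -/
theorem exists_trace_mul_pow_mul_pow_eq {A B W : Matrix n n ℝ} (hA : A.IsHermitian)
    (hB : B.IsHermitian) (hW : W.IsHermitian) :
    ∃ (a b : n → ℝ) (G : n → n → ℝ), ∀ i j,
      (W * A ^ i * W * B ^ j).trace = ∑ p, ∑ q, a p ^ i * b q ^ j * G p q ^ 2 := by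
  set U : Matrix n n ℝ := (hA.eigenvectorUnitary : Matrix n n ℝ)
  set V : Matrix n n ℝ := (hB.eigenvectorUnitary : Matrix n n ℝ)
  have hUU : star U * U = 1 := Unitary.coe_star_mul_self _
  have hVV : star V * V = 1 := Unitary.coe_star_mul_self _
  have diag : ∀ {C : Matrix n n ℝ} (hC : C.IsHermitian) (i : ℕ),
      C ^ i = (hC.eigenvectorUnitary : Matrix n n ℝ) * diagonal (fun p => hC.eigenvalues p ^ i) *
        star (hC.eigenvectorUnitary : Matrix n n ℝ) := by
    intro C hC i
    conv_lhs => rw [hC.spectral_theorem, ← map_pow, Unitary.conjStarAlgAut_apply, diagonal_pow]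
    rfl
  refine ⟨hA.eigenvalues, hB.eigenvalues, fun p q => (star U * W * V) p q, fun i j => ?_⟩
  have hG : star V * W * U = (star U * W * V)ᵀ := by
    have : star (star U * W * V) = star V * W * U := by
      rw [star_mul, star_mul, star_star, mul_assoc]
      congr 2
    rw [← this, star_eq_conjTranspose, conjTranspose_eq_transpose_of_trivial]
  rw [diag hA i, diag hB j]
  have : (W * (U * diagonal (fun p => hA.eigenvalues p ^ i) * star U) * W *
      (V * diagonal (fun p => hB.eigenvalues p ^ j) * star V)).trace =
      ((diagonal (fun p => hA.eigenvalues p ^ i) * (star U * W * V)) *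
        (diagonal (fun p => hB.eigenvalues p ^ j) * (star V * W * U))).trace := by
    have h1 := trace_mul_comm (W * U) (diagonal (fun p => hA.eigenvalues p ^ i) * (star U * W * V) *
      (diagonal (fun p => hB.eigenvalues p ^ j) * star V))
    simp only [mul_assoc] at h1 ⊢
    exact h1
  rw [this, hG, trace]
  simp only [diag_apply, mul_apply (M := diagonal _ * (star U * W * V)), diagonal_mul,
    transpose_apply]
  refine Finset.sum_congr rfl fun p _ => Finset.sum_congr rfl fun q _ => ?_
  ring

/-- In the common diagonal form the trace is a sum of `a p ^ i * b q ^ j` with nonnegative weights,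
so a scalar inequality suffices; the even total degree removes the absolute values on the right.
This separates the powers of a series from those of its leave-one-out version, which need not
commute. -/
theorem abs_trace_mul_pow_mul_pow_le {A B W : Matrix n n ℝ} (hA : A.IsHermitian)
    (hB : B.IsHermitian) (hW : W.IsHermitian) {i j l : ℕ} (h : i + j = 2 * l) :
    |(W * A ^ i * W * B ^ j).trace| ≤ (W * W * A ^ (2 * l)).trace + (W * W * B ^ (2 * l)).trace := by
  obtain ⟨a, b, G, hG⟩ := exists_trace_mul_pow_mul_pow_eq hA hB hW
  -- The exponent pairs `(2 * l, 0)` and `(0, 2 * l)` express both right-hand traces with the same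
  -- weights.
  have h1 := hG (2 * l) 0
  have h2 := hG 0 (2 * l)
  rw [pow_zero, mul_one, mul_assoc W, trace_mul_comm, mul_assoc, trace_mul_comm] at h1
  rw [pow_zero, mul_one] at h2
  rw [h2, h1, hG, ← Finset.sum_add_distrib]
  refine (Finset.abs_sum_le_sum_abs _ _).trans (Finset.sum_le_sum fun p _ => ?_)
  rw [← Finset.sum_add_distrib]
  refine (Finset.abs_sum_le_sum_abs _ _).trans (Finset.sum_le_sum fun q _ => ?_)
  have h3 := pow_mul_pow_le_add (abs_nonneg (a p)) (abs_nonneg (b q)) i j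
  rw [h, pow_mul, pow_mul |b q|, sq_abs, sq_abs, ← pow_mul, ← pow_mul] at h3
  rw [abs_mul, abs_mul, abs_pow, abs_pow, abs_of_nonneg (sq_nonneg (G p q))]
  rw [pow_zero, pow_zero, mul_one, one_mul, ← add_mul]
  gcongr

theorem trace_mul_self_mul_pow_nonneg {A W : Matrix n n ℝ} (hA : A.IsHermitian)
    (hW : W.IsHermitian) (l : ℕ) : 0 ≤ (W * W * A ^ (2 * l)).trace := by
  have := (abs_nonneg _).trans (abs_trace_mul_pow_mul_pow_le hA hA hW (i := 0) (l := l) (Nat.zero_add _))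
  linarith

/-- Cauchy–Schwarz on the diagonal; the off-diagonal squares in the trace of `A ^ 2` are then
dropped. -/
theorem abs_trace_sq_le {A : Matrix n n ℝ} (hA : A.IsHermitian) :
    A.trace ^ 2 ≤ Fintype.card n * (A ^ 2).trace := by
  have h1 := sq_sum_le_card_mul_sum_sq (s := Finset.univ) (f := fun i => A i i)
  refine h1.trans ?_
  rw [Finset.card_univ]
  gcongr
  simp only [trace, diag_apply, pow_two, mul_apply]
  refine Finset.sum_le_sum fun i _ => ?_
  have : ∀ j, A i j * A j i = A i j * A i j := fun j => by rw [← hA.apply j i]; rfl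
  simp only [this]
  exact Finset.single_le_sum (f := fun j => A i j * A i j) (fun j _ => mul_self_nonneg _)
    (Finset.mem_univ i)

theorem trace_pow_two_mul_nonneg {A : Matrix n n ℝ} (hA : A.IsHermitian) (l : ℕ) :
    0 ≤ (A ^ (2 * l)).trace := by
  have := trace_mul_self_mul_pow_nonneg hA (isHermitian_one (n := n) (α := ℝ)) l
  simpa using this

/-! ### Operator norm against traces. -/

section OperatorNorm

open scoped Matrix.Norms.L2Operator

theorem l2_opNorm_le_of_forall {A : Matrix n n ℝ} {C : ℝ} (hC : 0 ≤ C)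
    (h : ∀ v : n → ℝ, ‖WithLp.toLp 2 (A *ᵥ v)‖ ≤ C * ‖WithLp.toLp 2 v‖) : ‖A‖ ≤ C := by
  rw [l2_opNorm_def]
  exact ContinuousLinearMap.opNorm_le_bound _ hC fun v => h v

theorem abs_dotProduct_mulVec_le (A : Matrix n n ℝ) (u v : n → ℝ) :
    |u ⬝ᵥ A *ᵥ v| ≤ ‖A‖ * (‖WithLp.toLp 2 u‖ * ‖WithLp.toLp 2 v‖) := by
  have h1 := l2_opNorm_mulVec A (WithLp.toLp 2 v)
  have h2 := abs_real_inner_le_norm (WithLp.toLp 2 (A *ᵥ v)) (WithLp.toLp 2 u)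
  rw [EuclideanSpace.inner_toLp_toLp] at h2
  simp only [star_trivial] at h2
  refine h2.trans ?_
  calc _ ≤ (‖A‖ * ‖WithLp.toLp 2 v‖) * ‖WithLp.toLp 2 u‖ := by gcongr; exact h1
    _ = _ := by ring

/-- The operator norm is at most the Frobenius norm, by Cauchy–Schwarz in each row. -/
theorem l2_opNorm_sq_le_trace (A : Matrix n n ℝ) : ‖A‖ ^ 2 ≤ (Aᵀ * A).trace := by
  have h0 : (Aᵀ * A).trace = ∑ i, ∑ j, A i j ^ 2 := by
    simp only [trace, diag_apply, mul_apply, transpose_apply]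
    rw [Finset.sum_comm]
    simp [pow_two]
  have h1 : 0 ≤ ∑ i, ∑ j, A i j ^ 2 :=
    Finset.sum_nonneg fun i _ => Finset.sum_nonneg fun j _ => sq_nonneg _
  rw [h0]
  have h2 : ‖A‖ ≤ √(∑ i, ∑ j, A i j ^ 2) := by
    refine l2_opNorm_le_of_forall (Real.sqrt_nonneg _) fun v => ?_
    rw [EuclideanSpace.norm_eq, EuclideanSpace.norm_eq, ← Real.sqrt_mul h1]
    refine Real.sqrt_le_sqrt ?_
    rw [Finset.sum_mul]
    refine Finset.sum_le_sum fun i _ => ?_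
    simp only [Real.norm_eq_abs, sq_abs, mulVec, dotProduct]
    exact Finset.sum_mul_sq_le_sq_mul_sq _ _ _
  calc ‖A‖ ^ 2 ≤ √(∑ i, ∑ j, A i j ^ 2) ^ 2 := by gcongr
    _ = _ := Real.sq_sqrt h1

/-- The exponents are powers of two because the C⋆-identity for self-adjoint elements iterates by
squaring. -/
theorem l2_opNorm_pow_le_trace {A : Matrix n n ℝ} (hA : A.IsHermitian) (j : ℕ) :
    ‖A‖ ^ (2 ^ (j + 1)) ≤ (A ^ (2 ^ (j + 1))).trace := by
  have h := l2_opNorm_sq_le_trace (A ^ 2 ^ j)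
  have h1 : (A ^ 2 ^ j)ᵀ = A ^ 2 ^ j := by
    rw [← conjTranspose_eq_transpose_of_trivial]; exact hA.pow _
  rw [IsSelfAdjoint.norm_pow_two_pow hA, h1, ← pow_mul, ← pow_add, ← two_mul] at h
  rwa [mul_comm 2, ← pow_succ] at h

theorem l2_opNorm_pow_two_mul_le_trace {A : Matrix n n ℝ} (hA : A.IsHermitian) (l : ℕ) :
    ‖A ^ (2 * l)‖ ≤ (A ^ (2 * l)).trace := by
  have h := l2_opNorm_sq_le_trace (A ^ l)
  have h1 : (A ^ l)ᵀ = A ^ l := by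
    rw [← conjTranspose_eq_transpose_of_trivial]; exact hA.pow _
  rw [h1, ← pow_add, ← two_mul] at h
  refine le_trans ?_ h
  rw [mul_comm, pow_mul, pow_two, pow_two]
  exact norm_mul_le _ _

theorem abs_trace_le_card_mul_norm (A : Matrix n n ℝ) : |A.trace| ≤ Fintype.card n * ‖A‖ := by
  have h : ∀ i, |A i i| ≤ ‖A‖ := by
    intro i
    have := abs_dotProduct_mulVec_le A (Pi.single i 1) (Pi.single i 1)
    simpa using this
  rw [trace]
  refine (Finset.abs_sum_le_sum_abs _ _).trans ((Finset.sum_le_sum fun i _ => h i).trans ?_)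
  simp

end OperatorNorm

/-! ### Perturbation of weighted traces in Frobenius norm. -/

section Frobenius

open scoped Matrix.Norms.Frobenius

theorem frobenius_norm_sq (M : Matrix n n ℝ) : ‖M‖ ^ 2 = (Mᵀ * M).trace := by
  rw [frobenius_norm_def, ← Real.rpow_natCast, ← Real.rpow_mul (by positivity)]
  simp only [trace, diag_apply, mul_apply, transpose_apply]
  rw [Finset.sum_comm]
  simp [pow_two]

theorem frobenius_norm_pow_mul_sq {B W : Matrix n n ℝ} (hB : B.IsHermitian)
    (hW : W.IsHermitian) (l : ℕ) : ‖B ^ l * W‖ ^ 2 = (W * W * B ^ (2 * l)).trace := by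
  have hB' : (B ^ l)ᵀ = B ^ l := by
    rw [← conjTranspose_eq_transpose_of_trivial]; exact hB.pow l
  have hW' : Wᵀ = W := by rw [← conjTranspose_eq_transpose_of_trivial]; exact hW
  rw [frobenius_norm_sq, transpose_mul, hB', hW', mul_assoc, trace_mul_comm, ← mul_assoc,
    ← pow_add, ← two_mul, mul_assoc, trace_mul_comm]

/-- Telescoping writes the perturbed power as `B ^ j * W` plus products of `B ^ i * W` and a shorter
perturbed power times `W`, to which strong induction applies. The same telescoping for the scalars
`t` and `t + 2 * (|z| * w)` sums the bounds. Every factor ends in `W`, so no norm of `B` itself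
enters. -/
theorem frobenius_norm_add_pow_mul_le {B W : Matrix n n ℝ} {z w t : ℝ} {l : ℕ} (ht : 0 ≤ t)
    (hw : 0 ≤ w) (h : ∀ i ≤ l, ‖B ^ i * W‖ ≤ 2 * w * t ^ i) :
    ∀ j ≤ l, ‖(B + z • W) ^ j * W‖ ≤ 2 * w * (t + 2 * (|z| * w)) ^ j := by
  intro j
  induction j using Nat.strong_induction_on with
  | _ j ih =>
    intro hj
    have h1 : (B + z • W) ^ j * W = B ^ j * W +
        ∑ i ∈ Finset.range j, z • ((B ^ i * W) * ((B + z • W) ^ (j - 1 - i) * W)) := by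
      have := pow_sub_pow_eq_sum B (B + z • W) j
      rw [sub_eq_iff_eq_add] at this
      rw [this, add_mul, Finset.sum_mul, add_right_comm, ← Finset.sum_add_distrib,
        Finset.sum_eq_zero, zero_add]
      intro i _
      simp [mul_assoc]
    have h2 : ∀ i ∈ Finset.range j,
        ‖z • ((B ^ i * W) * ((B + z • W) ^ (j - 1 - i) * W))‖ ≤
          2 * w * (2 * (|z| * w)) * (t ^ i * (t + 2 * (|z| * w)) ^ (j - 1 - i)) := by
      intro i hi
      have hi := Finset.mem_range.1 hi
      rw [norm_smul, Real.norm_eq_abs]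
      calc |z| * ‖(B ^ i * W) * ((B + z • W) ^ (j - 1 - i) * W)‖
          ≤ |z| * (‖B ^ i * W‖ * ‖(B + z • W) ^ (j - 1 - i) * W‖) := by
            gcongr
            exact frobenius_norm_mul _ _
        _ ≤ |z| * ((2 * w * t ^ i) * (2 * w * (t + 2 * (|z| * w)) ^ (j - 1 - i))) := by
            gcongr
            · exact h i (by omega)
            · exact ih _ (by omega) (by omega)
        _ = _ := by ring
    have h3 := pow_sub_pow_eq_sum t (t + 2 * (|z| * w)) j
    rw [h1]
    refine (norm_add_le _ _).trans ?_
    refine (add_le_add (h j hj) ((norm_sum_le _ _).trans (Finset.sum_le_sum h2))).trans ?_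
    rw [← Finset.mul_sum]
    have h4 : (2 * (|z| * w)) * ∑ i ∈ Finset.range j, t ^ i * (t + 2 * (|z| * w)) ^ (j - 1 - i) =
        (t + 2 * (|z| * w)) ^ j - t ^ j := by
      rw [← neg_sub (t ^ j), h3, Finset.mul_sum, ← Finset.sum_neg_distrib]
      exact Finset.sum_congr rfl fun i _ => by ring
    rw [mul_assoc (2 * w), h4]
    exact le_of_eq (by ring)

/-- The left side is a squared Frobenius norm. Interpolating between `W` and `B ^ l * W` gives
geometric bounds on all `B ^ i * W`, and these survive the perturbation. The absence of any bound on
`B` lets the a priori moment estimate start. -/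
theorem trace_mul_add_smul_pow_le {B W : Matrix n n ℝ} (hB : B.IsHermitian)
    (hW : W.IsHermitian) {w : ℝ} (hw : 0 ≤ w) (hWw : (W * W).trace ≤ w ^ 2) (z : ℝ) (l : ℕ) :
    (W * W * (B + z • W) ^ (2 * l)).trace ≤
      4 * 16 ^ l * ((W * W * B ^ (2 * l)).trace + z ^ (2 * l) * w ^ (2 * l + 2)) := by
  have hBl := trace_mul_self_mul_pow_nonneg hB hW l
  have hA : (B + z • W).IsHermitian := hB.add (hW.smul (IsSelfAdjoint.all z))
  rcases Nat.eq_zero_or_pos l with rfl | hl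
  · simp only [mul_zero, pow_zero, mul_one, zero_add, one_mul] at hBl ⊢
    nlinarith [sq_nonneg w]
  have hW1 : ‖W‖ ≤ w := by
    have := frobenius_norm_pow_mul_sq hB hW 0
    simp only [mul_zero, pow_zero, mul_one, one_mul] at this
    exact abs_le_of_sq_le_sq' (this ▸ hWw) hw |>.2
  rcases hw.eq_or_lt with rfl | hw0
  · have : W = 0 := norm_le_zero_iff.1 hW1
    simp [this]
  -- `t` is the geometric rate for which `B ^ l * W` has Frobenius norm exactly `w * t ^ l`.
  obtain ⟨t, ht, htl⟩ : ∃ t : ℝ, 0 ≤ t ∧ t ^ l = ‖B ^ l * W‖ / w :=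
    ⟨(‖B ^ l * W‖ / w) ^ ((l : ℝ)⁻¹), by positivity,
      Real.rpow_inv_natCast_pow (by positivity) hl.ne'⟩
  have htl2 : w ^ 2 * t ^ (2 * l) = (W * W * B ^ (2 * l)).trace := by
    rw [← frobenius_norm_pow_mul_sq hB hW, mul_comm 2 l, pow_mul, htl]
    field_simp
  have h0 : ∀ i ≤ l, ‖B ^ i * W‖ ≤ 2 * w * t ^ i := by
    intro i hi
    -- If `t = 0` then `B ^ l * W = 0`; in diagonal form each `a p * G p q` then vanishes, hence so
    -- does `B ^ i * W` for every `i > 0`.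
    rcases ht.eq_or_lt with rfl | ht0
    · rcases Nat.eq_zero_or_pos i with rfl | hi0
      · simp only [pow_zero, one_mul, mul_one]
        linarith
      obtain ⟨a, b, G, hG⟩ := exists_trace_mul_pow_mul_pow_eq hB hB hW
      have hG' : ∀ m, (W * W * B ^ (2 * m)).trace = ∑ p, ∑ q, (a p ^ m * G p q) ^ 2 := by
        intro m
        have h1 := hG (2 * m) 0
        rw [pow_zero, mul_one, mul_assoc W, trace_mul_comm, mul_assoc, trace_mul_comm] at h1
        rw [h1]
        exact Finset.sum_congr rfl fun p _ => Finset.sum_congr rfl fun q _ => by ring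
      have h1 := htl2
      rw [zero_pow (by omega), mul_zero, hG', eq_comm, Finset.sum_eq_zero_iff_of_nonneg
        fun p _ => Finset.sum_nonneg fun q _ => sq_nonneg _] at h1
      have h2 : ‖B ^ i * W‖ ^ 2 = 0 := by
        rw [frobenius_norm_pow_mul_sq hB hW, hG']
        refine Finset.sum_eq_zero fun p hp => Finset.sum_eq_zero fun q hq => ?_
        have h3 := (Finset.sum_eq_zero_iff_of_nonneg fun q _ => sq_nonneg _).1 (h1 p hp) q hq
        rw [sq_eq_zero_iff, mul_eq_zero, pow_eq_zero_iff hl.ne'] at h3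
        rw [sq_eq_zero_iff, mul_eq_zero, pow_eq_zero_iff hi0.ne']
        exact h3
      rw [sq_eq_zero_iff.1 h2]
      positivity
    -- Interpolation: with a scalar second matrix the inequality compares exponent `2 * i` with the
    -- endpoints `2 * l` and `0`, both at most `w ^ 2 * t ^ (2 * l)`.
    have h1 := abs_trace_mul_pow_mul_pow_le hB (B := t • (1 : Matrix n n ℝ))
      (isHermitian_one.smul (IsSelfAdjoint.all t)) hW (i := 2 * i) (j := 2 * (l - i)) (l := l)
      (by omega)
    rw [← htl2] at h1
    simp only [smul_pow, one_pow, mul_smul_comm, mul_one, trace_smul, smul_eq_mul, abs_mul] at h1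
    have h2 : (W * B ^ (2 * i) * W).trace = (W * W * B ^ (2 * i)).trace := by
      rw [mul_assoc W, trace_mul_comm, mul_assoc, trace_mul_comm]
    rw [h2, ← frobenius_norm_pow_mul_sq hB hW i, abs_of_nonneg (by positivity),
      abs_of_nonneg (by positivity)] at h1
    have h3 : t ^ (2 * l) = t ^ (2 * (l - i)) * t ^ (2 * i) := by
      rw [← pow_add]; congr 1; omega
    have h4 : t ^ (2 * (l - i)) * ‖B ^ i * W‖ ^ 2 ≤ t ^ (2 * (l - i)) * (2 * (w ^ 2 * t ^ (2 * i))) := by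
      refine h1.trans ?_
      rw [h3]
      have : 0 ≤ t ^ (2 * (l - i)) * t ^ (2 * i) := by positivity
      nlinarith
    have h5 := le_of_mul_le_mul_left h4 (by positivity)
    refine (abs_le_of_sq_le_sq' (h5.trans ?_) (by positivity)).2
    rw [mul_pow, mul_pow, ← pow_mul, mul_comm i 2]
    have : 0 ≤ w ^ 2 * t ^ (2 * i) := by positivity
    nlinarith
  have h1 := frobenius_norm_add_pow_mul_le (z := z) ht hw h0 l le_rfl
  rw [← frobenius_norm_pow_mul_sq hA hW, ← htl2]
  calc ‖(B + z • W) ^ l * W‖ ^ 2 ≤ (2 * w * (t + 2 * (|z| * w)) ^ l) ^ 2 := by gcongr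
    _ = 4 * w ^ 2 * (t + 2 * (|z| * w)) ^ (2 * l) := by ring
    -- Of the final `16 ^ l`, one factor `4 ^ l` comes from this splitting and one from the `2` in
    -- `2 * (|z| * w)`.
    _ ≤ 4 * w ^ 2 * (2 ^ (2 * l) * (t ^ (2 * l) + (2 * (|z| * w)) ^ (2 * l))) := by
        gcongr
        refine (add_pow_le ht (by positivity) _).trans ?_
        gcongr
        · norm_num
        · omega
    _ ≤ 4 * w ^ 2 * (2 ^ (2 * l) * (2 ^ (2 * l) * t ^ (2 * l) + (2 * (|z| * w)) ^ (2 * l))) := by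
        gcongr
        exact le_mul_of_one_le_left (by positivity) (one_le_pow₀ (by norm_num))
    _ = 4 * (2 ^ (2 * l) * 2 ^ (2 * l)) *
          (w ^ 2 * t ^ (2 * l) + |z| ^ (2 * l) * w ^ (2 * l + 2)) := by ring
    _ = _ := by
        rw [← mul_pow, pow_mul |z|, sq_abs, ← pow_mul z, pow_mul (2 * 2 : ℝ)]
        norm_num

end Frobenius

end LinearAlgebra

/-! ### Random variables and matrices with finite moments of all orders. -/

section Moments

variable {Ω : Type*} [MeasurableSpace Ω] {P : Measure Ω}

/-- A random variable all of whose absolute moments are finite. -/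
structure HasMoments (P : Measure Ω) (f : Ω → ℝ) : Prop where
  measurable : Measurable f
  integrable_pow : ∀ k : ℕ, Integrable (fun ω => |f ω| ^ k) P

theorem HasMoments.integrable {f : Ω → ℝ} (h : HasMoments P f) : Integrable f P :=
  (h.integrable_pow 1).mono h.measurable.aestronglyMeasurable
    (ae_of_all _ fun ω => by simp)

theorem HasMoments.const [IsFiniteMeasure P] (c : ℝ) : HasMoments P (fun _ => c) :=
  ⟨measurable_const, fun _ => integrable_const _⟩

theorem HasMoments.add {f g : Ω → ℝ} (hf : HasMoments P f) (hg : HasMoments P g) :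
    HasMoments P (fun ω => f ω + g ω) where
  measurable := hf.measurable.add hg.measurable
  integrable_pow k := by
    refine (((hf.integrable_pow k).add (hg.integrable_pow k)).const_mul (2 ^ (k - 1))).mono'
      ((hf.measurable.add hg.measurable).abs.pow_const k).aestronglyMeasurable
      (ae_of_all _ fun ω => ?_)
    rw [Real.norm_eq_abs, abs_pow, abs_abs]
    calc |f ω + g ω| ^ k ≤ (|f ω| + |g ω|) ^ k := by gcongr; exact abs_add_le _ _
      _ ≤ _ := add_pow_le (abs_nonneg _) (abs_nonneg _) _

theorem HasMoments.mul {f g : Ω → ℝ} (hf : HasMoments P f) (hg : HasMoments P g) :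
    HasMoments P (fun ω => f ω * g ω) where
  measurable := hf.measurable.mul hg.measurable
  integrable_pow k := by
    refine ((hf.integrable_pow (k + k)).add (hg.integrable_pow (k + k))).mono'
      ((hf.measurable.mul hg.measurable).abs.pow_const k).aestronglyMeasurable
      (ae_of_all _ fun ω => ?_)
    rw [Real.norm_eq_abs, abs_pow, abs_abs, abs_mul, mul_pow]
    exact pow_mul_pow_le_add (abs_nonneg _) (abs_nonneg _) k k

theorem HasMoments.pow [IsFiniteMeasure P] {f : Ω → ℝ} (hf : HasMoments P f) (m : ℕ) :
    HasMoments P (fun ω => f ω ^ m) := by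
  induction m with
  | zero => simpa using HasMoments.const 1
  | succ m ih => simpa only [pow_succ] using ih.mul hf

theorem HasMoments.sub [IsFiniteMeasure P] {f g : Ω → ℝ} (hf : HasMoments P f)
    (hg : HasMoments P g) : HasMoments P (fun ω => f ω - g ω) := by
  simpa [sub_eq_add_neg] using hf.add ((HasMoments.const (-1)).mul hg)

theorem HasMoments.sum [IsFiniteMeasure P] {κ : Type*} (s : Finset κ) {f : κ → Ω → ℝ}
    (hf : ∀ a ∈ s, HasMoments P (f a)) : HasMoments P (fun ω => ∑ a ∈ s, f a ω) := by
  classical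
  induction s using Finset.induction_on with
  | empty => simpa using HasMoments.const 0
  | insert a s ha ih =>
    simp only [Finset.sum_insert ha]
    exact (hf a (by simp)).add (ih fun b hb => hf b (by simp [hb]))

variable {n : Type*}

/-- A random matrix whose entries have all absolute moments. -/
def MatrixHasMoments (P : Measure Ω) (A : Ω → Matrix n n ℝ) : Prop :=
  ∀ i j, HasMoments P (fun ω => A ω i j)

theorem MatrixHasMoments.const [IsFiniteMeasure P] (C : Matrix n n ℝ) :
    MatrixHasMoments P (fun _ => C) := fun _ _ => HasMoments.const _

variable [Fintype n]

theorem MatrixHasMoments.mul [IsFiniteMeasure P] {A B : Ω → Matrix n n ℝ}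
    (hA : MatrixHasMoments P A) (hB : MatrixHasMoments P B) :
    MatrixHasMoments P (fun ω => A ω * B ω) := fun i j => by
  simp only [Matrix.mul_apply]
  exact HasMoments.sum _ fun k _ => (hA i k).mul (hB k j)

theorem MatrixHasMoments.pow [DecidableEq n] [IsFiniteMeasure P] {A : Ω → Matrix n n ℝ}
    (hA : MatrixHasMoments P A) (m : ℕ) : MatrixHasMoments P (fun ω => A ω ^ m) := by
  induction m with
  | zero => simpa using MatrixHasMoments.const 1
  | succ m ih => simpa only [pow_succ] using ih.mul hA

theorem MatrixHasMoments.trace [IsFiniteMeasure P] {A : Ω → Matrix n n ℝ}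
    (hA : MatrixHasMoments P A) : HasMoments P (fun ω => (A ω).trace) := by
  simp only [Matrix.trace, Matrix.diag_apply]
  exact HasMoments.sum _ fun i _ => hA i i

end Moments

/-! ### Matrix series with independent coefficients and their a priori bounds. -/

section Series

open Matrix
open scoped Matrix.Norms.L2Operator

variable {Ω : Type*} [MeasurableSpace Ω] {P : Measure Ω} {N : ℕ} {ι : Type*} [Fintype ι]

/-- The matrix series `∑ Z_α W_α`. -/
def series (Z : ι → Ω → ℝ) (W : ι → Matrix (Fin N) (Fin N) ℝ) (ω : Ω) :
    Matrix (Fin N) (Fin N) ℝ := ∑ α, Z α ω • W α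

/-- The matrix series `∑ Z_β W_β` without its `α`-th term. -/
def seriesErase [DecidableEq ι] (Z : ι → Ω → ℝ) (W : ι → Matrix (Fin N) (Fin N) ℝ) (α : ι) (ω : Ω) :
    Matrix (Fin N) (Fin N) ℝ := ∑ β ∈ Finset.univ.erase α, Z β ω • W β

/-- A series `∑ Z_α W_α` of fixed symmetric matrices `W_α` with independent centered coefficients
of unit variance, whose covariance is close to that of a Wigner matrix. The weight `w_α` bounds the
trace norm of `W_α`. -/
structure IsWignerSeries (P : Measure Ω) (K : ℝ) (M : ℕ → ℝ) (Z : ι → Ω → ℝ)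
    (W : ι → Matrix (Fin N) (Fin N) ℝ) (w : ι → ℝ) : Prop where
  one_le : 1 ≤ K
  measurable : ∀ α, Measurable (Z α)
  indep : iIndepFun Z P
  mean_zero : ∀ α, ∫ ω, Z α ω ∂P = 0
  second_moment : ∀ α, ∫ ω, Z α ω ^ 2 ∂P = 1
  integrable_pow : ∀ α k, Integrable (fun ω => |Z α ω| ^ k) P
  moment_le : ∀ α k, ∫ ω, |Z α ω| ^ k ∂P ≤ M k
  isHermitian : ∀ α, (W α).IsHermitian
  norm_le : ∀ α, ‖W α‖ ≤ w α
  abs_trace_mul_le : ∀ α X, |(W α * X).trace| ≤ w α * ‖X‖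
  weight_le : ∀ α, w α ≤ K / √N
  sum_sq_weight_le : ∑ α, w α ^ 2 ≤ K * N
  cov : ∀ X Y : Matrix (Fin N) (Fin N) ℝ,
    |∑ α, (W α * X * W α * Y).trace - X.trace * Y.trace / N| ≤ K * (‖X‖ * ‖Y‖)

namespace IsWignerSeries

variable {K : ℝ} {M : ℕ → ℝ} {Z : ι → Ω → ℝ} {W : ι → Matrix (Fin N) (Fin N) ℝ} {w : ι → ℝ}

theorem hasMoments (h : IsWignerSeries P K M Z W w) (α : ι) : HasMoments P (Z α) :=
  ⟨h.measurable α, h.integrable_pow α⟩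

theorem isHermitian_sum {κ : Type*} (s : Finset κ) (c : κ → ℝ) {V : κ → Matrix (Fin N) (Fin N) ℝ}
    (hV : ∀ a, (V a).IsHermitian) : (∑ a ∈ s, c a • V a).IsHermitian :=
  isSelfAdjoint_sum _ fun a _ => (hV a).smul (IsSelfAdjoint.all (c a))

theorem series_isHermitian (h : IsWignerSeries P K M Z W w) (ω : Ω) :
    (series Z W ω).IsHermitian := isHermitian_sum _ _ h.isHermitian

theorem weight_nonneg (h : IsWignerSeries P K M Z W w) (α : ι) : 0 ≤ w α :=
  (norm_nonneg _).trans (h.norm_le α)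

theorem weight_le_const (h : IsWignerSeries P K M Z W w) (hN : 0 < N) (α : ι) : w α ≤ K :=
  (h.weight_le α).trans (div_le_self (zero_le_one.trans h.one_le)
    (Real.one_le_sqrt.2 (by exact_mod_cast hN)))

theorem trace_mul_self_le (h : IsWignerSeries P K M Z W w) (α : ι) :
    (W α * W α).trace ≤ w α ^ 2 :=
  (le_abs_self _).trans <| (h.abs_trace_mul_le α (W α)).trans <| by
    rw [pow_two]; exact mul_le_mul_of_nonneg_left (h.norm_le α) (h.weight_nonneg α)

/-- The covariance condition with `X = 1` and `Y = A ^ (2 * l)`: its error is absorbed because the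
norm of an even power is at most its trace. -/
theorem sum_trace_mul_self_le (h : IsWignerSeries P K M Z W w) {A : Matrix (Fin N) (Fin N) ℝ}
    (hN : 0 < N) (hA : A.IsHermitian) (l : ℕ) :
    ∑ α, (W α * W α * A ^ (2 * l)).trace ≤ (1 + K) * (A ^ (2 * l)).trace := by
  have h1 := h.cov 1 (A ^ (2 * l))
  have hN' : (N : ℝ) ≠ 0 := by positivity
  simp only [mul_one, trace_one, Fintype.card_fin] at h1
  rw [mul_div_right_comm, div_self hN', one_mul] at h1
  have h2 : ‖(1 : Matrix (Fin N) (Fin N) ℝ)‖ ≤ 1 := by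
    refine l2_opNorm_le_of_forall zero_le_one fun v => ?_
    simp
  have h3 := l2_opNorm_pow_two_mul_le_trace hA l
  have h4 : ‖(1 : Matrix (Fin N) (Fin N) ℝ)‖ * ‖A ^ (2 * l)‖ ≤ 1 * (A ^ (2 * l)).trace := by
    gcongr
  have h5 := mul_le_mul_of_nonneg_left h4 (zero_le_one.trans h.one_le)
  linarith [le_abs_self (∑ α, (W α * W α * A ^ (2 * l)).trace - (A ^ (2 * l)).trace)]

theorem matrixHasMoments_sum (h : IsWignerSeries P K M Z W w) (s : Finset ι) [IsFiniteMeasure P] :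
    MatrixHasMoments P (fun ω => ∑ α ∈ s, Z α ω • W α) := fun i j => by
  simp only [Matrix.sum_apply, Matrix.smul_apply, smul_eq_mul]
  exact HasMoments.sum _ fun α _ => (h.hasMoments α).mul (HasMoments.const _)

theorem series_hasMoments (h : IsWignerSeries P K M Z W w) [IsFiniteMeasure P] :
    MatrixHasMoments P (series Z W) := h.matrixHasMoments_sum _

variable [DecidableEq ι]

theorem seriesErase_hasMoments (h : IsWignerSeries P K M Z W w) [IsFiniteMeasure P] (α : ι) :
    MatrixHasMoments P (seriesErase Z W α) := h.matrixHasMoments_sum _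

theorem seriesErase_isHermitian (h : IsWignerSeries P K M Z W w) (α : ι) (ω : Ω) :
    (seriesErase Z W α ω).IsHermitian := isHermitian_sum _ _ h.isHermitian

theorem series_eq_add {Ω : Type*} (Z : ι → Ω → ℝ) (W : ι → Matrix (Fin N) (Fin N) ℝ) (α : ι) (ω : Ω) :
    series Z W ω = seriesErase Z W α ω + Z α ω • W α := by
  rw [series, seriesErase, Finset.sum_erase_add _ _ (Finset.mem_univ α)]

/-- The erased series is a continuous function of the coefficients other than `Z α`, hence
independent of it. -/
theorem integral_mul_seriesErase (h : IsWignerSeries P K M Z W w) (α : ι) {f : ℝ → ℝ}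
    (hf : Continuous f) {g : Matrix (Fin N) (Fin N) ℝ → ℝ} (hg : Continuous g) :
    ∫ ω, f (Z α ω) * g (seriesErase Z W α ω) ∂P =
      (∫ ω, f (Z α ω) ∂P) * ∫ ω, g (seriesErase Z W α ω) ∂P := by
  set S : Finset ι := Finset.univ.erase α
  have hind := h.indep.indepFun_finset {α} S (by simp [S]) h.measurable
  let L : (S → ℝ) → ℝ := fun z => g (∑ β : S, z β • W β)
  have hL : Continuous L := by fun_prop
  have hLe : ∀ ω, L (fun β : S => Z β ω) = g (seriesErase Z W α ω) := fun ω => by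
    simp only [L, seriesErase]
    rw [← Finset.sum_coe_sort S (fun β => Z β ω • W β)]
  let e : ({α} : Finset ι) := ⟨α, by simp⟩
  have := hind.integral_fun_comp_mul_comp (f := fun z => f (z e)) (g := L)
    (measurable_pi_lambda _ fun a => h.measurable _).aemeasurable
    (measurable_pi_lambda _ fun a => h.measurable _).aemeasurable
    (Continuous.aestronglyMeasurable (by fun_prop)) hL.aestronglyMeasurable
  simpa only [hLe] using this

/-- `Z α` is not independent of the full series. One passes to the erased series pointwise, uses
independence and unit variance to remove `Z α ^ 2`, and returns to the full series. Each passage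
costs a moment of `Z α` times `w α ^ (2 * l + 2)`. -/
theorem integral_sq_mul_trace_add_le [IsProbabilityMeasure P] (h : IsWignerSeries P K M Z W w)
    (hN : 0 < N) (l : ℕ) (α : ι) :
    ∫ ω, Z α ω ^ 2 * ((W α * W α * series Z W ω ^ (2 * l)).trace +
        (W α * W α * seriesErase Z W α ω ^ (2 * l)).trace) ∂P ≤
      (4 * 16 ^ l + 1) * (4 * 16 ^ l) * (1 + M (2 * l) + M (2 * l + 2)) *
      (∫ ω, (W α * W α * series Z W ω ^ (2 * l)).trace ∂P + K ^ (2 * l) * w α ^ 2) := by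
  set c : ℝ := 4 * 16 ^ l with hc
  have hc1 : 1 ≤ c := by
    have : (1 : ℝ) ≤ 16 ^ l := one_le_pow₀ (by norm_num)
    linarith
  set v : ℝ := w α ^ (2 * l + 2) with hv
  have hw := h.weight_nonneg α
  have hv0 : 0 ≤ v := by positivity
  have hvK : v ≤ K ^ (2 * l) * w α ^ 2 := by
    rw [hv, pow_add]
    gcongr
    exact h.weight_le_const hN α
  set a : Ω → ℝ := fun ω => (W α * W α * series Z W ω ^ (2 * l)).trace with ha
  set b : Ω → ℝ := fun ω => (W α * W α * seriesErase Z W α ω ^ (2 * l)).trace with hb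
  have hZm := h.hasMoments α
  have ham : HasMoments P a :=
    ((MatrixHasMoments.const _).mul (h.series_hasMoments.pow _)).trace
  have hbm : HasMoments P b :=
    ((MatrixHasMoments.const _).mul ((h.seriesErase_hasMoments α).pow _)).trace
  have ha0 : ∀ ω, 0 ≤ a ω := fun ω =>
    trace_mul_self_mul_pow_nonneg (h.series_isHermitian ω) (h.isHermitian α) l
  have hab : ∀ ω, a ω ≤ c * (b ω + Z α ω ^ (2 * l) * v) := fun ω => by
    have := trace_mul_add_smul_pow_le (h.seriesErase_isHermitian α ω) (h.isHermitian α) hw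
      (h.trace_mul_self_le α) (Z α ω) l
    rwa [← series_eq_add] at this
  -- The same perturbation bound read backwards: the erased series is the full one perturbed with
  -- coefficient `-Z α ω`.
  have hba : ∀ ω, b ω ≤ c * (a ω + Z α ω ^ (2 * l) * v) := fun ω => by
    have := trace_mul_add_smul_pow_le (h.series_isHermitian ω) (h.isHermitian α) hw
      (h.trace_mul_self_le α) (-Z α ω) l
    rw [series_eq_add Z W α, neg_smul, add_neg_cancel_right, ← series_eq_add,
      (even_two_mul l).neg_pow] at this
    exact this
  have hM : ∀ m, ∫ ω, Z α ω ^ (2 * m) ∂P ≤ M (2 * m) := fun m => by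
    refine le_trans (le_of_eq (integral_congr_ae (ae_of_all _ fun ω => ?_))) (h.moment_le α (2 * m))
    simp [pow_mul]
  have hM0 : ∀ m, 0 ≤ M (2 * m) := fun m =>
    (integral_nonneg fun ω => by positivity).trans (h.moment_le α _)
  have hEb : ∫ ω, b ω ∂P ≤ c * (∫ ω, a ω ∂P + M (2 * l) * v) := by
    refine (integral_mono hbm.integrable
      ((ham.add ((hZm.pow _).mul (HasMoments.const v))).integrable.const_mul c) hba).trans ?_
    rw [integral_const_mul, integral_add ham.integrable
      ((hZm.pow _).mul (HasMoments.const v)).integrable, integral_mul_const]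
    gcongr
    exact hM l
  have hind : ∫ ω, Z α ω ^ 2 * b ω ∂P = ∫ ω, b ω ∂P := by
    rw [h.integral_mul_seriesErase α (f := fun z => z ^ 2)
      (g := fun B => (W α * W α * B ^ (2 * l)).trace) (by fun_prop) (by fun_prop),
      h.second_moment, one_mul]
  have h1 : ∫ ω, Z α ω ^ 2 * (a ω + b ω) ∂P ≤ (c + 1) * ∫ ω, b ω ∂P + c * (M (2 * l + 2) * v) := by
    have h2 : ∀ ω, Z α ω ^ 2 * (a ω + b ω) ≤
        (c + 1) * (Z α ω ^ 2 * b ω) + c * (Z α ω ^ (2 * (l + 1)) * v) := fun ω => by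
      have := mul_le_mul_of_nonneg_left (hab ω) (sq_nonneg (Z α ω))
      calc _ ≤ Z α ω ^ 2 * (c * (b ω + Z α ω ^ (2 * l) * v)) + Z α ω ^ 2 * b ω := by linarith
        _ = _ := by ring
    have i1 := (((hZm.pow 2).mul hbm).integrable.const_mul (c + 1))
    have i2 := ((hZm.pow (2 * (l + 1))).mul (HasMoments.const v)).integrable.const_mul c
    refine (integral_mono ((hZm.pow 2).mul (ham.add hbm)).integrable (i1.add i2) h2).trans ?_
    rw [integral_add' i1 i2, integral_const_mul, integral_const_mul, integral_mul_const, hind]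
    gcongr
    exact hM (l + 1)
  have hEa : 0 ≤ ∫ ω, a ω ∂P := integral_nonneg ha0
  have hm1 := hM0 l
  have hm2 : 0 ≤ M (2 * l + 2) := hM0 (l + 1)
  set m1 := M (2 * l)
  set m2 := M (2 * l + 2)
  set Ea := ∫ ω, a ω ∂P
  set Eb := ∫ ω, b ω ∂P
  set q := K ^ (2 * l) * w α ^ 2
  have hq : 0 ≤ q := hv0.trans hvK
  calc _ ≤ (c + 1) * Eb + c * (m2 * v) := h1
    _ ≤ (c + 1) * (c * (Ea + m1 * v)) + c * (m2 * v) := by gcongr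
    _ ≤ (c + 1) * (c * (Ea + m1 * q)) + (c + 1) * c * (m2 * q) := by
        gcongr
        nlinarith
    _ = (c + 1) * c * (Ea + (m1 + m2) * q) := by ring
    _ ≤ (c + 1) * c * ((1 + m1 + m2) * (Ea + q)) := by
        gcongr
        nlinarith [mul_nonneg hm1 hEa, mul_nonneg hm2 hEa]
    _ = _ := by ring

/-- A priori bound for the even moments. -/
theorem exists_integral_trace_pow_le (K : ℝ) (M : ℕ → ℝ) (l : ℕ) :
    ∃ D : ℝ, 1 ≤ D ∧ ∀ {Ω : Type*} [MeasurableSpace Ω] (P : Measure Ω) [IsProbabilityMeasure P]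
      {N : ℕ} {ι : Type} [Fintype ι] {Z : ι → Ω → ℝ} {W : ι → Matrix (Fin N) (Fin N) ℝ}
      {w : ι → ℝ}, IsWignerSeries P K M Z W w → 0 < N →
      ∫ ω, (series Z W ω ^ (2 * l)).trace ∂P ≤ D * N := by
  induction l with
  | zero => exact ⟨1, le_rfl, fun P _ => by simp⟩
  | succ l ih =>
    obtain ⟨D, hD, ih⟩ := ih
    set C : ℝ := (4 * 16 ^ l + 1) * (4 * 16 ^ l) * (1 + M (2 * l) + M (2 * l + 2)) with hC
    -- `2 * l + 1` counts telescoping terms, `C` is the leave-one-out cost, `(1 + K) * D` comes from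
    -- the covariance and the induction hypothesis, and the last summand from the squared weights.
    refine ⟨max 1 ((2 * l + 1) * (C * ((1 + K) * D + K ^ (2 * l) * K))), le_max_left _ _, ?_⟩
    intro Ω _ P _ N ι _ Z W w h hN
    classical
    have hAm := h.series_hasMoments
    have hK := h.one_le
    -- Substitute for integration by parts: the term with the erased series has mean zero, so it may
    -- be subtracted. The telescoped difference releases a second factor `Z α • W α`.
    have hterm : ∀ α, ∫ ω, Z α ω * (W α * series Z W ω ^ (2 * l + 1)).trace ∂P ≤
        (2 * l + 1) * (C * (∫ ω, (W α * W α * series Z W ω ^ (2 * l)).trace ∂P +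
          K ^ (2 * l) * w α ^ 2)) := by
      intro α
      have hBm := h.seriesErase_hasMoments α
      have hZm := h.hasMoments α
      have h0 : ∫ ω, Z α ω * (W α * seriesErase Z W α ω ^ (2 * l + 1)).trace ∂P = 0 := by
        rw [h.integral_mul_seriesErase α (f := fun z => z)
          (g := fun B => (W α * B ^ (2 * l + 1)).trace) (by fun_prop) (by fun_prop),
          h.mean_zero, zero_mul]
      have hcm : MatrixHasMoments P (fun _ => W α) := MatrixHasMoments.const _
      have i1 := (hZm.mul (hcm.mul (hAm.pow (2 * l + 1))).trace).integrable
      have i2 := (hZm.mul (hcm.mul (hBm.pow (2 * l + 1))).trace).integrable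
      rw [← sub_zero (∫ ω, Z α ω * (W α * series Z W ω ^ (2 * l + 1)).trace ∂P), ← h0,
        ← integral_sub i1 i2]
      have i3 := ((hZm.pow 2).mul ((((hcm.mul hcm).mul (hAm.pow (2 * l))).trace).add
        (((hcm.mul hcm).mul (hBm.pow (2 * l))).trace))).integrable
      refine (integral_mono (i1.sub i2) (i3.const_mul (2 * l + 1)) fun ω => ?_).trans ?_
      · have h1 := pow_sub_pow_eq_sum (series Z W ω) (seriesErase Z W α ω) (2 * l + 1)
        have h2 : series Z W ω - seriesErase Z W α ω = Z α ω • W α := by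
          rw [series_eq_add Z W α, add_sub_cancel_left]
        simp only [Pi.sub_apply]
        rw [← mul_sub, ← trace_sub, ← mul_sub, h1, h2, Finset.mul_sum, trace_sum, Finset.mul_sum]
        have h3 : ∀ i ∈ Finset.range (2 * l + 1), Z α ω * (W α * (series Z W ω ^ i * Z α ω • W α *
            seriesErase Z W α ω ^ (2 * l + 1 - 1 - i))).trace ≤
            Z α ω ^ 2 * ((W α * W α * series Z W ω ^ (2 * l)).trace +
              (W α * W α * seriesErase Z W α ω ^ (2 * l)).trace) := by
          intro i hi
          have hi := Finset.mem_range.1 hi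
          have h4 := abs_trace_mul_pow_mul_pow_le (h.series_isHermitian ω)
            (h.seriesErase_isHermitian α ω) (h.isHermitian α) (i := i) (j := 2 * l + 1 - 1 - i)
            (l := l) (by omega)
          have h5 : Z α ω * (W α * (series Z W ω ^ i * Z α ω • W α *
            seriesErase Z W α ω ^ (2 * l + 1 - 1 - i))).trace = Z α ω ^ 2 *
              (W α * series Z W ω ^ i * W α * seriesErase Z W α ω ^ (2 * l + 1 - 1 - i)).trace := by
            simp only [mul_smul_comm, smul_mul_assoc, trace_smul, smul_eq_mul, mul_assoc]
            ring
          rw [h5]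
          exact mul_le_mul_of_nonneg_left ((le_abs_self _).trans h4) (sq_nonneg _)
        refine (Finset.sum_le_sum h3).trans (le_of_eq ?_)
        rw [Finset.sum_const, Finset.card_range, nsmul_eq_mul]
        push_cast
        ring
      · rw [integral_const_mul]
        exact mul_le_mul_of_nonneg_left (h.integral_sq_mul_trace_add_le hN l α) (by positivity)
    have h1 : ∀ ω, (series Z W ω ^ (2 * (l + 1))).trace =
        ∑ α, Z α ω * (W α * series Z W ω ^ (2 * l + 1)).trace := fun ω => by
      rw [show 2 * (l + 1) = (2 * l + 1) + 1 by ring, pow_succ']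
      nth_rewrite 1 [series]
      simp [Finset.sum_mul, trace_sum]
    simp only [h1]
    have hcm : ∀ α, MatrixHasMoments P (fun _ => W α) := fun α => MatrixHasMoments.const _
    rw [integral_finsetSum _ fun α _ =>
      ((h.hasMoments α).mul ((hcm α).mul (hAm.pow (2 * l + 1))).trace).integrable]
    refine (Finset.sum_le_sum fun α _ => hterm α).trans ?_
    rw [← Finset.mul_sum, ← Finset.mul_sum, Finset.sum_add_distrib, ← Finset.mul_sum,
      ← integral_finsetSum _ fun α _ =>
        ((((hcm α).mul (hcm α)).mul (hAm.pow (2 * l))).trace).integrable]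
    have h2 : ∫ ω, ∑ α, (W α * W α * series Z W ω ^ (2 * l)).trace ∂P ≤ (1 + K) * (D * N) := by
      refine (integral_mono (HasMoments.sum _ fun α _ =>
        (((hcm α).mul (hcm α)).mul (hAm.pow (2 * l))).trace).integrable
        ((hAm.pow (2 * l)).trace.integrable.const_mul (1 + K))
        fun ω => h.sum_trace_mul_self_le hN (h.series_isHermitian ω) l).trans ?_
      rw [integral_const_mul]
      exact mul_le_mul_of_nonneg_left (ih P h hN) (by linarith)
    have h3 := h.sum_sq_weight_le
    -- Without any coefficient nothing forces `M` to be nonnegative, so the sign of `C` is available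
    -- only for nonempty `ι`.
    rcases isEmpty_or_nonempty ι with he | ⟨⟨α⟩⟩
    · simp
    have hM0 : ∀ m, 0 ≤ M m := fun m =>
      (integral_nonneg fun ω => by positivity).trans (h.moment_le α m)
    have hC0 : 0 ≤ C := by
      have := hM0 (2 * l)
      have := hM0 (2 * l + 2)
      positivity
    calc _ ≤ (2 * l + 1) * (C * ((1 + K) * (D * N) + K ^ (2 * l) * (K * N))) := by gcongr
      _ = (2 * l + 1) * (C * ((1 + K) * D + K ^ (2 * l) * K)) * N := by ring
      _ ≤ _ := by
        gcongr
        exact le_max_right _ _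

end IsWignerSeries

end Series

/-! ### Deterministic first-order expansion in one coefficient. -/

section Pointwise

open Matrix
open scoped Matrix.Norms.L2Operator

variable {N : ℕ}

/-- The normalized moment `N⁻¹ tr Aᵏ`. -/
noncomputable def trMoment (A : Matrix (Fin N) (Fin N) ℝ) (k : ℕ) : ℝ := (A ^ k).trace / N

theorem l2_opNorm_one_le {n : Type*} [Fintype n] [DecidableEq n] :
    ‖(1 : Matrix n n ℝ)‖ ≤ 1 :=
  l2_opNorm_le_of_forall zero_le_one fun v => by simp

theorem l2_opNorm_pow_le {n : Type*} [Fintype n] [DecidableEq n] {A : Matrix n n ℝ} {R : ℝ}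
    (hA : ‖A‖ ≤ R) (m : ℕ) : ‖A ^ m‖ ≤ R ^ m := by
  induction m with
  | zero => simpa using l2_opNorm_one_le
  | succ m ih =>
    rw [pow_succ, pow_succ]
    exact (norm_mul_le _ _).trans (mul_le_mul ih hA (norm_nonneg _)
      (pow_nonneg ((norm_nonneg _).trans hA) _))

theorem norm_pow_mul_mul_pow_le {n : Type*} [Fintype n] [DecidableEq n] {A B W : Matrix n n ℝ}
    {R w : ℝ} (hA : ‖A‖ ≤ R) (hB : ‖B‖ ≤ R) (hW : ‖W‖ ≤ w) (i j : ℕ) :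
    ‖A ^ i * W * B ^ j‖ ≤ w * R ^ (i + j) := by
  have hR := (norm_nonneg _).trans hA
  calc ‖A ^ i * W * B ^ j‖ ≤ ‖A ^ i‖ * ‖W‖ * ‖B ^ j‖ :=
        (norm_mul_le _ _).trans (mul_le_mul_of_nonneg_right (norm_mul_le _ _) (norm_nonneg _))
    _ ≤ R ^ i * w * R ^ j := by
        gcongr
        · exact mul_nonneg (by positivity) ((norm_nonneg _).trans hW)
        · exact l2_opNorm_pow_le hA i
        · exact l2_opNorm_pow_le hB j
    _ = _ := by ring

theorem norm_pow_sub_pow_le {n : Type*} [Fintype n] [DecidableEq n] {A B W : Matrix n n ℝ}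
    {R w z : ℝ} (hA : ‖A‖ ≤ R) (hB : ‖B‖ ≤ R) (hW : ‖W‖ ≤ w) (hAB : A = B + z • W) (hR : 1 ≤ R)
    (i : ℕ) : ‖A ^ i - B ^ i‖ ≤ i * |z| * w * R ^ i := by
  have hw := (norm_nonneg _).trans hW
  rw [pow_sub_pow_eq_sum, show A - B = z • W by rw [hAB, add_sub_cancel_left]]
  refine (norm_sum_le _ _).trans ?_
  have : ∀ l ∈ Finset.range i, ‖A ^ l * z • W * B ^ (i - 1 - l)‖ ≤ |z| * (w * R ^ i) := by
    intro l hl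
    have hl := Finset.mem_range.1 hl
    rw [mul_smul_comm, smul_mul_assoc, norm_smul, Real.norm_eq_abs]
    gcongr
    refine (norm_pow_mul_mul_pow_le hA hB hW _ _).trans ?_
    gcongr
    omega
  refine (Finset.sum_le_sum this).trans (le_of_eq ?_)
  rw [Finset.sum_const, Finset.card_range, nsmul_eq_mul]
  ring

/-- The sum `∑_{i+j=n-1} tr (W Aⁱ W Bʲ)`. -/
noncomputable def mixedTrace (W A B : Matrix (Fin N) (Fin N) ℝ) (n : ℕ) : ℝ :=
  ∑ i ∈ Finset.range n, (W * A ^ i * W * B ^ (n - 1 - i)).trace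

/-- A bound for the trace pairing with `W` and the operator norm of `W`. -/
structure TraceNormLE (W : Matrix (Fin N) (Fin N) ℝ) (w : ℝ) : Prop where
  norm_le : ‖W‖ ≤ w
  abs_trace_mul_le : ∀ X, |(W * X).trace| ≤ w * ‖X‖

section

variable {A B W : Matrix (Fin N) (Fin N) ℝ} {R w z κ : ℝ}

theorem TraceNormLE.nonneg (hW : TraceNormLE W w) : 0 ≤ w := (norm_nonneg _).trans hW.norm_le

/-- `mixedTrace` is the exact difference quotient in `z`, so no Taylor remainder appears at this
stage. -/
theorem trace_mul_pow_sub_eq (hAB : A = B + z • W) (n : ℕ) :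
    (W * A ^ n).trace - (W * B ^ n).trace = z * mixedTrace W A B n := by
  rw [← trace_sub, ← mul_sub, pow_sub_pow_eq_sum, show A - B = z • W by
    rw [hAB, add_sub_cancel_left], Finset.mul_sum, trace_sum, mixedTrace, Finset.mul_sum]
  refine Finset.sum_congr rfl fun i _ => ?_
  simp only [mul_smul_comm, smul_mul_assoc, trace_smul, smul_eq_mul, mul_assoc]

/-- One `W` is paired through its trace norm and the other enters through its operator norm; this
gives `w ^ 2` with no factor of the dimension. -/
theorem abs_mixedTrace_le (hW : TraceNormLE W w) (hA : ‖A‖ ≤ R) (hB : ‖B‖ ≤ R) (hR : 1 ≤ R)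
    (n : ℕ) : |mixedTrace W A B n| ≤ n * w ^ 2 * R ^ n := by
  have hw := hW.nonneg
  refine (Finset.abs_sum_le_sum_abs _ _).trans ?_
  have : ∀ i ∈ Finset.range n, |(W * A ^ i * W * B ^ (n - 1 - i)).trace| ≤ w ^ 2 * R ^ n := by
    intro i hi
    have hi := Finset.mem_range.1 hi
    rw [mul_assoc, mul_assoc, ← mul_assoc (A ^ i)]
    have h1 : ‖A ^ i * W * B ^ (n - 1 - i)‖ ≤ w * R ^ n := by
      refine (norm_pow_mul_mul_pow_le hA hB hW.norm_le _ _).trans ?_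
      gcongr
      omega
    exact (hW.abs_trace_mul_le _).trans ((mul_le_mul_of_nonneg_left h1 hw).trans
      (le_of_eq (by ring)))
  refine (Finset.sum_le_sum this).trans (le_of_eq ?_)
  rw [Finset.sum_const, Finset.card_range, nsmul_eq_mul]
  ring

theorem norm_mul_mul_le {n : Type*} [Fintype n] [DecidableEq n] {X Y V : Matrix n n ℝ}
    {x y v : ℝ} (hX : ‖X‖ ≤ x) (hV : ‖V‖ ≤ v) (hY : ‖Y‖ ≤ y) : ‖X * (V * Y)‖ ≤ x * (v * y) := by
  have hx := (norm_nonneg _).trans hX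
  have hv := (norm_nonneg _).trans hV
  refine (norm_mul_le _ _).trans (mul_le_mul hX ?_ (norm_nonneg _) hx)
  exact (norm_mul_le _ _).trans (mul_le_mul hV hY (norm_nonneg _) hv)

/-- Exchanging a power of `A` for one of `B` releases a third `W`, hence the factor `w ^ 3`. The two
bounds link the pairs `B, B` to `A, B` and `A, B` to `A, A`. -/
theorem abs_mixedTrace_sub_le (hW : TraceNormLE W w) (hA : ‖A‖ ≤ R) (hB : ‖B‖ ≤ R) (hR : 1 ≤ R)
    (hAB : A = B + z • W) (n : ℕ) :
    |mixedTrace W A B n - mixedTrace W B B n| ≤ n * (n * |z| * w ^ 3 * R ^ n) ∧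
    |mixedTrace W A A n - mixedTrace W A B n| ≤ n * (n * |z| * w ^ 3 * R ^ n) := by
  have hw := hW.nonneg
  have key : ∀ i, i < n → ∀ X Y : Matrix (Fin N) (Fin N) ℝ, ∀ a b : ℕ, ‖X‖ ≤ R ^ a * (|z| * n * w) →
      ‖Y‖ ≤ R ^ b → a + b ≤ n → |(W * (X * (W * Y))).trace| ≤ n * |z| * w ^ 3 * R ^ n ∧
        |(W * (Y * (W * X))).trace| ≤ n * |z| * w ^ 3 * R ^ n := by
    intro i hi X Y a b hX hY hab
    have h1 : R ^ a * R ^ b ≤ R ^ n := by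
      rw [← pow_add]; exact pow_le_pow_right₀ hR hab
    have h2 : 0 ≤ n * |z| * w ^ 3 := by positivity
    constructor
    · refine (hW.abs_trace_mul_le _).trans ?_
      calc _ ≤ w * (R ^ a * (|z| * n * w) * (w * R ^ b)) :=
            mul_le_mul_of_nonneg_left (norm_mul_mul_le hX hW.norm_le hY) hw
        _ = n * |z| * w ^ 3 * (R ^ a * R ^ b) := by ring
        _ ≤ _ := mul_le_mul_of_nonneg_left h1 h2
    · refine (hW.abs_trace_mul_le _).trans ?_
      calc _ ≤ w * (R ^ b * (w * (R ^ a * (|z| * n * w)))) :=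
            mul_le_mul_of_nonneg_left (norm_mul_mul_le hY hW.norm_le hX) hw
        _ = n * |z| * w ^ 3 * (R ^ a * R ^ b) := by ring
        _ ≤ _ := mul_le_mul_of_nonneg_left h1 h2
  have hd : ∀ i, i ≤ n → ‖A ^ i - B ^ i‖ ≤ R ^ i * (|z| * n * w) := by
    intro i hi
    refine (norm_pow_sub_pow_le hA hB hW.norm_le hAB hR i).trans ?_
    have : (i : ℝ) ≤ n := by exact_mod_cast hi
    calc _ = R ^ i * (|z| * i * w) := by ring
      _ ≤ _ := by gcongr
  constructor
  · rw [mixedTrace, mixedTrace, ← Finset.sum_sub_distrib]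
    refine (Finset.abs_sum_le_sum_abs _ _).trans ?_
    refine (Finset.sum_le_card_nsmul _ _ (n * |z| * w ^ 3 * R ^ n) fun i hi => ?_).trans
      (le_of_eq ?_)
    · have hi := Finset.mem_range.1 hi
      rw [← trace_sub, ← sub_mul, ← sub_mul, ← mul_sub, mul_assoc, mul_assoc]
      exact (key i hi _ _ _ _ (hd i hi.le) (l2_opNorm_pow_le hB _) (by omega)).1
    · rw [Finset.card_range, nsmul_eq_mul]
  · rw [mixedTrace, mixedTrace, ← Finset.sum_sub_distrib]
    refine (Finset.abs_sum_le_sum_abs _ _).trans ?_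
    refine (Finset.sum_le_card_nsmul _ _ (n * |z| * w ^ 3 * R ^ n) fun i hi => ?_).trans
      (le_of_eq ?_)
    · have hi := Finset.mem_range.1 hi
      rw [← trace_sub, ← mul_sub, mul_assoc, mul_assoc]
      exact (key i hi _ _ _ _ (hd (n - 1 - i) (by omega)) (l2_opNorm_pow_le hA i) (by omega)).2
    · rw [Finset.card_range, nsmul_eq_mul]

theorem abs_trMoment_le (hN : 0 < N) (hA : ‖A‖ ≤ R) (k : ℕ) : |trMoment A k| ≤ R ^ k := by
  have hN' : (0 : ℝ) < N := by exact_mod_cast hN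
  rw [trMoment, abs_div, Nat.abs_cast, div_le_iff₀ hN', mul_comm]
  refine (abs_trace_le_card_mul_norm _).trans ?_
  rw [Fintype.card_fin]
  gcongr
  exact l2_opNorm_pow_le hA k

/-- The perturbation is small in trace norm, so the normalized moment moves only by order `w / N`.
The factor `trMoment A (n + 1) - c` is therefore constant to leading order. -/
theorem abs_trMoment_sub_le (hW : TraceNormLE W w) (hA : ‖A‖ ≤ R) (hB : ‖B‖ ≤ R) (hR : 1 ≤ R)
    (hAB : A = B + z • W) (k : ℕ) :
    |trMoment A k - trMoment B k| ≤ k * |z| * w * R ^ k / N := by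
  have hw := hW.nonneg
  rw [trMoment, trMoment, ← sub_div, abs_div, Nat.abs_cast]
  gcongr
  rw [← trace_sub, pow_sub_pow_eq_sum, show A - B = z • W by rw [hAB, add_sub_cancel_left],
    trace_sum]
  refine (Finset.abs_sum_le_sum_abs _ _).trans ?_
  refine (Finset.sum_le_card_nsmul _ _ (|z| * (w * R ^ k)) fun i hi => ?_).trans (le_of_eq ?_)
  · have hi := Finset.mem_range.1 hi
    rw [mul_smul_comm, smul_mul_assoc, trace_smul, smul_eq_mul, abs_mul, mul_assoc, trace_mul_comm,
      mul_assoc]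
    gcongr
    refine (hW.abs_trace_mul_le _).trans ?_
    gcongr
    calc _ ≤ ‖B ^ (k - 1 - i)‖ * ‖A ^ i‖ := norm_mul_le _ _
      _ ≤ R ^ (k - 1 - i) * R ^ i := by
        gcongr
        · exact l2_opNorm_pow_le hB _
        · exact l2_opNorm_pow_le hA _
      _ ≤ R ^ k := by
        rw [← pow_add]
        exact pow_le_pow_right₀ hR (by omega)
  · rw [Finset.card_range, nsmul_eq_mul]
    ring

set_option maxHeartbeats 1000000 in
/-- The first order expansion of `z ↦ z tr (W Aⁿ) (N⁻¹ tr Aⁿ⁺¹ - c)`, `A = B + z W`, and the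
replacement of `B` by `A` in the leading term. -/
theorem expansion_le (hN : 0 < N) (hW : TraceNormLE W w) (hA : ‖A‖ ≤ R) (hB : ‖B‖ ≤ R)
    (hR : 1 ≤ R) (hAB : A = B + z • W) (hwκ : w ≤ κ) (hNκ : 1 / (N : ℝ) ≤ κ) (c : ℝ) (n : ℕ) :
    |z * ((W * A ^ n).trace * (trMoment A (n + 1) - c) -
        (W * B ^ n).trace * (trMoment B (n + 1) - c)) -
      z ^ 2 * (mixedTrace W B B n * (trMoment B (n + 1) - c))| ≤
      (n + 1) ^ 2 * (3 + 2 * |c|) * w ^ 2 * κ * (R ^ (2 * (n + 1)) * (1 + |z|) ^ 3) ∧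
    |mixedTrace W A A n * (trMoment A (n + 1) - c) - mixedTrace W B B n * (trMoment B (n + 1) - c)| ≤
      (n + 1) ^ 2 * (3 + 2 * |c|) * w ^ 2 * κ * (R ^ (2 * (n + 1)) * (1 + |z|) ^ 3) := by
  have hw := hW.nonneg
  have hκ : 0 ≤ κ := hw.trans hwκ
  have hN' : (1 : ℝ) ≤ N := by exact_mod_cast hN
  set Q : ℝ := R ^ (n + 1) with hQ
  have hRQ : R ^ n ≤ Q := pow_le_pow_right₀ hR (Nat.le_succ n)
  have hQ1 : 1 ≤ Q := one_le_pow₀ hR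
  have hRn : 0 ≤ R ^ n := by positivity
  have hQ2 : R ^ (2 * (n + 1)) = Q * Q := by rw [hQ, ← pow_add, two_mul]
  set m : ℝ := n + 1 with hm
  have hm0 : 0 ≤ m := by positivity
  have hnm : (n : ℝ) ≤ m := by linarith
  set gA := trMoment A (n + 1) - c
  set gB := trMoment B (n + 1) - c
  set y := |z|
  have hy : 0 ≤ y := abs_nonneg z
  have hc := abs_nonneg c
  obtain ⟨s1, s2⟩ := abs_mixedTrace_sub_le hW hA hB hR hAB n
  have s3 := abs_mixedTrace_le hW hB hB hR n
  have t1 := trace_mul_pow_sub_eq hAB n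
  have t2 : |(W * B ^ n).trace| ≤ w * Q :=
    (hW.abs_trace_mul_le _).trans (mul_le_mul_of_nonneg_left
      ((l2_opNorm_pow_le hB n).trans hRQ) hw)
  have g1 : |gA| ≤ (1 + |c|) * Q := by
    refine (abs_sub _ _).trans ?_
    have := abs_trMoment_le hN hA (n + 1)
    nlinarith
  have g2 : |gA - gB| ≤ m * y * Q * (w * (1 / N)) := by
    have := abs_trMoment_sub_le hW hA hB hR hAB (n + 1)
    rw [show gA - gB = trMoment A (n + 1) - trMoment B (n + 1) by ring]
    refine this.trans (le_of_eq ?_)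
    push_cast
    ring
  have g3 : |gA - gB| ≤ m * y * Q * κ := by
    refine g2.trans (mul_le_mul_of_nonneg_left ?_ (by positivity))
    calc w * (1 / N) ≤ w * 1 := by
          gcongr
          rw [div_le_one (by linarith)]
          exact hN'
      _ ≤ κ := by linarith
  -- Two forms of one bound: `g3` multiplies a mixed trace, which already carries `w ^ 2`, while
  -- `g4` multiplies a trace with a single `w` and must supply the second.
  have g4 : |gA - gB| ≤ m * y * Q * (w * κ) :=
    g2.trans (mul_le_mul_of_nonneg_left (by gcongr) (by positivity))
  set SAA := mixedTrace W A A n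
  set SAB := mixedTrace W A B n
  set SBB := mixedTrace W B B n
  have w3 : (n : ℝ) * (n * y * w ^ 3 * R ^ n) ≤ m ^ 2 * y * w ^ 2 * κ * Q := by
    calc (n : ℝ) * (n * y * w ^ 3 * R ^ n) = (n * n) * y * w ^ 2 * w * R ^ n := by ring
      _ ≤ (m * m) * y * w ^ 2 * κ * Q := by gcongr
      _ = _ := by ring
  have s1' := s1.trans w3
  have s2' : |SAA - SBB| ≤ 2 * (m ^ 2 * y * w ^ 2 * κ * Q) := by
    have := abs_add_le (SAA - SAB) (SAB - SBB)
    rw [sub_add_sub_cancel] at this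
    linarith [s2.trans w3]
  have s3' : |SBB| ≤ m * w ^ 2 * Q := s3.trans (by gcongr)
  set E := m ^ 2 * w ^ 2 * κ * (Q * Q) with hE
  have hE0 : 0 ≤ E := by positivity
  have p1 : |(SAB - SBB) * gA| ≤ y * (1 + |c|) * E := by
    rw [abs_mul]
    calc _ ≤ (m ^ 2 * y * w ^ 2 * κ * Q) * ((1 + |c|) * Q) := by gcongr
      _ = _ := by ring
  have p2 : |SBB * (gA - gB)| ≤ y * E := by
    rw [abs_mul]
    calc _ ≤ (m * w ^ 2 * Q) * (m * y * Q * κ) := by gcongr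
      _ = _ := by ring
  have p3 : |(W * B ^ n).trace * (gA - gB)| ≤ y * E := by
    rw [abs_mul]
    calc _ ≤ (w * Q) * (m * y * Q * (w * κ)) := by gcongr
      _ = 1 * (m * (y * w ^ 2 * κ * (Q * Q))) := by ring
      _ ≤ m * (m * (y * w ^ 2 * κ * (Q * Q))) := by
        gcongr
        rw [hm]; linarith [(Nat.cast_nonneg n : (0 : ℝ) ≤ n)]
      _ = _ := by ring
  have p4 : |(SAA - SBB) * gA| ≤ 2 * y * (1 + |c|) * E := by
    rw [abs_mul]
    calc _ ≤ (2 * (m ^ 2 * y * w ^ 2 * κ * Q)) * ((1 + |c|) * Q) := by gcongr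
      _ = _ := by ring
  have target : m ^ 2 * (3 + 2 * |c|) * w ^ 2 * κ * (R ^ (2 * (n + 1)) * (1 + y) ^ 3) =
      (3 + 2 * |c|) * (1 + y) ^ 3 * E := by rw [hQ2, hE]; ring
  rw [target]
  have y1 : y ≤ (1 + y) ^ 3 := by nlinarith [pow_nonneg hy 2, pow_nonneg hy 3]
  have y2 : y ^ 2 ≤ (1 + y) ^ 3 := by nlinarith [pow_nonneg hy 2, pow_nonneg hy 3]
  have y3 : y ^ 3 ≤ (1 + y) ^ 3 := by gcongr; linarith
  have q1 : y ^ 3 * (2 + |c|) + y ^ 2 ≤ (3 + 2 * |c|) * (1 + y) ^ 3 := by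
    have := mul_le_mul_of_nonneg_right y3 (by positivity : 0 ≤ 2 + |c|)
    have := mul_nonneg hc (by positivity : 0 ≤ (1 + y) ^ 3)
    linarith
  have q2 : y * (3 + 2 * |c|) ≤ (3 + 2 * |c|) * (1 + y) ^ 3 := by
    rw [mul_comm]
    exact mul_le_mul_of_nonneg_left y1 (by positivity)
  constructor
  -- An exact product rule: beyond the leading term `z ^ 2 * (SBB * gB)`, each summand contains one
  -- more small difference.
  · have e1 : z * ((W * A ^ n).trace * gA - (W * B ^ n).trace * gB) - z ^ 2 * (SBB * gB) =
        z ^ 2 * ((SAB - SBB) * gA) + z ^ 2 * (SBB * (gA - gB)) +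
          z * ((W * B ^ n).trace * (gA - gB)) := by
      rw [sub_eq_iff_eq_add] at t1
      rw [t1]
      ring
    rw [e1]
    have hz2 : |z ^ 2| = y ^ 2 := abs_pow z 2
    refine (abs_add_three _ _ _).trans ?_
    rw [abs_mul (z ^ 2), abs_mul (z ^ 2), abs_mul z, hz2]
    calc _ ≤ y ^ 2 * (y * (1 + |c|) * E) + y ^ 2 * (y * E) + y * (y * E) := by gcongr
      _ = (y ^ 3 * (2 + |c|) + y ^ 2) * E := by ring
      _ ≤ _ := by
        exact mul_le_mul_of_nonneg_right q1 hE0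
  · have e2 : SAA * gA - SBB * gB = (SAA - SBB) * gA + SBB * (gA - gB) := by ring
    rw [e2]
    refine (abs_add_le _ _).trans ?_
    calc _ ≤ 2 * y * (1 + |c|) * E + y * E := by gcongr
      _ = (y * (3 + 2 * |c|)) * E := by ring
      _ ≤ _ := by
        exact mul_le_mul_of_nonneg_right q2 hE0

end

theorem pow_le_one_add_pow {x : ℝ} (hx : 0 ≤ x) {a b : ℕ} (hab : a ≤ b) : x ^ a ≤ 1 + x ^ b := by
  rcases le_total x 1 with h | h
  · linarith [pow_le_one₀ (n := a) hx h, pow_nonneg hx b]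
  · linarith [pow_le_pow_right₀ h hab]

/-- Powers of the operator norm are `O(N^{1/4})` up to high moments. -/
theorem exists_one_add_norm_pow_le (m : ℕ) (K : ℝ) (hK : 0 ≤ K) : ∃ (C : ℝ) (L : ℕ), 0 ≤ C ∧
    ∀ {N : ℕ} {A : Matrix (Fin N) (Fin N) ℝ} (y : ℝ), 0 < N → A.IsHermitian → 0 ≤ y →
      (1 + ‖A‖ + K * y) ^ m ≤
        C * √√N * (1 + (A ^ (2 * L)).trace / N + y ^ (4 * m)) := by
  -- The norm is needed to the power `4 * m`; the trace bound is available at the larger exponent `2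
  -- ^ (4 * m + 1)`, which is `2 * L`.
  refine ⟨1 + 3 ^ (4 * m) * (2 + K ^ (4 * m)), 2 ^ (4 * m), by positivity, ?_⟩
  intro N A y hN hA hy
  have hN' : (1 : ℝ) ≤ N := by exact_mod_cast hN
  have hN0 : (0 : ℝ) < N := by linarith
  set q : ℝ := √√N with hq
  have hq4 : q ^ 4 = N := by
    rw [show 4 = 2 * 2 by rfl, pow_mul, Real.sq_sqrt (by positivity), Real.sq_sqrt hN0.le]
  have hq0 : 0 < q := by positivity
  set x := ‖A‖
  have hx : 0 ≤ x := norm_nonneg A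
  set R := 1 + x + K * y with hR
  have hR0 : 0 ≤ R := by positivity
  have hT := trace_pow_two_mul_nonneg hA (2 ^ (4 * m))
  -- With `q ^ 4 = N`, this is `u ≤ 1 + u ^ 4` for `u = R ^ m / q`. The division by `N` pays for
  -- bounding a norm by an unnormalized trace.
  have h1 : R ^ m ≤ q * (1 + R ^ (4 * m) / N) := by
    have := pow_le_one_add_pow (x := R ^ m / q) (by positivity) (a := 1) (b := 4) (by norm_num)
    rw [pow_one, div_pow, ← pow_mul, hq4, div_le_iff₀ hq0] at this
    calc _ ≤ _ := this
      _ = _ := by rw [mul_comm m 4]; ring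
  have h2 : R ^ (4 * m) ≤ 3 ^ (4 * m) * (1 + x ^ (4 * m) + (K * y) ^ (4 * m)) := by
    have h3 : ∀ u, 0 ≤ u → R ≤ 3 * u → R ^ (4 * m) ≤ 3 ^ (4 * m) * u ^ (4 * m) := fun u hu h => by
      rw [← mul_pow]; gcongr
    have hx' : 0 ≤ x ^ (4 * m) := by positivity
    have hy' : 0 ≤ (K * y) ^ (4 * m) := by positivity
    have hp : (0 : ℝ) ≤ 3 ^ (4 * m) := by positivity
    have hKy : 0 ≤ K * y := by positivity
    -- The largest of `1`, `x` and `K * y` is at least a third of `R`.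
    rcases le_total x 1 with ha | ha <;> rcases le_total (K * y) 1 with hb | hb <;>
      rcases le_total x (K * y) with hd | hd
    all_goals first
      | refine (h3 1 (by norm_num) (by linarith)).trans (mul_le_mul_of_nonneg_left ?_ hp)
        rw [one_pow]; linarith
      | refine (h3 x hx (by linarith)).trans (mul_le_mul_of_nonneg_left ?_ hp)
        linarith
      | refine (h3 (K * y) hKy (by linarith)).trans (mul_le_mul_of_nonneg_left ?_ hp)
        linarith
  have h3 : x ^ (4 * m) ≤ 1 + (A ^ (2 * 2 ^ (4 * m))).trace := by
    refine (pow_le_one_add_pow hx (b := 2 ^ (4 * m + 1)) ?_).trans ?_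
    · exact (Nat.lt_two_pow_self.le).trans (Nat.pow_le_pow_right (by norm_num) (Nat.le_succ _))
    · have := l2_opNorm_pow_le_trace hA (4 * m)
      rw [pow_succ' 2] at this ⊢
      linarith
  set T := (A ^ (2 * 2 ^ (4 * m))).trace
  have h4 : R ^ (4 * m) / N ≤ 3 ^ (4 * m) * (2 + K ^ (4 * m)) * (1 + T / N + y ^ (4 * m)) := by
    have h5 : R ^ (4 * m) ≤ 3 ^ (4 * m) * (2 + T + K ^ (4 * m) * y ^ (4 * m)) := by
      refine h2.trans ?_
      rw [mul_pow]
      refine mul_le_mul_of_nonneg_left ?_ (by positivity)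
      linarith
    have hTN : 0 ≤ T / N := by positivity
    rw [div_le_iff₀ hN0]
    refine h5.trans ?_
    have hKm : 0 ≤ K ^ (4 * m) := by positivity
    have hym : 0 ≤ y ^ (4 * m) := by positivity
    rw [mul_assoc, mul_assoc]
    gcongr
    have : (1 + T / N + y ^ (4 * m)) * N = N + T + y ^ (4 * m) * N := by
      field_simp
    rw [this]
    nlinarith [mul_nonneg hKm hym, mul_nonneg hKm hT, mul_nonneg hKm hN0.le,
      mul_nonneg hym hN0.le, mul_nonneg (mul_nonneg hKm hym) (sub_nonneg.2 hN')]
  have hT0 : 0 ≤ T / N := by positivity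
  have hym : 0 ≤ y ^ (4 * m) := by positivity
  set G := 3 ^ (4 * m) * (2 + K ^ (4 * m))
  calc R ^ m ≤ q * (1 + R ^ (4 * m) / N) := h1
    _ ≤ q * ((1 + T / N + y ^ (4 * m)) + G * (1 + T / N + y ^ (4 * m))) := by
        gcongr
        linarith
    _ = _ := by ring

end Pointwise

/-! ### Approximate Schwinger–Dyson equation. -/

section Recursion

open Matrix
open scoped Matrix.Norms.L2Operator

theorem MatrixHasMoments.trMoment {Ω : Type*} [MeasurableSpace Ω] {P : Measure Ω}
    [IsFiniteMeasure P] {N : ℕ} {A : Ω → Matrix (Fin N) (Fin N) ℝ} (hA : MatrixHasMoments P A)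
    (k : ℕ) : HasMoments P (fun ω => trMoment (A ω) k) := by
  simpa only [SphericalGlass.trMoment, div_eq_mul_inv] using
    (hA.pow k).trace.mul (HasMoments.const _)

theorem continuous_trMoment {N : ℕ} (k : ℕ) :
    Continuous fun A : Matrix (Fin N) (Fin N) ℝ => trMoment A k := by
  unfold trMoment
  fun_prop

theorem continuous_mixedTrace {N : ℕ} (W : Matrix (Fin N) (Fin N) ℝ) (n : ℕ) :
    Continuous fun A : Matrix (Fin N) (Fin N) ℝ => mixedTrace W A A n := by
  unfold mixedTrace
  fun_prop

theorem MatrixHasMoments.mixedTrace {Ω : Type*} [MeasurableSpace Ω] {P : Measure Ω}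
    [IsFiniteMeasure P] {N : ℕ} {A : Ω → Matrix (Fin N) (Fin N) ℝ} (hA : MatrixHasMoments P A)
    (W : Matrix (Fin N) (Fin N) ℝ) (n : ℕ) :
    HasMoments P (fun ω => mixedTrace W (A ω) (A ω) n) :=
  HasMoments.sum _ fun i _ => ((((MatrixHasMoments.const W).mul (hA.pow i)).mul
    (MatrixHasMoments.const W)).mul (hA.pow _)).trace

theorem abs_integral_sub_le {Ω : Type*} [MeasurableSpace Ω] {P : Measure Ω} {f g b : Ω → ℝ}
    (hf : Integrable f P) (hg : Integrable g P) (hb : Integrable b P)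
    (h : ∀ ω, |f ω - g ω| ≤ b ω) {c : ℝ} (hc : ∫ ω, b ω ∂P ≤ c) :
    |∫ ω, f ω ∂P - ∫ ω, g ω ∂P| ≤ c := by
  rw [← integral_sub hf hg]
  exact (abs_integral_le_integral_abs).trans
    ((integral_mono (hf.sub hg).abs hb h).trans hc)

namespace IsWignerSeries

theorem traceNormLE {Ω : Type*} [MeasurableSpace Ω] {P : Measure Ω} {N : ℕ} {ι : Type}
    [Fintype ι] {K : ℝ} {M : ℕ → ℝ} {Z : ι → Ω → ℝ} {W : ι → Matrix (Fin N) (Fin N) ℝ} {w : ι → ℝ}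
    (h : IsWignerSeries P K M Z W w) (α : ι) : TraceNormLE (W α) (w α) :=
  ⟨h.norm_le α, h.abs_trace_mul_le α⟩

/-- The approximate Schwinger–Dyson equation for the normalized moments. -/
theorem exists_abs_integral_trMoment_sub_le (K : ℝ) (M : ℕ → ℝ) (n : ℕ) (c : ℝ) :
    ∃ C : ℝ, 0 ≤ C ∧ ∀ {Ω : Type*} [MeasurableSpace Ω] (P : Measure Ω) [IsProbabilityMeasure P]
      {N : ℕ} {ι : Type} [Fintype ι] {Z : ι → Ω → ℝ} {W : ι → Matrix (Fin N) (Fin N) ℝ}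
      {w : ι → ℝ}, IsWignerSeries P K M Z W w → 0 < N →
      |∫ ω, trMoment (series Z W ω) (n + 1) * (trMoment (series Z W ω) (n + 1) - c) ∂P -
        ∫ ω, (∑ i ∈ Finset.range n, trMoment (series Z W ω) i *
          trMoment (series Z W ω) (n - 1 - i)) * (trMoment (series Z W ω) (n + 1) - c) ∂P| ≤
        C / √√N := by
  -- This exponent absorbs both `R ^ (2 * (n + 1))` and `(1 + |z|) ^ 3` from the expansion, since `1
  -- + |z| ≤ R`.
  set m := 2 * (n + 1) + 3 with hm
  obtain ⟨C1, L, hC1, hnorm⟩ := exists_one_add_norm_pow_le m |K| (abs_nonneg K)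
  obtain ⟨D, hD, hapriori⟩ := exists_integral_trace_pow_le K M L
  set T := 1 + D + |M (4 * m)| with hT
  have hT0 : 0 ≤ T := by positivity
  set C2 : ℝ := (n + 1) ^ 2 * (3 + 2 * |c|) with hC2
  have hC20 : 0 ≤ C2 := by positivity
  refine ⟨2 * C2 * C1 * T * |K| ^ 2 + n * |K| * (1 + |c|) * C1 * T, by positivity, ?_⟩
  intro Ω _ P _ N ι _ Z W w h hN
  classical
  have hK := h.one_le
  have hK0 : 0 ≤ K := zero_le_one.trans hK
  rw [abs_of_nonneg hK0] at hnorm ⊢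
  have hN1 : (1 : ℝ) ≤ N := by exact_mod_cast hN
  have hN0 : (0 : ℝ) < N := by linarith
  set q : ℝ := √√N with hq
  have hq2 : q ^ 2 = √N := Real.sq_sqrt (Real.sqrt_nonneg _)
  have hq0 : 0 < q := by positivity
  set κ : ℝ := K / √N with hκ
  have hκ0 : 0 ≤ κ := by positivity
  have hsN : √(N : ℝ) ≤ N := Real.sqrt_le_iff.2 ⟨hN0.le, by nlinarith⟩
  have hNκ : 1 / (N : ℝ) ≤ κ := by
    rw [hκ]
    gcongr
  have hκq : κ * q = K / q := by
    rw [hκ, ← hq2]; field_simp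
  have hqN : q / N ≤ 1 / q := by
    rw [div_le_div_iff₀ hN0 hq0]
    nlinarith
  set A := series Z W with hA
  have hAm : MatrixHasMoments P A := h.series_hasMoments
  have hAh : ∀ ω, (A ω).IsHermitian := h.series_isHermitian
  -- One integrable majorant serves all errors: `Y = Z α` in the leave-one-out steps and `Y = 0` in
  -- the covariance step.
  set b : (Ω → ℝ) → Ω → ℝ := fun Y ω =>
    C1 * q * (1 + (A ω ^ (2 * L)).trace / N + |Y ω| ^ (4 * m)) with hb
  have hbI : ∀ Y, HasMoments P Y → Integrable (b Y) P := fun Y hY => by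
    refine Integrable.const_mul ?_ _
    exact ((integrable_const (1 : ℝ)).add ((hAm.pow _).trace.integrable.div_const _)).add
      (hY.integrable_pow _)
  have hbE : ∀ Y, HasMoments P Y → ∫ ω, |Y ω| ^ (4 * m) ∂P ≤ |M (4 * m)| →
      ∫ ω, b Y ω ∂P ≤ C1 * q * T := fun Y hY hYM => by
    have i1 := (hAm.pow (2 * L)).trace.integrable.div_const (N : ℝ)
    simp only [hb]
    rw [integral_const_mul, integral_add (show Integrable (fun ω => (1 : ℝ) +
      (A ω ^ (2 * L)).trace / N) P from (integrable_const _).add i1) (hY.integrable_pow _),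
      integral_add (integrable_const (1 : ℝ)) i1, integral_div]
    have h1 : (∫ ω, (A ω ^ (2 * L)).trace ∂P) / N ≤ D := by
      rw [div_le_iff₀ hN0]; exact hapriori P h hN
    simp only [integral_const, probReal_univ, one_smul]
    exact mul_le_mul_of_nonneg_left (by rw [hT]; linarith) (by positivity)
  set g : Matrix (Fin N) (Fin N) ℝ → ℝ := fun X => trMoment X (n + 1) - c with hg
  have hgc : Continuous g := (continuous_trMoment _).sub continuous_const
  have hgm : ∀ {X : Ω → Matrix (Fin N) (Fin N) ℝ}, MatrixHasMoments P X →
      HasMoments P (fun ω => g (X ω)) := fun hX => (hX.trMoment _).sub (HasMoments.const _)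
  -- With `B` the erased series, `F` the factor of `Z α` and `Φ` the mixed-trace integrand, the
  -- chain is $E[ZF(A)]=E[Z(F(A)-F(B))]\approx E[Z^2\Phi(B)]=E[\Phi(B)]\approx E[\Phi(A)]$. The
  -- equalities are independence with mean zero and unit variance.
  have hterm : ∀ α, |∫ ω, Z α ω * ((W α * A ω ^ n).trace * g (A ω)) ∂P -
      ∫ ω, mixedTrace (W α) (A ω) (A ω) n * g (A ω) ∂P| ≤
        2 * (C2 * w α ^ 2 * κ * (C1 * q * T)) := by
    intro α
    set B := seriesErase Z W α
    have hBm : MatrixHasMoments P B := h.seriesErase_hasMoments α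
    have hZm := h.hasMoments α
    have hcm : MatrixHasMoments P (fun _ => W α) := MatrixHasMoments.const _
    have hw := h.weight_nonneg α
    have iF : ∀ {X : Ω → Matrix (Fin N) (Fin N) ℝ}, MatrixHasMoments P X →
        HasMoments P (fun ω => Z α ω * ((W α * X ω ^ n).trace * g (X ω))) := fun hX =>
      hZm.mul (((hcm.mul (hX.pow n)).trace).mul (hgm hX))
    have iΦ : ∀ {X : Ω → Matrix (Fin N) (Fin N) ℝ}, MatrixHasMoments P X →
        HasMoments P (fun ω => mixedTrace (W α) (X ω) (X ω) n * g (X ω)) := fun hX =>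
      (hX.mixedTrace _ _).mul (hgm hX)
    have hZ0 : ∫ ω, Z α ω * ((W α * B ω ^ n).trace * g (B ω)) ∂P = 0 := by
      rw [h.integral_mul_seriesErase α (f := fun z => z)
        (g := fun X => (W α * X ^ n).trace * g X) (by fun_prop) (by fun_prop),
        h.mean_zero, zero_mul]
    have hZ2 : ∫ ω, Z α ω ^ 2 * (mixedTrace (W α) (B ω) (B ω) n * g (B ω)) ∂P =
        ∫ ω, mixedTrace (W α) (B ω) (B ω) n * g (B ω) ∂P := by
      rw [h.integral_mul_seriesErase α (f := fun z => z ^ 2)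
        (g := fun X => mixedTrace (W α) X X n * g X) (by fun_prop)
        ((continuous_mixedTrace _ _).mul hgc), h.second_moment, one_mul]
    have hexp : ∀ ω,
        |(Z α ω * ((W α * A ω ^ n).trace * g (A ω)) - Z α ω * ((W α * B ω ^ n).trace * g (B ω))) -
          Z α ω ^ 2 * (mixedTrace (W α) (B ω) (B ω) n * g (B ω))| ≤
          C2 * w α ^ 2 * κ * b (Z α) ω ∧
        |mixedTrace (W α) (A ω) (A ω) n * g (A ω) -
          mixedTrace (W α) (B ω) (B ω) n * g (B ω)| ≤ C2 * w α ^ 2 * κ * b (Z α) ω := by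
      intro ω
      set R := 1 + ‖A ω‖ + K * |Z α ω| with hR
      have hAB : A ω = B ω + Z α ω • W α := series_eq_add Z W α ω
      have hKZ : 0 ≤ K * |Z α ω| := by positivity
      have hAR : ‖A ω‖ ≤ R := by linarith
      have hBR : ‖B ω‖ ≤ R := by
        have h1 : B ω = A ω - Z α ω • W α := by rw [hAB, add_sub_cancel_right]
        have h2 : ‖Z α ω • W α‖ ≤ K * |Z α ω| := by
          rw [norm_smul, Real.norm_eq_abs, mul_comm]
          exact mul_le_mul_of_nonneg_right ((h.norm_le α).trans (h.weight_le_const hN α))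
            (abs_nonneg _)
        rw [h1]
        refine (norm_sub_le _ _).trans ?_
        linarith
      have hR1 : 1 ≤ R := by linarith [norm_nonneg (A ω)]
      obtain ⟨e1, e2⟩ := expansion_le hN (h.traceNormLE α) hAR hBR hR1 hAB (h.weight_le α) hNκ c n
      have hRm : R ^ (2 * (n + 1)) * (1 + |Z α ω|) ^ 3 ≤ b (Z α) ω := by
        refine le_trans ?_ (hnorm |Z α ω| hN (hAh ω) (abs_nonneg _))
        rw [hm, pow_add]
        have h1 : |Z α ω| ≤ K * |Z α ω| := le_mul_of_one_le_left (abs_nonneg _) hK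
        have h2 : 1 + |Z α ω| ≤ R := by linarith [norm_nonneg (A ω)]
        exact mul_le_mul_of_nonneg_left (pow_le_pow_left₀ (by positivity) h2 3)
          (pow_nonneg (by positivity) _)
      have hpos : 0 ≤ C2 * w α ^ 2 * κ := by positivity
      have hfin := mul_le_mul_of_nonneg_left hRm hpos
      refine ⟨?_, e2.trans hfin⟩
      rw [← mul_sub]
      exact e1.trans hfin
    have hbE' := mul_le_mul_of_nonneg_left (hbE (Z α) hZm ((h.moment_le α _).trans (le_abs_self _)))
      (by positivity : 0 ≤ C2 * w α ^ 2 * κ)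
    rw [← integral_const_mul] at hbE'
    have hbI' := (hbI (Z α) hZm).const_mul (C2 * w α ^ 2 * κ)
    have E1 := abs_integral_sub_le ((iF hAm).integrable.sub (iF hBm).integrable)
      ((hZm.pow 2).mul (iΦ hBm)).integrable hbI' (fun ω => (hexp ω).1) hbE'
    have E2 := abs_integral_sub_le (iΦ hAm).integrable (iΦ hBm).integrable hbI'
      (fun ω => (hexp ω).2) hbE'
    rw [integral_sub' (iF hAm).integrable (iF hBm).integrable, hZ0, sub_zero, hZ2] at E1
    rw [abs_sub_comm] at E2
    have := abs_sub_le (∫ ω, Z α ω * ((W α * A ω ^ n).trace * g (A ω)) ∂P)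
      (∫ ω, mixedTrace (W α) (B ω) (B ω) n * g (B ω) ∂P)
      (∫ ω, mixedTrace (W α) (A ω) (A ω) n * g (A ω) ∂P)
    linarith
  have hleft : ∀ ω, ∑ α, Z α ω * ((W α * A ω ^ n).trace * g (A ω)) =
      N * (trMoment (A ω) (n + 1) * g (A ω)) := fun ω => by
    have h1 : (A ω ^ (n + 1)).trace = ∑ α, Z α ω * (W α * A ω ^ n).trace := by
      rw [pow_succ']
      nth_rewrite 1 [hA, series]
      simp [Finset.sum_mul, trace_sum]
    have h2 : N * trMoment (A ω) (n + 1) = (A ω ^ (n + 1)).trace := by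
      rw [trMoment]; field_simp
    rw [← mul_assoc, h2, h1, Finset.sum_mul]
    exact Finset.sum_congr rfl fun α _ => by ring
  -- Summed over `α`, the mixed traces collapse by the covariance condition to `N` times products of
  -- two normalized moments, with an error that does not grow with `N` except through the norm of `A
  -- ω`.
  have hright : ∀ ω, |∑ α, mixedTrace (W α) (A ω) (A ω) n * g (A ω) -
      N * ((∑ i ∈ Finset.range n, trMoment (A ω) i * trMoment (A ω) (n - 1 - i)) * g (A ω))| ≤
      n * K * (1 + |c|) * b (fun _ => 0) ω := fun ω => by
    set R := 1 + ‖A ω‖ + K * |(0 : ℝ)| with hR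
    have hAR : ‖A ω‖ ≤ R := by simp [hR]
    have hR1 : 1 ≤ R := by simp [hR]
    have hRm : R ^ m ≤ b (fun _ => 0) ω := hnorm |(0 : ℝ)| hN (hAh ω) (abs_nonneg _)
    have hgR : |g (A ω)| ≤ (1 + |c|) * R ^ (n + 1) := by
      refine (abs_sub _ _).trans ?_
      have h1 := abs_trMoment_le hN hAR (n + 1)
      have h2 : 1 ≤ R ^ (n + 1) := one_le_pow₀ hR1
      nlinarith [abs_nonneg c]
    have hcov : |∑ α, mixedTrace (W α) (A ω) (A ω) n -
        N * ∑ i ∈ Finset.range n, trMoment (A ω) i * trMoment (A ω) (n - 1 - i)| ≤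
        n * (K * R ^ n) := by
      simp only [mixedTrace]
      rw [Finset.sum_comm, Finset.mul_sum, ← Finset.sum_sub_distrib]
      refine (Finset.abs_sum_le_sum_abs _ _).trans ?_
      refine (Finset.sum_le_card_nsmul _ _ (K * R ^ n) fun i hi => ?_).trans (le_of_eq ?_)
      · have hi := Finset.mem_range.1 hi
        have h1 := h.cov (A ω ^ i) (A ω ^ (n - 1 - i))
        have h2 : (N : ℝ) * (trMoment (A ω) i * trMoment (A ω) (n - 1 - i)) =
            (A ω ^ i).trace * (A ω ^ (n - 1 - i)).trace / N := by
          rw [trMoment, trMoment]; field_simp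
        rw [h2]
        refine h1.trans (mul_le_mul_of_nonneg_left ?_ hK0)
        calc _ ≤ R ^ i * R ^ (n - 1 - i) := by
              gcongr
              · exact l2_opNorm_pow_le hAR _
              · exact l2_opNorm_pow_le hAR _
          _ ≤ R ^ n := by
            rw [← pow_add]; exact pow_le_pow_right₀ hR1 (by omega)
      · rw [Finset.card_range, nsmul_eq_mul]
    rw [← Finset.sum_mul, ← mul_assoc, ← sub_mul, abs_mul]
    calc _ ≤ (n * (K * R ^ n)) * ((1 + |c|) * R ^ (n + 1)) := by gcongr
      _ = n * K * (1 + |c|) * R ^ (n + (n + 1)) := by ring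
      _ ≤ n * K * (1 + |c|) * R ^ m := by
        gcongr
        omega
      _ ≤ _ := by gcongr
  have I1 : ∀ α, HasMoments P (fun ω => Z α ω * ((W α * A ω ^ n).trace * g (A ω))) := fun α =>
    (h.hasMoments α).mul ((((MatrixHasMoments.const (W α)).mul (hAm.pow n)).trace).mul (hgm hAm))
  have I2 : ∀ α, HasMoments P (fun ω => mixedTrace (W α) (A ω) (A ω) n * g (A ω)) := fun α =>
    (hAm.mixedTrace _ _).mul (hgm hAm)
  have I3 : HasMoments P (fun ω => (∑ i ∈ Finset.range n,
      trMoment (A ω) i * trMoment (A ω) (n - 1 - i)) * g (A ω)) :=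
    (HasMoments.sum _ fun i _ => (hAm.trMoment i).mul (hAm.trMoment _)).mul (hgm hAm)
  have S1 : |∑ α, ∫ ω, Z α ω * ((W α * A ω ^ n).trace * g (A ω)) ∂P -
      ∑ α, ∫ ω, mixedTrace (W α) (A ω) (A ω) n * g (A ω) ∂P| ≤
      2 * C2 * C1 * T * K * (κ * q) * N := by
    rw [← Finset.sum_sub_distrib]
    refine (Finset.abs_sum_le_sum_abs _ _).trans ((Finset.sum_le_sum fun α _ => hterm α).trans ?_)
    have : ∀ α, 2 * (C2 * w α ^ 2 * κ * (C1 * q * T)) =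
        (2 * C2 * C1 * T * (κ * q)) * w α ^ 2 := fun α => by ring
    simp only [this]
    rw [← Finset.mul_sum]
    calc _ ≤ (2 * C2 * C1 * T * (κ * q)) * (K * N) := by
          gcongr
          exact h.sum_sq_weight_le
      _ = _ := by ring
  rw [← integral_finsetSum _ fun α _ => (I1 α).integrable,
    ← integral_finsetSum _ fun α _ => (I2 α).integrable] at S1
  simp only [hleft] at S1
  have h0m : 4 * m ≠ 0 := by omega
  have S2 := abs_integral_sub_le (HasMoments.sum Finset.univ fun α _ => I2 α).integrable
    (I3.integrable.const_mul (N : ℝ)) ((hbI _ (HasMoments.const 0)).const_mul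
      (n * K * (1 + |c|))) hright (c := n * K * (1 + |c|) * (C1 * q * T)) (by
      rw [integral_const_mul]
      refine mul_le_mul_of_nonneg_left (hbE _ (HasMoments.const 0) ?_) (by positivity)
      simp [h0m])
  have S3 := (abs_sub_le _ _ _).trans (add_le_add S1 S2)
  rw [integral_const_mul, integral_const_mul, ← mul_sub, abs_mul, Nat.abs_cast] at S3
  rw [← le_div_iff₀' hN0] at S3
  refine S3.trans ?_
  -- The rate: `κ` is of order $N^{-1/2}$ and the norm bounds cost `q`, of order $N^{1/4}$; the
  -- covariance error, of order `q / N`, is smaller.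
  calc _ = 2 * C2 * C1 * T * K * (κ * q) + n * K * (1 + |c|) * C1 * T * (q / N) := by
        field_simp
    _ ≤ 2 * C2 * C1 * T * K * (K / q) + n * K * (1 + |c|) * C1 * T * (1 / q) := by
        rw [hκq]
        gcongr
    _ = _ := by ring

end IsWignerSeries

end Recursion

/-! ### Recursion for the semicircle moments. -/

section Catalan

theorem semicircleMoment_two_mul (m : ℕ) : semicircleMoment (2 * m) = catalan m := by
  have h : ((m : ℝ) + 1) ≠ 0 := by positivity
  rw [semicircleMoment, if_pos (even_two_mul m), Nat.mul_div_cancel_left m (by norm_num)]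
  have h1 := succ_mul_catalan_eq_centralBinom m
  have h2 : ((m : ℝ) + 1) * catalan m = ((2 * m).choose m : ℝ) := by
    rw [← Nat.centralBinom_eq_two_mul_choose, ← h1]; push_cast; ring
  push_cast
  rw [← h2]
  field_simp

theorem semicircleMoment_odd {k : ℕ} (hk : ¬ Even k) : semicircleMoment k = 0 := if_neg hk

/-- For even `n + 1` only even `i` contribute and the sum is the Catalan convolution. For odd `n +
1` the indices `i` and `n - 1 - i` have opposite parity, so every product vanishes. -/
theorem semicircleMoment_succ (n : ℕ) : semicircleMoment (n + 1) =
    ∑ i ∈ Finset.range n, semicircleMoment i * semicircleMoment (n - 1 - i) := by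
  by_cases hn : Even (n + 1)
  · obtain ⟨m, hm⟩ := hn
    obtain ⟨m, rfl⟩ : ∃ l, m = l + 1 := ⟨m - 1, by omega⟩
    obtain rfl : n = 2 * m + 1 := by omega
    rw [show 2 * m + 1 + 1 = 2 * (m + 1) by ring, semicircleMoment_two_mul, catalan_succ',
      Finset.Nat.sum_antidiagonal_eq_sum_range_succ (fun i j => catalan i * catalan j)]
    push_cast
    have h : Finset.image (fun i => 2 * i) (Finset.range (m + 1)) ⊆ Finset.range (2 * m + 1) := by
      intro x
      simp only [Finset.mem_image, Finset.mem_range]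
      rintro ⟨i, hi, rfl⟩
      omega
    rw [← Finset.sum_subset h, Finset.sum_image (by intro a _ b _ h; simpa using h)]
    · refine Finset.sum_congr rfl fun i hi => ?_
      have hi := Finset.mem_range.1 hi
      rw [semicircleMoment_two_mul, ← Nat.mul_sub,
        semicircleMoment_two_mul]
    · intro x hx hx'
      rw [semicircleMoment_odd, zero_mul]
      rintro ⟨y, rfl⟩
      have := Finset.mem_range.1 hx
      exact hx' (Finset.mem_image.2 ⟨y, Finset.mem_range.2 (by omega), by ring⟩)
  · rw [semicircleMoment_odd hn, Finset.sum_eq_zero]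
    intro i hi
    have hi := Finset.mem_range.1 hi
    by_cases h : Even i
    · rw [semicircleMoment_odd (k := n - 1 - i), mul_zero]
      intro h'
      apply hn
      have := h.add h'
      rw [show i + (n - 1 - i) = n - 1 by omega] at this
      have := this.add even_two
      rwa [show n - 1 + 2 = n + 1 by omega] at this
    · rw [semicircleMoment_odd h, zero_mul]

end Catalan

/-! ### Mean-square convergence of the normalized moments. -/

section Convergence

open Matrix
open scoped Matrix.Norms.L2Operator

theorem trMoment_sq_le {N : ℕ} (hN : 0 < N) {A : Matrix (Fin N) (Fin N) ℝ} (hA : A.IsHermitian)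
    (k : ℕ) : trMoment A k ^ 2 ≤ trMoment A (2 * k) := by
  have hN0 : (0 : ℝ) < N := by exact_mod_cast hN
  have h := abs_trace_sq_le (hA.pow k)
  rw [← pow_mul, mul_comm k, Fintype.card_fin] at h
  rw [trMoment, trMoment, div_pow, div_le_div_iff₀ (by positivity) hN0]
  nlinarith

theorem trMoment_pow_four_le {N : ℕ} (hN : 0 < N) {A : Matrix (Fin N) (Fin N) ℝ}
    (hA : A.IsHermitian) (k : ℕ) : trMoment A k ^ 4 ≤ trMoment A (2 * (2 * k)) := by
  have h1 := trMoment_sq_le hN hA k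
  have h2 := trMoment_sq_le hN hA (2 * k)
  calc trMoment A k ^ 4 = (trMoment A k ^ 2) ^ 2 := by ring
    _ ≤ trMoment A (2 * k) ^ 2 := by gcongr
    _ ≤ _ := h2

namespace IsWignerSeries

theorem exists_integral_trMoment_pow_four_le (K : ℝ) (M : ℕ → ℝ) (k : ℕ) :
    ∃ D : ℝ, 1 ≤ D ∧ ∀ {Ω : Type*} [MeasurableSpace Ω] (P : Measure Ω) [IsProbabilityMeasure P]
      {N : ℕ} {ι : Type} [Fintype ι] {Z : ι → Ω → ℝ} {W : ι → Matrix (Fin N) (Fin N) ℝ}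
      {w : ι → ℝ}, IsWignerSeries P K M Z W w → 0 < N →
      ∫ ω, trMoment (series Z W ω) k ^ 4 ∂P ≤ D := by
  obtain ⟨D, hD, h⟩ := exists_integral_trace_pow_le K M (2 * k)
  refine ⟨D, hD, ?_⟩
  intro Ω _ P _ N ι _ Z W w hs hN
  have hN0 : (0 : ℝ) < N := by exact_mod_cast hN
  have h1 := h P hs hN
  rw [← div_le_iff₀ hN0, ← integral_div] at h1
  exact (integral_mono ((hs.series_hasMoments.trMoment k).pow 4).integrable
    (hs.series_hasMoments.trMoment _).integrable
    fun ω => trMoment_pow_four_le hN (hs.series_isHermitian ω) k).trans h1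

/-- Weighted Young inequality after splitting `x * y - a * b`. The fourth powers have bounded means
and are multiplied by a small `δ` fixed first; the squared deviations are made small afterwards,
relative to `δ`. -/
theorem abs_mul_sub_mul_mul_le {x y a b g δ : ℝ} (hδ : 0 < δ) :
    |(x * y - a * b) * g| ≤ ((x - a) ^ 2 + (y - b) ^ 2) / δ + δ * (y ^ 4 + a ^ 4 + 2 * g ^ 4) := by
  have key : ∀ u v : ℝ, |u * v| ≤ u ^ 2 / δ + δ * v ^ 2 := fun u v => by
    have h1 : u ^ 2 / δ + δ * v ^ 2 - |u * v| = (|u| / √δ - √δ * |v|) ^ 2 + |u * v| := by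
      have hs := Real.sq_sqrt hδ.le
      have hs0 : √δ ≠ 0 := by positivity
      rw [sub_sq, div_pow, mul_pow, hs, sq_abs, sq_abs, abs_mul]
      field_simp
      ring
    nlinarith [sq_nonneg (|u| / √δ - √δ * |v|), abs_nonneg (u * v)]
  have k1 := key (x - a) (y * g)
  have k2 := key (y - b) (a * g)
  have : (x * y - a * b) * g = (x - a) * (y * g) + (y - b) * (a * g) := by ring
  rw [this]
  have h3 : (y * g) ^ 2 ≤ y ^ 4 + g ^ 4 := by nlinarith [sq_nonneg (y ^ 2 - g ^ 2), sq_nonneg (y ^ 2 + g ^ 2), sq_nonneg (y*g)]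
  have h4 : (a * g) ^ 2 ≤ a ^ 4 + g ^ 4 := by nlinarith [sq_nonneg (a ^ 2 - g ^ 2), sq_nonneg (a ^ 2 + g ^ 2), sq_nonneg (a*g)]
  have h5 := mul_le_mul_of_nonneg_left (add_le_add h3 h4) hδ.le
  refine (abs_add_le _ _).trans ?_
  rw [add_div]
  linarith

/-- The normalized moments of a Wigner series converge in mean square to the moments of the
semicircular law, uniformly over all series with given constants. -/
theorem exists_forall_integral_trMoment_sub_sq_le (K : ℝ) (M : ℕ → ℝ) (m : ℕ) :
    ∀ ε > 0, ∃ N₀ : ℕ, ∀ {Ω : Type*} [MeasurableSpace Ω] (P : Measure Ω)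
      [IsProbabilityMeasure P] {N : ℕ} {ι : Type} [Fintype ι] {Z : ι → Ω → ℝ}
      {W : ι → Matrix (Fin N) (Fin N) ℝ} {w : ι → ℝ}, IsWignerSeries P K M Z W w → N₀ < N →
      ∀ k < m, ∫ ω, (trMoment (series Z W ω) k - semicircleMoment k) ^ 2 ∂P ≤ ε := by
  induction m with
  | zero => exact fun ε hε => ⟨0, fun P _ _ _ _ _ _ _ _ _ k hk => absurd hk (by omega)⟩
  | succ m ih =>
    intro ε hε
    rcases m with _ | n
    · refine ⟨0, ?_⟩
      intro Ω _ P _ N ι _ Z W w h hN k hk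
      obtain rfl : k = 0 := by omega
      have hN0 : (N : ℝ) ≠ 0 := by positivity
      simp [trMoment, semicircleMoment, hN0, hε.le]
    choose D hD hmom using exists_integral_trMoment_pow_four_le K M
    -- Taking for `c` the limit to be proved makes the equation one for the mean-square deviation.
    obtain ⟨C, hC, hrec⟩ := exists_abs_integral_trMoment_sub_le K M n (semicircleMoment (n + 1))
    set c := semicircleMoment
    set T : ℝ := ∑ i ∈ Finset.range n, (D (n - 1 - i) + c i ^ 4 +
      2 * (8 * (D (n + 1) + c (n + 1) ^ 4))) with hT
    have hD0 : ∀ k, 0 ≤ D k := fun k => zero_le_one.trans (hD k)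
    have hT0 : 0 ≤ T := Finset.sum_nonneg fun i _ => by
      have := hD0 (n - 1 - i)
      have := hD0 (n + 1)
      positivity
    set δ := ε / (3 * (T + 1)) with hδ
    have hδ0 : 0 < δ := by positivity
    have hδT : δ * T ≤ ε / 3 := by
      rw [hδ, div_mul_eq_mul_div, div_le_div_iff₀ (by positivity) (by norm_num)]
      nlinarith
    -- Chosen so that the `n` terms `2 * ε' / δ` add up to at most `ε / 3`.
    set ε' := ε * δ / (6 * (n + 1)) with hε'
    have hε'0 : 0 < ε' := by positivity
    obtain ⟨N₁, h1⟩ := ih (min ε ε') (lt_min hε hε'0)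
    obtain ⟨N₂, h2⟩ : ∃ N₂ : ℕ, ∀ N : ℕ, N₂ < N → C / √√(N : ℝ) ≤ ε / 3 := by
      have ht : Tendsto (fun N : ℕ => C / √√(N : ℝ)) atTop (𝓝 0) :=
        Tendsto.const_div_atTop (Real.tendsto_sqrt_atTop.comp
          (Real.tendsto_sqrt_atTop.comp tendsto_natCast_atTop_atTop)) C
      obtain ⟨N₂, h⟩ := eventually_atTop.1 (ht.eventually_le_const (by positivity : 0 < ε / 3))
      exact ⟨N₂, fun N hN => h N hN.le⟩
    refine ⟨max N₁ N₂, ?_⟩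
    intro Ω _ P _ N ι _ Z W w h hN k hk
    have hN0 : 0 < N := by omega
    have ihN := h1 P h ((le_max_left _ _).trans_lt hN)
    rcases Nat.lt_succ_iff_lt_or_eq.1 hk with hk | rfl
    · exact (ihN k hk).trans (min_le_left _ _)
    set A := series Z W
    have hAm : MatrixHasMoments P A := h.series_hasMoments
    set X : ℕ → Ω → ℝ := fun k ω => trMoment (A ω) k
    have hX : ∀ k, HasMoments P (X k) := fun k => hAm.trMoment k
    have hX4 : ∀ k, ∫ ω, X k ω ^ 4 ∂P ≤ D k := fun k => hmom k P h hN0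
    set G : Ω → ℝ := fun ω => X (n + 1) ω - c (n + 1)
    have hG : HasMoments P G := (hX _).sub (HasMoments.const _)
    have hG4 : ∫ ω, G ω ^ 4 ∂P ≤ 8 * (D (n + 1) + c (n + 1) ^ 4) := by
      have i1 := ((hX (n + 1)).pow 4).integrable
      have h3 : ∀ ω, G ω ^ 4 ≤ 8 * (X (n + 1) ω ^ 4 + c (n + 1) ^ 4) := fun ω => by
        have h4 := add_pow_le (abs_nonneg (X (n + 1) ω)) (abs_nonneg (c (n + 1))) 4
        have h5 : |G ω| ^ 4 ≤ (|X (n + 1) ω| + |c (n + 1)|) ^ 4 :=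
          pow_le_pow_left₀ (abs_nonneg _) (abs_sub _ _) 4
        have e : Even 4 := by decide
        rw [e.pow_abs] at h5
        rw [e.pow_abs, e.pow_abs] at h4
        norm_num at h4
        linarith
      refine (integral_mono (hG.pow 4).integrable ((i1.add (integrable_const _)).const_mul 8)
        h3).trans ?_
      rw [integral_const_mul, integral_add' i1 (integrable_const _), integral_const, probReal_univ,
        one_smul]
      linarith [hX4 (n + 1)]
    have hrecN := (hrec P h hN0).trans (h2 N ((le_max_right _ _).trans_lt hN))
    -- Write `G ^ 2` as `X (n + 1) * G - c (n + 1) * G` and expand `c (n + 1)` by its recursion: the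
    -- first difference is the Schwinger–Dyson defect, and the rest involves lower moments only.
    have hsum : ∫ ω, G ω ^ 2 ∂P = (∫ ω, X (n + 1) ω * G ω ∂P -
        ∫ ω, (∑ i ∈ Finset.range n, X i ω * X (n - 1 - i) ω) * G ω ∂P) +
        ∑ i ∈ Finset.range n, ∫ ω, (X i ω * X (n - 1 - i) ω - c i * c (n - 1 - i)) * G ω ∂P := by
      have i0 : ∀ i, HasMoments P
          (fun ω => (X i ω * X (n - 1 - i) ω - c i * c (n - 1 - i)) * G ω) := fun i =>
        (((hX i).mul (hX _)).sub (HasMoments.const _)).mul hG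
      have i1 := ((hX (n + 1)).mul hG).integrable
      have i2 : Integrable (fun ω => (∑ i ∈ Finset.range n, X i ω * X (n - 1 - i) ω) * G ω) P :=
        ((HasMoments.sum _ fun i _ => (hX i).mul (hX _)).mul hG).integrable
      rw [← integral_finsetSum _ fun i _ => (i0 i).integrable, ← integral_sub i1 i2,
        ← integral_add (f := fun ω => X (n + 1) ω * G ω -
          (∑ i ∈ Finset.range n, X i ω * X (n - 1 - i) ω) * G ω) (i1.sub i2) (HasMoments.sum _ fun i _ => i0 i).integrable]
      refine integral_congr_ae (ae_of_all _ fun ω => ?_)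
      have hc : c (n + 1) = ∑ i ∈ Finset.range n, c i * c (n - 1 - i) := semicircleMoment_succ n
      simp only
      rw [← Finset.sum_mul, Finset.sum_sub_distrib, ← hc]
      simp only [G]
      ring
    have hterm : ∀ i ∈ Finset.range n,
        ∫ ω, (X i ω * X (n - 1 - i) ω - c i * c (n - 1 - i)) * G ω ∂P ≤
          2 * ε' / δ + δ * (D (n - 1 - i) + c i ^ 4 + 2 * (8 * (D (n + 1) + c (n + 1) ^ 4))) := by
      intro i hi
      have hi := Finset.mem_range.1 hi
      set j := n - 1 - i
      have v1 := (ihN i (by omega)).trans (min_le_right _ _)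
      have v2 := (ihN j (by omega)).trans (min_le_right _ _)
      have m1 : HasMoments P (fun ω => (X i ω - c i) ^ 2) := ((hX i).sub (HasMoments.const _)).pow 2
      have m2 : HasMoments P (fun ω => (X j ω - c j) ^ 2) := ((hX j).sub (HasMoments.const _)).pow 2
      have m3 := ((hX j).pow 4)
      have m4 : HasMoments P (fun _ => c i ^ 4) := HasMoments.const _
      have m5 := (hG.pow 4).integrable.const_mul 2
      have b1 : Integrable (fun ω => ((X i ω - c i) ^ 2 + (X j ω - c j) ^ 2) / δ) P :=
        (m1.add m2).integrable.div_const δ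
      have b2 : Integrable (fun ω => δ * (X j ω ^ 4 + c i ^ 4 + 2 * G ω ^ 4)) P :=
        ((m3.add m4).integrable.add m5).const_mul δ
      refine (integral_mono ((((hX i).mul (hX j)).sub (HasMoments.const _)).mul hG).integrable
        (b1.add b2) fun ω => (le_abs_self _).trans (abs_mul_sub_mul_mul_le hδ0)).trans ?_
      rw [integral_add' b1 b2, integral_div, integral_const_mul, integral_add m1.integrable
        m2.integrable, integral_add (m3.add m4).integrable m5, integral_add m3.integrable
        m4.integrable, integral_const_mul, integral_const, probReal_univ, one_smul]
      have := hX4 j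
      gcongr
      linarith
    have hfin : ∑ i ∈ Finset.range n, (2 * ε' / δ + δ * (D (n - 1 - i) + c i ^ 4 +
        2 * (8 * (D (n + 1) + c (n + 1) ^ 4)))) ≤ ε / 3 + ε / 3 := by
      rw [Finset.sum_add_distrib, ← Finset.mul_sum, ← hT, Finset.sum_const, Finset.card_range,
        nsmul_eq_mul]
      refine add_le_add ?_ hδT
      have : (n : ℝ) * (2 * ε' / δ) = ε / 3 * (n / (n + 1)) := by
        rw [hε']; field_simp; ring
      rw [this]
      refine mul_le_of_le_one_right (by positivity) ?_
      rw [div_le_one (by positivity)]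
      linarith
    have := (Finset.sum_le_sum hterm).trans hfin
    rw [hsum]
    have := le_abs_self (∫ ω, X (n + 1) ω * G ω ∂P -
        ∫ ω, (∑ i ∈ Finset.range n, X i ω * X (n - 1 - i) ω) * G ω ∂P)
    linarith

/-- Convergence of the mean moments. -/
theorem exists_forall_abs_integral_trMoment_sub_le (K : ℝ) (M : ℕ → ℝ) (k : ℕ) :
    ∀ ε > 0, ∃ N₀ : ℕ, ∀ {Ω : Type*} [MeasurableSpace Ω] (P : Measure Ω)
      [IsProbabilityMeasure P] {N : ℕ} {ι : Type} [Fintype ι] {Z : ι → Ω → ℝ}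
      {W : ι → Matrix (Fin N) (Fin N) ℝ} {w : ι → ℝ}, IsWignerSeries P K M Z W w → N₀ < N →
      |∫ ω, trMoment (series Z W ω) k ∂P - semicircleMoment k| ≤ ε := by
  intro ε hε
  obtain ⟨N₀, h0⟩ := exists_forall_integral_trMoment_sub_sq_le K M (k + 1) (ε ^ 2) (by positivity)
  refine ⟨N₀, ?_⟩
  intro Ω _ P _ N ι _ Z W w h hN
  have h1 := h0 P h hN k (Nat.lt_succ_self k)
  have hX := h.series_hasMoments.trMoment k
  set X : Ω → ℝ := fun ω => trMoment (series Z W ω) k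
  set c := semicircleMoment k
  have hY : HasMoments P (fun ω => X ω - c) := hX.sub (HasMoments.const _)
  have h2 : ∫ ω, X ω ∂P - c = ∫ ω, (X ω - c) ∂P := by
    rw [integral_sub hX.integrable (integrable_const _), integral_const, probReal_univ, one_smul]
  -- Young's inequality with parameter `ε`, matching the mean-square bound `ε ^ 2`.
  have h3 : |∫ ω, (X ω - c) ∂P| ≤ ∫ ω, ((X ω - c) ^ 2 / (2 * ε) + ε / 2) ∂P := by
    refine abs_integral_le_integral_abs.trans (integral_mono hY.integrable.abs
      (((hY.pow 2).integrable.div_const _).add (integrable_const _)) fun ω => ?_)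
    have : (X ω - c) ^ 2 / (2 * ε) + ε / 2 - |X ω - c| = (|X ω - c| - ε) ^ 2 / (2 * ε) := by
      rw [sub_sq |X ω - c|, sq_abs]; field_simp; ring
    have h4 : 0 ≤ (|X ω - c| - ε) ^ 2 / (2 * ε) := by positivity
    simp only
    linarith
  rw [h2]
  refine h3.trans ?_
  rw [integral_add ((hY.pow 2).integrable.div_const _) (integrable_const _), integral_div,
    integral_const, probReal_univ, one_smul]
  have : (∫ ω, (X ω - c) ^ 2 ∂P) / (2 * ε) ≤ ε / 2 := by
    rw [div_le_iff₀ (by positivity)]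
    nlinarith
  linarith

end IsWignerSeries

end Convergence

/-! ### Rules for partial derivatives. -/

section PartialDeriv

variable {N : ℕ} {f g : EuclideanSpace ℝ (Fin N) → ℝ}

theorem hasDerivAt_line (hf : Differentiable ℝ f) (j : Fin N) (x : EuclideanSpace ℝ (Fin N)) :
    HasDerivAt (fun t : ℝ => f (x + t • EuclideanSpace.single j 1)) (partialDeriv j f x) 0 :=
  (hf x).lineDifferentiableAt.hasLineDerivAt

theorem partialDeriv_eq_of_hasDerivAt {j : Fin N} {x : EuclideanSpace ℝ (Fin N)} {c : ℝ}
    (h : HasDerivAt (fun t : ℝ => f (x + t • EuclideanSpace.single j 1)) c 0) :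
    partialDeriv j f x = c :=
  HasLineDerivAt.lineDeriv h

theorem partialDeriv_sum {κ : Type*} (s : Finset κ) {F : κ → EuclideanSpace ℝ (Fin N) → ℝ}
    (hF : ∀ a ∈ s, Differentiable ℝ (F a)) (j : Fin N) :
    partialDeriv j (fun y => ∑ a ∈ s, F a y) = fun y => ∑ a ∈ s, partialDeriv j (F a) y := by
  funext x
  exact partialDeriv_eq_of_hasDerivAt
    (HasDerivAt.fun_sum fun a ha => hasDerivAt_line (hF a ha) j x)

theorem partialDeriv_const_mul (c : ℝ) (hf : Differentiable ℝ f) (j : Fin N) :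
    partialDeriv j (fun y => c * f y) = fun y => c * partialDeriv j f y := by
  funext x
  exact partialDeriv_eq_of_hasDerivAt ((hasDerivAt_line hf j x).const_mul c)

theorem partialDeriv_add (hf : Differentiable ℝ f) (hg : Differentiable ℝ g) (j : Fin N) :
    partialDeriv j (fun y => f y + g y) = fun y => partialDeriv j f y + partialDeriv j g y := by
  funext x
  exact partialDeriv_eq_of_hasDerivAt ((hasDerivAt_line hf j x).add (hasDerivAt_line hg j x))

theorem partialDeriv_mul (hf : Differentiable ℝ f) (hg : Differentiable ℝ g) (j : Fin N) :
    partialDeriv j (fun y => f y * g y) =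
      fun y => partialDeriv j f y * g y + f y * partialDeriv j g y := by
  funext x
  have := (hasDerivAt_line hf j x).mul (hasDerivAt_line hg j x)
  rw [zero_smul, add_zero] at this
  exact partialDeriv_eq_of_hasDerivAt this

theorem partialDeriv_pow (hf : Differentiable ℝ f) (q : ℕ) (j : Fin N) :
    partialDeriv j (fun y => f y ^ q) = fun y => q * f y ^ (q - 1) * partialDeriv j f y := by
  funext x
  have := (hasDerivAt_line hf j x).pow q
  rw [zero_smul, add_zero] at this
  exact partialDeriv_eq_of_hasDerivAt this

theorem partialDeriv_coord (j k : Fin N) :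
    partialDeriv j (fun y : EuclideanSpace ℝ (Fin N) => y k) =
      fun _ => if k = j then (1 : ℝ) else 0 := by
  funext x
  refine partialDeriv_eq_of_hasDerivAt ?_
  have h : HasDerivAt (fun t : ℝ => x k + t * (EuclideanSpace.single j (1 : ℝ) : EuclideanSpace ℝ (Fin N)) k)
      (1 * (EuclideanSpace.single j (1 : ℝ) : EuclideanSpace ℝ (Fin N)) k) 0 :=
    ((hasDerivAt_id 0).mul_const _).const_add _
  simpa [Pi.single_apply] using h

theorem partialDeriv_const (c : ℝ) (j : Fin N) :
    partialDeriv j (fun _ : EuclideanSpace ℝ (Fin N) => c) = fun _ => 0 := by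
  funext x
  exact partialDeriv_eq_of_hasDerivAt (hasDerivAt_const _ _)

theorem partialDeriv_prod {κ : Type*} [DecidableEq κ] (s : Finset κ) (i : κ → Fin N) (j : Fin N) :
    partialDeriv j (fun y : EuclideanSpace ℝ (Fin N) => ∏ c ∈ s, y (i c)) =
      fun y => ∑ a ∈ s, (∏ c ∈ s.erase a, y (i c)) * if i a = j then 1 else 0 := by
  funext x
  have := HasDerivAt.fun_finsetProd (u := s) (x := (0 : ℝ)) fun a (_ : a ∈ s) =>
    hasDerivAt_line (f := fun y : EuclideanSpace ℝ (Fin N) => y (i a)) (by fun_prop) j x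
  rw [partialDeriv_eq_of_hasDerivAt this]
  simp only [zero_smul, add_zero, partialDeriv_coord, smul_eq_mul]

theorem partialDeriv_linear (v : Fin N → ℝ) (j : Fin N) :
    partialDeriv j (fun y : EuclideanSpace ℝ (Fin N) => ∑ a, y a * v a) = fun _ => v j := by
  have h : (fun y : EuclideanSpace ℝ (Fin N) => ∑ a, y a * v a) = fun y => ∑ a, v a * y a := by
    funext y; simp only [mul_comm]
  rw [h, partialDeriv_sum _ (fun a _ => by fun_prop)]
  funext x
  have : ∀ a, partialDeriv j (fun y : EuclideanSpace ℝ (Fin N) => v a * y a) x =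
      v a * if a = j then 1 else 0 := fun a => by
    rw [partialDeriv_const_mul _ (by fun_prop), partialDeriv_coord]
  simp [this]

end PartialDeriv

/-! ### Hessians of monomials and their trace norms. -/

section Monomial

open Matrix
open scoped Matrix.Norms.L2Operator

variable {N r : ℕ}

/-- The Euclidean Hessian at `x` of the monomial `y ↦ ∏ y_{i_l}`. -/
noncomputable def monomialHessian (i : Fin r → Fin N) (x : EuclideanSpace ℝ (Fin N)) :
    Matrix (Fin N) (Fin N) ℝ :=
  Matrix.of fun j k => partialDeriv j (partialDeriv k fun y => ∏ l, y (i l)) x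

/-- The two derivatives remove two distinct positions `a`, `b` of the product. Positions, not index
values, are required to differ, so repeated coordinates need no separate treatment. -/
theorem monomialHessian_eq (i : Fin r → Fin N) (x : EuclideanSpace ℝ (Fin N)) :
    monomialHessian i x = ∑ a, ∑ b ∈ Finset.univ.erase a,
      (∏ c ∈ (Finset.univ.erase a).erase b, x (i c)) • Matrix.single (i b) (i a) 1 := by
  ext j k
  rw [monomialHessian, of_apply, partialDeriv_prod, partialDeriv_sum _ fun a _ => by fun_prop]
  simp only [Matrix.sum_apply, Matrix.smul_apply, smul_eq_mul]
  refine Finset.sum_congr rfl fun a _ => ?_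
  have : (fun y : EuclideanSpace ℝ (Fin N) =>
      (∏ c ∈ Finset.univ.erase a, y (i c)) * if i a = k then (1 : ℝ) else 0) =
      fun y => (if i a = k then (1 : ℝ) else 0) * ∏ c ∈ Finset.univ.erase a, y (i c) := by
    funext y; ring
  rw [this, partialDeriv_const_mul _ (by fun_prop), partialDeriv_prod]
  beta_reduce
  rw [Finset.mul_sum]
  refine Finset.sum_congr rfl fun b _ => ?_
  rw [Matrix.single_apply]
  by_cases h1 : i a = k <;> by_cases h2 : i b = j <;> simp [h1, h2]

theorem monomialHessian_isHermitian (i : Fin r → Fin N) (x : EuclideanSpace ℝ (Fin N)) :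
    (monomialHessian i x).IsHermitian := by
  rw [IsHermitian, monomialHessian_eq]
  simp only [conjTranspose_sum, conjTranspose_smul, star_trivial, conjTranspose_single]
  rw [Finset.sum_comm' (s' := fun b => Finset.univ.erase b) (t' := Finset.univ)
    (by intro a b; simp [ne_comm])]
  exact Finset.sum_congr rfl fun b _ => Finset.sum_congr rfl fun a _ => by
    rw [Finset.erase_right_comm]

/-- A bound for the trace norm of the Hessian of a monomial. -/
noncomputable def monomialWeight (i : Fin r → Fin N) (x : EuclideanSpace ℝ (Fin N)) : ℝ :=
  ∑ a, ∑ b ∈ Finset.univ.erase a, ∏ c ∈ (Finset.univ.erase a).erase b, |x (i c)|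

theorem norm_single_le (j k : Fin N) : ‖(Matrix.single j k 1 : Matrix (Fin N) (Fin N) ℝ)‖ ≤ 1 := by
  have h := l2_opNorm_sq_le_trace (Matrix.single j k 1 : Matrix (Fin N) (Fin N) ℝ)
  rw [transpose_single, single_mul_single_same, trace_single_eq_same, mul_one] at h
  exact (abs_le_of_sq_le_sq' (by simpa using h) zero_le_one).2

theorem norm_monomialHessian_le (i : Fin r → Fin N) (x : EuclideanSpace ℝ (Fin N)) :
    ‖monomialHessian i x‖ ≤ monomialWeight i x := by
  rw [monomialHessian_eq]
  refine (norm_sum_le _ _).trans (Finset.sum_le_sum fun a _ => ?_)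
  refine (norm_sum_le _ _).trans (Finset.sum_le_sum fun b _ => ?_)
  rw [norm_smul, Real.norm_eq_abs, Finset.abs_prod]
  exact mul_le_of_le_one_right (Finset.prod_nonneg fun _ _ => abs_nonneg _) (norm_single_le _ _)

theorem abs_apply_le_norm (X : Matrix (Fin N) (Fin N) ℝ) (j k : Fin N) : |X j k| ≤ ‖X‖ := by
  have := abs_dotProduct_mulVec_le X (Pi.single j 1) (Pi.single k 1)
  simpa using this

theorem abs_trace_monomialHessian_mul_le (i : Fin r → Fin N) (x : EuclideanSpace ℝ (Fin N))
    (X : Matrix (Fin N) (Fin N) ℝ) :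
    |(monomialHessian i x * X).trace| ≤ monomialWeight i x * ‖X‖ := by
  rw [monomialHessian_eq, Finset.sum_mul, trace_sum, monomialWeight, Finset.sum_mul]
  refine (Finset.abs_sum_le_sum_abs _ _).trans (Finset.sum_le_sum fun a _ => ?_)
  rw [Finset.sum_mul, trace_sum, Finset.sum_mul]
  refine (Finset.abs_sum_le_sum_abs _ _).trans (Finset.sum_le_sum fun b _ => ?_)
  rw [smul_mul_assoc, trace_smul, smul_eq_mul, abs_mul, Finset.abs_prod]
  refine mul_le_mul_of_nonneg_left ?_ (Finset.prod_nonneg fun _ _ => abs_nonneg _)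
  rw [trace_mul_comm, trace_mul_single, MulOpposite.op_one, one_smul]
  exact abs_apply_le_norm _ _ _

theorem card_erase_erase {a b : Fin r} (hb : b ∈ Finset.univ.erase a) :
    ((Finset.univ.erase a).erase b).card = r - 2 := by
  rw [Finset.card_erase_of_mem hb, Finset.card_erase_of_mem (Finset.mem_univ a),
    Finset.card_univ, Fintype.card_fin]
  omega

theorem sum_pairs_le {F : Fin r → Fin r → ℝ} {c : ℝ} (hc : 0 ≤ c)
    (hF : ∀ a, ∀ b ∈ Finset.univ.erase a, F a b ≤ c) :
    ∑ a, ∑ b ∈ Finset.univ.erase a, F a b ≤ (r : ℝ) ^ 2 * c := by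
  have h1 : ∀ a ∈ Finset.univ, ∑ b ∈ Finset.univ.erase a, F a b ≤ r * c := fun a _ => by
    refine (Finset.sum_le_card_nsmul _ _ c (hF a)).trans ?_
    rw [nsmul_eq_mul]
    gcongr
    exact (Finset.card_le_univ _).trans (by simp)
  refine (Finset.sum_le_card_nsmul _ _ _ h1).trans (le_of_eq ?_)
  rw [Finset.card_univ, Fintype.card_fin, nsmul_eq_mul]
  ring

theorem monomialWeight_le (i : Fin r → Fin N) (x : EuclideanSpace ℝ (Fin N)) :
    monomialWeight i x ≤ (r : ℝ) ^ 2 * ‖x‖ ^ (r - 2) := by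
  refine sum_pairs_le (by positivity) fun a b hb => ?_
  rw [← card_erase_erase hb, ← Finset.prod_const]
  refine Finset.prod_le_prod (fun _ _ => abs_nonneg _) fun c _ => ?_
  have := PiLp.norm_apply_le x (i c)
  simpa using this

theorem monomialWeight_nonneg (i : Fin r → Fin N) (x : EuclideanSpace ℝ (Fin N)) :
    0 ≤ monomialWeight i x :=
  Finset.sum_nonneg fun _ _ => Finset.sum_nonneg fun _ _ => Finset.prod_nonneg fun _ _ =>
    abs_nonneg _

/-- The sum over all multi-indices factorizes over positions; each position outside `S` contributes
a factor `N`. -/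
theorem sum_prod_comp_eq (S : Finset (Fin r)) (g : Fin N → ℝ) :
    ∑ i : Fin r → Fin N, ∏ c ∈ S, g (i c) = (∑ j, g j) ^ S.card * (N : ℝ) ^ (r - S.card) := by
  have h1 : ∀ i : Fin r → Fin N, ∏ c ∈ S, g (i c) = ∏ c, if c ∈ S then g (i c) else 1 := fun i => by
    rw [Finset.prod_ite_mem, Finset.univ_inter]
  simp only [h1]
  have h2 := Finset.prod_univ_sum (fun _ : Fin r => (Finset.univ : Finset (Fin N)))
    (fun c j => if c ∈ S then g j else 1)
  rw [Fintype.piFinset_univ] at h2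
  rw [← h2]
  have h3 : ∀ c : Fin r, (∑ j : Fin N, if c ∈ S then g j else 1) =
      if c ∈ S then ∑ j, g j else (N : ℝ) := fun c => by
    split_ifs <;> simp
  simp only [h3]
  rw [Finset.prod_ite, Finset.prod_const, Finset.prod_const]
  have h4 : Finset.univ.filter (fun c => c ∈ S) = S := by ext; simp
  have h5 : (Finset.univ.filter (fun c => c ∉ S)).card = r - S.card := by
    rw [← Finset.compl_filter, h4, Finset.card_compl, Fintype.card_fin]
  rw [h4, h5]

/-- Cauchy–Schwarz over at most `r ^ 2` pairs of positions; in each remaining sum the two removed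
positions are free and give `N ^ 2`. -/
theorem sum_monomialWeight_sq_le (hr : 2 ≤ r) (x : EuclideanSpace ℝ (Fin N)) :
    ∑ i : Fin r → Fin N, monomialWeight i x ^ 2 ≤
      (r : ℝ) ^ 4 * ((‖x‖ ^ 2) ^ (r - 2) * (N : ℝ) ^ 2) := by
  have h1 : ∀ i : Fin r → Fin N, monomialWeight i x ^ 2 ≤ (r : ℝ) ^ 2 *
      ∑ a, ∑ b ∈ Finset.univ.erase a, ∏ c ∈ (Finset.univ.erase a).erase b, x (i c) ^ 2 := by
    intro i
    rw [monomialWeight, Finset.sum_sigma', Finset.sum_sigma']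
    refine sq_sum_le_card_mul_sum_sq.trans ?_
    refine mul_le_mul ?_ (le_of_eq ?_) (Finset.sum_nonneg fun _ _ => sq_nonneg _) (by positivity)
    · have : ((Finset.univ : Finset (Fin r)).sigma fun a => Finset.univ.erase a).card ≤ r ^ 2 := by
        refine (Finset.card_le_univ _).trans ?_
        simp [pow_two]
      exact_mod_cast this
    · refine Finset.sum_congr rfl fun ab _ => ?_
      rw [← Finset.prod_pow]
      simp only [sq_abs]
  refine (Finset.sum_le_sum fun i _ => h1 i).trans ?_
  rw [← Finset.mul_sum, Finset.sum_comm]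
  have h2 : ∀ a : Fin r, ∑ i : Fin r → Fin N, ∑ b ∈ Finset.univ.erase a,
      ∏ c ∈ (Finset.univ.erase a).erase b, x (i c) ^ 2 =
      ∑ b ∈ Finset.univ.erase a, ∑ i : Fin r → Fin N,
        ∏ c ∈ (Finset.univ.erase a).erase b, x (i c) ^ 2 := fun a => Finset.sum_comm
  simp only [h2]
  have h3 : ∑ a : Fin r, ∑ b ∈ Finset.univ.erase a, ∑ i : Fin r → Fin N,
      ∏ c ∈ (Finset.univ.erase a).erase b, x (i c) ^ 2 ≤
        (r : ℝ) ^ 2 * ((‖x‖ ^ 2) ^ (r - 2) * (N : ℝ) ^ 2) := by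
    refine sum_pairs_le (by positivity) fun a b hb => le_of_eq ?_
    rw [sum_prod_comp_eq _ fun j => x j ^ 2, card_erase_erase hb, EuclideanSpace.real_norm_sq_eq]
    congr 2
    omega
  calc _ ≤ (r : ℝ) ^ 2 * ((r : ℝ) ^ 2 * ((‖x‖ ^ 2) ^ (r - 2) * (N : ℝ) ^ 2)) := by gcongr
    _ = _ := by ring

end Monomial

/-! ### Covariance tensor of the Hessian entries. -/

section Covariance

open Matrix
open scoped Matrix.Norms.L2Operator

variable {N r : ℕ}

theorem differentiable_monomial (i : Fin r → Fin N) :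
    Differentiable ℝ fun y : EuclideanSpace ℝ (Fin N) => ∏ l, y (i l) := by fun_prop

theorem differentiable_partialDeriv_monomial (i : Fin r → Fin N) (k : Fin N) :
    Differentiable ℝ (partialDeriv k fun y : EuclideanSpace ℝ (Fin N) => ∏ l, y (i l)) := by
  rw [partialDeriv_prod]
  fun_prop

/-- The covariance kernel of the pure model; covariances of derivatives follow by differentiating it
in each variable. -/
theorem sum_monomial_mul (x y : EuclideanSpace ℝ (Fin N)) :
    ∑ i : Fin r → Fin N, (∏ l, x (i l)) * ∏ l, y (i l) = (∑ a, y a * x a) ^ r := by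
  rw [Fintype.sum_pow]
  refine Finset.sum_congr rfl fun i _ => ?_
  rw [← Finset.prod_mul_distrib]
  exact Finset.prod_congr rfl fun _ _ => mul_comm _ _

theorem partialDeriv_partialDeriv_linear_pow (v : Fin N → ℝ) (q : ℕ) (l m : Fin N) :
    partialDeriv l (partialDeriv m fun y : EuclideanSpace ℝ (Fin N) => (∑ a, y a * v a) ^ q) =
      fun y => q * ((q - 1 : ℕ) * (∑ a, y a * v a) ^ (q - 2)) * v l * v m := by
  have hd : Differentiable ℝ fun y : EuclideanSpace ℝ (Fin N) => ∑ a, y a * v a := by fun_prop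
  rw [partialDeriv_pow hd, partialDeriv_linear]
  have : (fun y : EuclideanSpace ℝ (Fin N) => (q : ℝ) * (∑ a, y a * v a) ^ (q - 1) * v m) =
      fun y => (q * v m) * (∑ a, y a * v a) ^ (q - 1) := by funext y; ring
  rw [this, partialDeriv_const_mul _ (by fun_prop), partialDeriv_pow hd, partialDeriv_linear]
  funext y
  rw [show q - 1 - 1 = q - 2 by omega]
  ring

theorem sum_monomial_mul_monomialHessian (x y : EuclideanSpace ℝ (Fin N)) (l m : Fin N) :
    ∑ i : Fin r → Fin N, (∏ c, x (i c)) * monomialHessian i y l m =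
      r * ((r - 1 : ℕ) * (∑ a, y a * x a) ^ (r - 2)) * x l * x m := by
  have h1 := partialDeriv_partialDeriv_linear_pow (fun a => x a) r l m
  have h2 : (fun y : EuclideanSpace ℝ (Fin N) => (∑ a, y a * x a) ^ r) =
      fun y => ∑ i : Fin r → Fin N, (∏ l, x (i l)) * ∏ l, y (i l) := by
    funext y; rw [sum_monomial_mul]
  rw [h2, partialDeriv_sum _ fun i _ => (differentiable_monomial i).const_mul _] at h1
  have h3 : ∀ i : Fin r → Fin N, partialDeriv m
      (fun y : EuclideanSpace ℝ (Fin N) => (∏ l, x (i l)) * ∏ l, y (i l)) =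
      fun y => (∏ l, x (i l)) * partialDeriv m (fun y => ∏ l, y (i l)) y := fun i =>
    partialDeriv_const_mul _ (differentiable_monomial i) m
  simp only [h3] at h1
  rw [partialDeriv_sum _ fun i _ => (differentiable_partialDeriv_monomial i m).const_mul _] at h1
  rw [← congrFun h1 y]
  refine Finset.sum_congr rfl fun i _ => ?_
  rw [partialDeriv_const_mul _ (differentiable_partialDeriv_monomial i m)]
  rfl

/-- The covariance of the Hessian of the homogeneous polynomial `∑ J_i ∏ y_{i_l}`. -/
theorem sum_monomialHessian_mul (x : EuclideanSpace ℝ (Fin N)) (j k l m : Fin N) :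
    ∑ i : Fin r → Fin N, monomialHessian i x j k * monomialHessian i x l m =
      r * (r - 1 : ℕ) * ((‖x‖ ^ 2) ^ (r - 2) * ((if l = k then 1 else 0) * (if m = j then 1 else 0) +
          (if l = j then 1 else 0) * (if m = k then 1 else 0)) +
        (r - 2 : ℕ) * (‖x‖ ^ 2) ^ (r - 2 - 1) *
          (x k * x m * (if l = j then 1 else 0) + x k * x l * (if m = j then 1 else 0) +
           x j * x m * (if l = k then 1 else 0) + x j * x l * (if m = k then 1 else 0)) +
        (r - 2 : ℕ) * (r - 2 - 1 : ℕ) * (‖x‖ ^ 2) ^ (r - 2 - 2) * (x j * x k * x l * x m)) := by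
  set q := r - 2 with hq
  have hs : ∑ a, x a * x a = ‖x‖ ^ 2 := by
    rw [EuclideanSpace.real_norm_sq_eq]; exact Finset.sum_congr rfl fun _ _ => by ring
  set v : Fin N → ℝ := fun a => x a with hv
  have hd : Differentiable ℝ fun y : EuclideanSpace ℝ (Fin N) => ∑ a, y a * v a := by fun_prop
  -- Half of the computation is the twice differentiated kernel. The covariance is the Hessian of
  -- this function of `y`, taken at `y = x`.
  have h0 : (fun y : EuclideanSpace ℝ (Fin N) => ∑ i : Fin r → Fin N,
      monomialHessian i x l m * ∏ c, y (i c)) =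
      fun y => (r * (r - 1 : ℕ) : ℝ) * ((∑ a, y a * v a) ^ q * (y l * y m)) := by
    funext y
    have := sum_monomial_mul_monomialHessian (r := r) y x l m
    simp only [mul_comm (monomialHessian _ _ _ _), this]
    have h1 : ∀ a, x a * y a = y a * v a := fun a => mul_comm _ _
    simp only [h1]
    ring
  have h1 : partialDeriv j (partialDeriv k fun y : EuclideanSpace ℝ (Fin N) =>
      ∑ i : Fin r → Fin N, monomialHessian i x l m * ∏ c, y (i c)) x =
      ∑ i : Fin r → Fin N, monomialHessian i x j k * monomialHessian i x l m := by
    rw [partialDeriv_sum _ fun i _ => (differentiable_monomial i).const_mul _]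
    have h3 : ∀ i : Fin r → Fin N, partialDeriv k
        (fun y : EuclideanSpace ℝ (Fin N) => monomialHessian i x l m * ∏ c, y (i c)) =
        fun y => monomialHessian i x l m * partialDeriv k (fun y => ∏ c, y (i c)) y := fun i =>
      partialDeriv_const_mul _ (differentiable_monomial i) k
    simp only [h3]
    rw [partialDeriv_sum _ fun i _ => (differentiable_partialDeriv_monomial i k).const_mul _]
    refine Finset.sum_congr rfl fun i _ => ?_
    rw [partialDeriv_const_mul _ (differentiable_partialDeriv_monomial i k)]
    exact mul_comm _ _
  rw [← h1, h0, partialDeriv_const_mul _ (by fun_prop), partialDeriv_const_mul _ ?_]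
  swap
  · rw [partialDeriv_mul (by fun_prop) (by fun_prop), partialDeriv_pow hd, partialDeriv_linear,
      partialDeriv_mul (by fun_prop) (by fun_prop), partialDeriv_coord, partialDeriv_coord]
    fun_prop
  rw [partialDeriv_mul (by fun_prop) (by fun_prop), partialDeriv_pow hd, partialDeriv_linear,
    partialDeriv_mul (by fun_prop) (by fun_prop), partialDeriv_coord, partialDeriv_coord]
  beta_reduce
  rw [partialDeriv_add (by fun_prop) (by fun_prop),
    partialDeriv_mul (f := fun y : EuclideanSpace ℝ (Fin N) => q * (∑ a, y a * v a) ^ (q - 1) * v k)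
      (by fun_prop) (by fun_prop),
    partialDeriv_mul (f := fun y : EuclideanSpace ℝ (Fin N) => q * (∑ a, y a * v a) ^ (q - 1))
      (by fun_prop) (by fun_prop), partialDeriv_const_mul _ (by fun_prop),
    partialDeriv_pow hd, partialDeriv_linear, partialDeriv_const,
    partialDeriv_mul (f := fun y : EuclideanSpace ℝ (Fin N) => (∑ a, y a * v a) ^ q)
      (by fun_prop) (by fun_prop), partialDeriv_pow hd, partialDeriv_linear,
    partialDeriv_mul (f := fun y : EuclideanSpace ℝ (Fin N) => y l) (by fun_prop) (by fun_prop),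
    partialDeriv_coord, partialDeriv_coord,
    partialDeriv_add (by fun_prop) (by fun_prop),
    partialDeriv_const_mul _ (by fun_prop), partialDeriv_coord]
  have h5 : partialDeriv j (fun y : EuclideanSpace ℝ (Fin N) =>
      y l * if m = k then (1 : ℝ) else 0) =
      fun _ => (if m = k then 1 else 0) * if l = j then 1 else 0 := by
    rw [show (fun y : EuclideanSpace ℝ (Fin N) => y l * if m = k then (1 : ℝ) else 0) =
      fun y => (if m = k then (1 : ℝ) else 0) * y l by funext y; ring,
      partialDeriv_const_mul _ (by fun_prop), partialDeriv_coord]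
  rw [h5]
  simp only [hv, hs]
  rw [show q - 1 - 1 = q - 2 by omega]
  ring

end Covariance

/-! ### Contraction of the covariance tensor with two matrices. -/

section Contraction

open Matrix
open scoped Matrix.Norms.L2Operator

variable {N r : ℕ}

theorem trace_mul_mul_mul_eq (H X H' Y : Matrix (Fin N) (Fin N) ℝ) :
    (H * X * H' * Y).trace = ∑ j, ∑ m, ∑ l, ∑ k, H j k * H' l m * (X k l * Y m j) := by
  simp only [trace, diag_apply, mul_apply, Finset.sum_mul]
  refine Finset.sum_congr rfl fun j _ => Finset.sum_congr rfl fun m _ =>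
    Finset.sum_congr rfl fun l _ => Finset.sum_congr rfl fun k _ => by ring

/-- Each of the seven index patterns of the covariance contracts to its own scalar. Among these,
`X.trace * Y.trace` is the leading one. -/
theorem sum_trace_monomialHessian_mul (x : EuclideanSpace ℝ (Fin N))
    (X Y : Matrix (Fin N) (Fin N) ℝ) :
    ∑ i : Fin r → Fin N, (monomialHessian i x * X * monomialHessian i x * Y).trace =
      r * (r - 1 : ℕ) * ((‖x‖ ^ 2) ^ (r - 2) * (X.trace * Y.trace + (X * Yᵀ).trace) +
        (r - 2 : ℕ) * (‖x‖ ^ 2) ^ (r - 2 - 1) *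
          (x ⬝ᵥ (X * Yᵀ) *ᵥ x + (x ⬝ᵥ X *ᵥ x) * Y.trace +
            X.trace * (x ⬝ᵥ Y *ᵥ x) + x ⬝ᵥ (Xᵀ * Y) *ᵥ x) +
        (r - 2 : ℕ) * (r - 2 - 1 : ℕ) * (‖x‖ ^ 2) ^ (r - 2 - 2) *
          ((x ⬝ᵥ X *ᵥ x) * (x ⬝ᵥ Y *ᵥ x))) := by
  set a := (‖x‖ ^ 2) ^ (r - 2)
  set b := (r - 2 : ℕ) * (‖x‖ ^ 2) ^ (r - 2 - 1)
  set c := (r - 2 : ℕ) * (r - 2 - 1 : ℕ) * (‖x‖ ^ 2) ^ (r - 2 - 2)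
  set S : (Fin N → Fin N → Fin N → Fin N → ℝ) → ℝ := fun φ =>
    ∑ j, ∑ m, ∑ l, ∑ k, φ j m l k * (X k l * Y m j) with hS
  have h0 : ∑ i : Fin r → Fin N, (monomialHessian i x * X * monomialHessian i x * Y).trace =
      S fun j m l k => ∑ i : Fin r → Fin N, monomialHessian i x j k * monomialHessian i x l m := by
    simp only [trace_mul_mul_mul_eq, hS]
    rw [Finset.sum_comm]
    refine Finset.sum_congr rfl fun j _ => ?_
    rw [Finset.sum_comm]
    refine Finset.sum_congr rfl fun m _ => ?_
    rw [Finset.sum_comm]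
    refine Finset.sum_congr rfl fun l _ => ?_
    rw [Finset.sum_comm]
    refine Finset.sum_congr rfl fun k _ => ?_
    rw [Finset.sum_mul]
  have hadd : ∀ φ ψ, S (fun j m l k => φ j m l k + ψ j m l k) = S φ + S ψ := fun φ ψ => by
    simp only [hS, add_mul, Finset.sum_add_distrib]
  have hmul : ∀ (t : ℝ) φ, S (fun j m l k => t * φ j m l k) = t * S φ := fun t φ => by
    simp only [hS, mul_assoc, Finset.mul_sum]
  have s1 : S (fun j m l k => (if l = k then 1 else 0) * (if m = j then 1 else 0)) =
      X.trace * Y.trace := by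
    simp only [hS, trace, diag_apply, Finset.sum_mul_sum]
    simp
    rw [Finset.sum_comm]
  have s2 : S (fun j m l k => (if l = j then 1 else 0) * (if m = k then 1 else 0)) =
      (X * Yᵀ).trace := by
    simp only [hS, trace, diag_apply, mul_apply, transpose_apply]
    simp
    rw [Finset.sum_comm]
  have s3 : S (fun j m l k => x k * x m * (if l = j then 1 else 0)) = x ⬝ᵥ (X * Yᵀ) *ᵥ x := by
    simp only [hS, dotProduct, mulVec, mul_apply, transpose_apply]
    simp [Finset.mul_sum, Finset.sum_mul]
    refine Eq.trans ?_ (Finset.sum_congr rfl fun _ _ => Finset.sum_comm)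
    rw [Finset.sum_comm]
    refine Eq.trans (Finset.sum_congr rfl fun _ _ => Finset.sum_comm) ?_
    rw [Finset.sum_comm]
    refine Eq.trans ?_ (Finset.sum_congr rfl fun _ _ => Finset.sum_comm)
    refine Finset.sum_congr rfl fun _ _ => Finset.sum_congr rfl fun _ _ =>
      Finset.sum_congr rfl fun _ _ => ?_
    ring
  have s4 : S (fun j m l k => x k * x l * (if m = j then 1 else 0)) =
      (x ⬝ᵥ X *ᵥ x) * Y.trace := by
    simp only [hS, dotProduct, mulVec, trace, diag_apply]
    simp [Finset.mul_sum, Finset.sum_mul]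
    refine Eq.trans (Finset.sum_congr rfl fun _ _ => Finset.sum_comm) ?_
    refine Finset.sum_congr rfl fun _ _ => Finset.sum_congr rfl fun _ _ =>
      Finset.sum_congr rfl fun _ _ => ?_
    ring
  have s5 : S (fun j m l k => x j * x m * (if l = k then 1 else 0)) =
      X.trace * (x ⬝ᵥ Y *ᵥ x) := by
    simp only [hS, dotProduct, mulVec, trace, diag_apply]
    simp [Finset.mul_sum, Finset.sum_mul]
    rw [Finset.sum_comm]
    refine Finset.sum_congr rfl fun _ _ => Finset.sum_congr rfl fun _ _ =>
      Finset.sum_congr rfl fun _ _ => ?_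
    ring
  have s6 : S (fun j m l k => x j * x l * (if m = k then 1 else 0)) = x ⬝ᵥ (Xᵀ * Y) *ᵥ x := by
    simp only [hS, dotProduct, mulVec, mul_apply, transpose_apply]
    simp [Finset.mul_sum, Finset.sum_mul]
    refine Eq.trans (Finset.sum_congr rfl fun _ _ => Finset.sum_comm) ?_
    rw [Finset.sum_comm]
    refine Finset.sum_congr rfl fun _ _ => Finset.sum_congr rfl fun _ _ =>
      Finset.sum_congr rfl fun _ _ => ?_
    ring
  have s7 : S (fun j m l k => x j * x k * x l * x m) = (x ⬝ᵥ X *ᵥ x) * (x ⬝ᵥ Y *ᵥ x) := by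
    simp only [hS, dotProduct, mulVec]
    simp [Finset.mul_sum, Finset.sum_mul]
    rw [Finset.sum_comm]
    refine Eq.trans (Finset.sum_congr rfl fun _ _ => Finset.sum_congr rfl fun _ _ => Finset.sum_comm) ?_
    refine Finset.sum_congr rfl fun _ _ => Finset.sum_congr rfl fun _ _ =>
      Finset.sum_congr rfl fun _ _ => Finset.sum_congr rfl fun _ _ => ?_
    ring
  rw [h0]
  simp only [sum_monomialHessian_mul]
  rw [hmul, hadd, hadd, hmul, hmul, hmul, hadd, hadd, hadd, hadd, s1, s2, s3, s4, s5, s6, s7]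

theorem abs_dotProduct_mulVec_self_le (X : Matrix (Fin N) (Fin N) ℝ)
    (x : EuclideanSpace ℝ (Fin N)) : |x ⬝ᵥ X *ᵥ x| ≤ ‖X‖ * ‖x‖ ^ 2 := by
  have := abs_dotProduct_mulVec_le X x x
  rwa [pow_two]

theorem norm_transpose_eq (X : Matrix (Fin N) (Fin N) ℝ) : ‖Xᵀ‖ = ‖X‖ := by
  rw [← conjTranspose_eq_transpose_of_trivial, l2_opNorm_conjTranspose]

/-- The factor `q` vanishes exactly where the truncated exponent `q - 1` would be wrong. -/
theorem natCast_mul_pow_pred_mul (q : ℕ) (s : ℝ) : (q : ℝ) * s ^ (q - 1) * s = q * s ^ q := by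
  cases q with
  | zero => simp
  | succ q => rw [Nat.add_sub_cancel, pow_succ, mul_assoc]

/-- Each quadratic form in `x` supplies a power of `‖x‖ ^ 2` that its coefficient lacks, so all
other terms are bounded by `N` times the same power. With `q = r - 2`, their number is controlled by
`1 + 4 * q + q ^ 2 ≤ (q + 2) ^ 2`. -/
theorem abs_sum_trace_monomialHessian_sub_le (hN : 0 < N) (hr : 2 ≤ r)
    (x : EuclideanSpace ℝ (Fin N)) (X Y : Matrix (Fin N) (Fin N) ℝ) :
    |∑ i : Fin r → Fin N, (monomialHessian i x * X * monomialHessian i x * Y).trace -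
      (r * (r - 1 : ℕ) * (‖x‖ ^ 2) ^ (r - 2) * (X.trace * Y.trace))| ≤
      r * (r - 1 : ℕ) * (‖x‖ ^ 2) ^ (r - 2) * N * ((r : ℝ) ^ 2 * (‖X‖ * ‖Y‖)) := by
  have hN1 : (1 : ℝ) ≤ N := by exact_mod_cast hN
  rw [sum_trace_monomialHessian_mul]
  obtain ⟨q, rfl⟩ : ∃ q, r = q + 2 := ⟨r - 2, by omega⟩
  rw [Nat.add_sub_cancel]
  set s := ‖x‖ ^ 2
  have hs : 0 ≤ s := sq_nonneg _
  set u := ‖X‖ * ‖Y‖ with hu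
  have hu0 : 0 ≤ u := by positivity
  have n1 : ‖X * Yᵀ‖ ≤ u := (norm_mul_le _ _).trans (by rw [norm_transpose_eq])
  have n2 : ‖Xᵀ * Y‖ ≤ u := (norm_mul_le _ _).trans (by rw [norm_transpose_eq])
  have e1 : |(X * Yᵀ).trace| ≤ N * u := by
    refine (abs_trace_le_card_mul_norm _).trans ?_
    rw [Fintype.card_fin]
    gcongr
  have d1 : |x ⬝ᵥ X *ᵥ x| ≤ ‖X‖ * s := abs_dotProduct_mulVec_self_le X x
  have d2 : |x ⬝ᵥ Y *ᵥ x| ≤ ‖Y‖ * s := abs_dotProduct_mulVec_self_le Y x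
  have t1 : |X.trace| ≤ N * ‖X‖ := by simpa using abs_trace_le_card_mul_norm X
  have t2 : |Y.trace| ≤ N * ‖Y‖ := by simpa using abs_trace_le_card_mul_norm Y
  have uN : u * s ≤ N * u * s := by
    have := le_mul_of_one_le_left (mul_nonneg hu0 hs) hN1
    rwa [← mul_assoc] at this
  have e2 : |x ⬝ᵥ (X * Yᵀ) *ᵥ x| ≤ N * u * s :=
    (abs_dotProduct_mulVec_self_le _ x).trans ((mul_le_mul_of_nonneg_right n1 hs).trans uN)
  have e5 : |x ⬝ᵥ (Xᵀ * Y) *ᵥ x| ≤ N * u * s :=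
    (abs_dotProduct_mulVec_self_le _ x).trans ((mul_le_mul_of_nonneg_right n2 hs).trans uN)
  have e3 : |(x ⬝ᵥ X *ᵥ x) * Y.trace| ≤ N * u * s := by
    rw [abs_mul]
    calc _ ≤ (‖X‖ * s) * (N * ‖Y‖) := by gcongr
      _ = _ := by rw [hu]; ring
  have e4 : |X.trace * (x ⬝ᵥ Y *ᵥ x)| ≤ N * u * s := by
    rw [abs_mul]
    calc _ ≤ (N * ‖X‖) * (‖Y‖ * s) := by gcongr
      _ = _ := by rw [hu]; ring
  have e6 : |(x ⬝ᵥ X *ᵥ x) * (x ⬝ᵥ Y *ᵥ x)| ≤ N * u * (s * s) := by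
    rw [abs_mul]
    calc _ ≤ (‖X‖ * s) * (‖Y‖ * s) := by gcongr
      _ = 1 * (u * (s * s)) := by rw [hu]; ring
      _ ≤ N * (u * (s * s)) := by gcongr
      _ = _ := by ring
  set E1 := (X * Yᵀ).trace
  set E2 := x ⬝ᵥ (X * Yᵀ) *ᵥ x
  set E3 := (x ⬝ᵥ X *ᵥ x) * Y.trace
  set E4 := X.trace * (x ⬝ᵥ Y *ᵥ x)
  set E5 := x ⬝ᵥ (Xᵀ * Y) *ᵥ x
  set E6 := (x ⬝ᵥ X *ᵥ x) * (x ⬝ᵥ Y *ᵥ x)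
  set R : ℝ := ((q + 2 : ℕ) : ℝ) * ((q + 2 - 1 : ℕ) : ℝ) with hR
  have hR0 : 0 ≤ R := by positivity
  have h1 := natCast_mul_pow_pred_mul q s
  have h2 := natCast_mul_pow_pred_mul (q - 1) s
  have hq2 : ((q - 1 : ℕ) : ℝ) ≤ q := by exact_mod_cast Nat.sub_le q 1
  have hdiff : R * (s ^ q * (X.trace * Y.trace + E1) + q * s ^ (q - 1) * (E2 + E3 + E4 + E5) +
      q * (q - 1 : ℕ) * s ^ (q - 2) * E6) - R * s ^ q * (X.trace * Y.trace) =
      R * (s ^ q * E1 + q * s ^ (q - 1) * (E2 + E3 + E4 + E5) +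
        q * (q - 1 : ℕ) * s ^ (q - 2) * E6) := by ring
  rw [show q - 1 - 1 = q - 2 by omega] at h2
  have hE : |E2 + E3 + E4 + E5| ≤ 4 * (N * u * s) := by
    have := abs_add_le (E2 + E3 + E4) E5
    have := abs_add_three E2 E3 E4
    linarith
  rw [hdiff, abs_mul, abs_of_nonneg hR0]
  have hmain : |s ^ q * E1 + q * s ^ (q - 1) * (E2 + E3 + E4 + E5) +
      q * (q - 1 : ℕ) * s ^ (q - 2) * E6| ≤ s ^ q * N * (((q + 2 : ℕ) : ℝ) ^ 2 * u) := by
    refine (abs_add_three _ _ _).trans ?_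
    rw [abs_mul, abs_mul, abs_mul (_ * _ * _) E6, abs_of_nonneg (by positivity : 0 ≤ s ^ q),
      abs_of_nonneg (by positivity : 0 ≤ (q : ℝ) * s ^ (q - 1)),
      abs_of_nonneg (by positivity : 0 ≤ (q : ℝ) * ((q - 1 : ℕ) : ℝ) * s ^ (q - 2))]
    calc _ ≤ s ^ q * (N * u) + q * s ^ (q - 1) * (4 * (N * u * s)) +
          q * (q - 1 : ℕ) * s ^ (q - 2) * (N * u * (s * s)) := by gcongr
      _ = s ^ q * (N * u) + 4 * (q * s ^ (q - 1) * s) * (N * u) +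
          q * (((q - 1 : ℕ) : ℝ) * s ^ (q - 2) * s) * s * (N * u) := by ring
      _ = (1 + 4 * q + ((q - 1 : ℕ) : ℝ) * q) * (s ^ q * (N * u)) := by
        rw [h1, h2]
        linear_combination (((q - 1 : ℕ) : ℝ) * (N * u)) * h1
      _ ≤ (1 + 4 * q + (q : ℝ) * q) * (s ^ q * (N * u)) := by gcongr
      _ ≤ ((q + 2 : ℕ) : ℝ) ^ 2 * (s ^ q * (N * u)) := by
        gcongr
        push_cast
        nlinarith
      _ = _ := by ring
  calc _ ≤ R * (s ^ q * N * (((q + 2 : ℕ) : ℝ) ^ 2 * u)) := mul_le_mul_of_nonneg_left hmain hR0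
    _ = _ := by ring

end Contraction

/-! ### The compressed Hessian as a Wigner series. -/

section SpinSeries

open Matrix
open scoped Matrix.Norms.L2Operator

variable {N : ℕ}

/-- A symmetric contraction `Q` for which `X ↦ Q X Q` changes traces by at most `‖X‖`. -/
structure IsCompression (Q : Matrix (Fin N) (Fin N) ℝ) : Prop where
  isHermitian : Q.IsHermitian
  norm_le : ‖Q‖ ≤ 1
  abs_trace_sub_le : ∀ X : Matrix (Fin N) (Fin N) ℝ, |(Q * X * Q).trace - X.trace| ≤ ‖X‖

theorem isCompression_one : IsCompression (1 : Matrix (Fin N) (Fin N) ℝ) where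
  isHermitian := isHermitian_one
  norm_le := l2_opNorm_one_le
  abs_trace_sub_le X := by simp

theorem IsCompression.norm_mul_mul_le {Q : Matrix (Fin N) (Fin N) ℝ} (hQ : IsCompression Q)
    (X : Matrix (Fin N) (Fin N) ℝ) : ‖Q * X * Q‖ ≤ ‖X‖ := by
  calc ‖Q * X * Q‖ ≤ ‖Q‖ * ‖X‖ * ‖Q‖ :=
        (norm_mul_le _ _).trans (mul_le_mul_of_nonneg_right (norm_mul_le _ _) (norm_nonneg _))
    _ ≤ 1 * ‖X‖ * 1 := by
        gcongr
        exacts [hQ.norm_le, hQ.norm_le]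
    _ = ‖X‖ := by ring

theorem projPerp_isHermitian (x : EuclideanSpace ℝ (Fin N)) : (projPerp x).IsHermitian := by
  rw [IsHermitian, projPerp, conjTranspose_sub, conjTranspose_one, conjTranspose_smul,
    conjTranspose_vecMulVec]
  simp

theorem projPerp_mul_self (x : EuclideanSpace ℝ (Fin N)) :
    projPerp x * projPerp x = projPerp x := by
  have h : vecMulVec (fun j => x j) (fun j => x j) * vecMulVec (fun j => x j) (fun j => x j) =
      ‖x‖ ^ 2 • vecMulVec (fun j => x j) (fun j => x j) := by
    rw [vecMulVec_mul_vecMulVec, EuclideanSpace.real_norm_sq_eq]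
    ext j k
    simp only [dotProduct, vecMulVec_apply, Matrix.smul_apply, smul_eq_mul, pow_two]
    simp [mul_comm, mul_assoc]
  set c := ‖x‖ ^ 2 with hc
  set V := vecMulVec (fun j => x j) (fun j => x j) with hV
  have hcc : c⁻¹ * c⁻¹ * c = c⁻¹ := by
    rcases eq_or_ne c 0 with h0 | h0
    · simp [h0]
    · field_simp
  rw [projPerp, ← hV, ← hc, sub_mul, one_mul, mul_sub, mul_one, smul_mul_smul_comm, h, smul_smul,
    hcc]
  abel

/-- Since the projection is idempotent, compression changes the trace by the quadratic form of `X`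
at the unit vector along `x`. At `x = 0` the inverse is `0` and nothing changes. -/
theorem isCompression_projPerp (x : EuclideanSpace ℝ (Fin N)) : IsCompression (projPerp x) where
  isHermitian := projPerp_isHermitian x
  norm_le := by
    have h := l2_opNorm_conjTranspose_mul_self (projPerp x)
    rw [projPerp_isHermitian x, projPerp_mul_self] at h
    by_contra! hlt
    nlinarith
  abs_trace_sub_le X := by
    have h : (projPerp x * X * projPerp x).trace - X.trace =
        -((‖x‖ ^ 2)⁻¹ * ((fun j => x j) ⬝ᵥ X *ᵥ (fun j => x j))) := by
      rw [Matrix.trace_mul_comm, ← Matrix.mul_assoc, projPerp_mul_self, projPerp, sub_mul, one_mul,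
        smul_mul_assoc, trace_sub, trace_smul, vecMulVec_mul, trace_vecMulVec, smul_eq_mul,
        dotProduct_comm, ← dotProduct_mulVec]
      ring
    rw [h, abs_neg, abs_mul, abs_of_nonneg (by positivity)]
    rcases eq_or_ne (‖x‖ ^ 2) 0 with h0 | h0
    · simp [h0]
    · calc _ ≤ (‖x‖ ^ 2)⁻¹ * (‖X‖ * ‖x‖ ^ 2) := by
            gcongr
            exact abs_dotProduct_mulVec_self_le X x
        _ = ‖X‖ := by rw [mul_left_comm, inv_mul_cancel₀ h0, mul_one]

variable {Ω : Type*} [MeasurableSpace Ω] {P : Measure Ω}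
  {J : (r : ℕ) → (Fin r → Fin N) → Ω → ℝ} {p : ℕ}

/-- The indices of the disorder variables of the model truncated at level `p`. -/
abbrev SpinIndex (p N : ℕ) : Type := Σ r : {r // r ∈ Finset.Icc 2 p}, (Fin (r : ℕ) → Fin N)

theorem IsDisorder.iIndepFun_spinIndex (hJ : IsDisorder P N J) :
    iIndepFun (fun a : SpinIndex p N => J a.1 a.2) P := by
  let e : SpinIndex p N → Σ r : {r : ℕ // 2 ≤ r}, (Fin (r : ℕ) → Fin N) :=
    fun a => ⟨⟨a.1, (Finset.mem_Icc.1 a.1.2).1⟩, a.2⟩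
  have he : Function.Injective e := by
    rintro ⟨⟨r, hr⟩, i⟩ ⟨⟨r', hr'⟩, i'⟩ h
    simp only [e, Sigma.mk.injEq, Subtype.mk.injEq] at h
    obtain ⟨rfl, h⟩ := h
    simpa using h
  exact hJ.indep.precomp he

theorem sum_spinIndex (F : (r : ℕ) → (Fin r → Fin N) → ℝ) :
    ∑ a : SpinIndex p N, F a.1 a.2 = ∑ r ∈ Finset.Icc 2 p, ∑ i, F r i := by
  rw [Fintype.sum_sigma, ← Finset.sum_coe_sort (Finset.Icc 2 p) fun r => ∑ i, F r i]

/-- Cyclicity moves `Q` onto the test matrices, giving `Q * X * Q` and `Q * Y * Q`. The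
normalization `hβ` makes the leading coefficients of all `r` add up to `1 / N` and also sums the
errors. Restoring the traces of `X` and `Y` costs the remaining `2`. -/
theorem cov_spin (hN : 0 < N) {β : ℕ → ℝ} {x : EuclideanSpace ℝ (Fin N)}
    (hβ : ∑ r ∈ Finset.Icc 2 p, β r ^ 2 * (r * (r - 1 : ℕ) * (‖x‖ ^ 2) ^ (r - 2)) = 1 / (N : ℝ))
    {Q : Matrix (Fin N) (Fin N) ℝ} (hQ : IsCompression Q) (X Y : Matrix (Fin N) (Fin N) ℝ) :
    |∑ a : SpinIndex p N, ((β a.1 • (Q * monomialHessian a.2 x * Q)) * X *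
        (β a.1 • (Q * monomialHessian a.2 x * Q)) * Y).trace - X.trace * Y.trace / N| ≤
      ((p : ℝ) ^ 2 + 2) * (‖X‖ * ‖Y‖) := by
  have hN' : (0 : ℝ) < N := by exact_mod_cast hN
  rw [sum_spinIndex (fun r i => ((β r • (Q * monomialHessian i x * Q)) * X *
        (β r • (Q * monomialHessian i x * Q)) * Y).trace)]
  set X' := Q * X * Q with hX'
  set Y' := Q * Y * Q with hY'
  have hXn : ‖X'‖ ≤ ‖X‖ := hQ.norm_mul_mul_le X
  have hYn : ‖Y'‖ ≤ ‖Y‖ := hQ.norm_mul_mul_le Y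
  have h1 : ∀ r, ∑ i : Fin r → Fin N, ((β r • (Q * monomialHessian i x * Q)) * X *
        (β r • (Q * monomialHessian i x * Q)) * Y).trace =
      β r ^ 2 * ∑ i : Fin r → Fin N,
        (monomialHessian i x * X' * monomialHessian i x * Y').trace := fun r => by
    rw [Finset.mul_sum]
    refine Finset.sum_congr rfl fun i _ => ?_
    rw [smul_mul_assoc, smul_mul_assoc, mul_smul_comm, smul_mul_assoc, smul_mul_assoc, trace_smul,
      trace_smul, smul_eq_mul, smul_eq_mul, ← mul_assoc, pow_two, hX', hY']
    congr 1
    simp only [Matrix.mul_assoc]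
    rw [Matrix.trace_mul_comm Q]
    simp only [Matrix.mul_assoc]
  simp only [h1]
  set u := ‖X‖ * ‖Y‖ with hu
  have h2 : |∑ r ∈ Finset.Icc 2 p, β r ^ 2 * (∑ i : Fin r → Fin N,
      (monomialHessian i x * X' * monomialHessian i x * Y').trace) -
      X'.trace * Y'.trace / N| ≤ (p : ℝ) ^ 2 * u := by
    have e1 : X'.trace * Y'.trace / N = ∑ r ∈ Finset.Icc 2 p, β r ^ 2 *
        (r * (r - 1 : ℕ) * (‖x‖ ^ 2) ^ (r - 2) * (X'.trace * Y'.trace)) := by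
      simp only [← mul_assoc (β _ ^ 2)]
      rw [← Finset.sum_mul, div_eq_mul_one_div, mul_comm, ← hβ]
      simp only [mul_assoc]
    have e2 : (p : ℝ) ^ 2 * u = ∑ r ∈ Finset.Icc 2 p, β r ^ 2 *
        (r * (r - 1 : ℕ) * (‖x‖ ^ 2) ^ (r - 2) * N * ((p : ℝ) ^ 2 * u)) := by
      calc (p : ℝ) ^ 2 * u = 1 / N * (N * ((p : ℝ) ^ 2 * u)) := by field_simp
        _ = _ := by
          rw [← hβ, Finset.sum_mul]
          exact Finset.sum_congr rfl fun r _ => by ring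
    rw [e1, ← Finset.sum_sub_distrib, e2]
    refine (Finset.abs_sum_le_sum_abs _ _).trans (Finset.sum_le_sum fun r hr => ?_)
    rw [← mul_sub, abs_mul, abs_of_nonneg (sq_nonneg _)]
    have hr := Finset.mem_Icc.1 hr
    have hrp : (r : ℝ) ≤ p := by exact_mod_cast hr.2
    gcongr
    refine (abs_sum_trace_monomialHessian_sub_le hN hr.1 x X' Y').trans ?_
    rw [hu]
    gcongr
  have h3 : |X'.trace * Y'.trace / N - X.trace * Y.trace / N| ≤ 2 * u := by
    rw [← sub_div, abs_div, abs_of_pos hN', div_le_iff₀ hN']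
    have e : X'.trace * Y'.trace - X.trace * Y.trace =
        (X'.trace - X.trace) * Y'.trace + X.trace * (Y'.trace - Y.trace) := by ring
    have a1 := hQ.abs_trace_sub_le X
    have a2 := hQ.abs_trace_sub_le Y
    have a3 := (abs_trace_le_card_mul_norm Y').trans
      (mul_le_mul_of_nonneg_left hYn (Nat.cast_nonneg _))
    have a4 := abs_trace_le_card_mul_norm X
    rw [Fintype.card_fin] at a3 a4
    rw [e]
    refine (abs_add_le _ _).trans ?_
    rw [abs_mul, abs_mul]
    calc _ ≤ ‖X‖ * (N * ‖Y‖) + N * ‖X‖ * ‖Y‖ := by gcongr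
      _ = 2 * u * N := by rw [hu]; ring
  calc _ ≤ (p : ℝ) ^ 2 * u + 2 * u := (abs_sub_le _ _ _).trans (add_le_add h2 h3)
    _ = _ := by ring

/-- The Hessian of the truncated model, normalised and compressed by `Q`, is a Wigner series. -/
theorem isWignerSeries_spin (hN : 0 < N) (hJ : IsDisorder P N J) {M : ℕ → ℝ}
    (hM : ∀ r ∈ Finset.Icc 2 p, ∀ (i : Fin r → Fin N) (k : ℕ),
      Integrable (fun ω => |J r i ω| ^ k) P ∧ ∫ ω, |J r i ω| ^ k ∂P ≤ M k)
    {β : ℕ → ℝ} {x : EuclideanSpace ℝ (Fin N)}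
    (hβ : ∑ r ∈ Finset.Icc 2 p, β r ^ 2 * (r * (r - 1 : ℕ) * (‖x‖ ^ 2) ^ (r - 2)) = 1 / (N : ℝ))
    {Q : Matrix (Fin N) (Fin N) ℝ} (hQ : IsCompression Q) :
    IsWignerSeries P ((p : ℝ) ^ 4 + (p ^ 2 + 2)) M (fun (a : SpinIndex p N) => J a.1 a.2)
      (fun a => β a.1 • (Q * monomialHessian a.2 x * Q))
      (fun a => |β a.1| * monomialWeight a.2 x) := by
  have hN' : (0 : ℝ) < N := by exact_mod_cast hN
  have hmem : ∀ a : SpinIndex p N, 2 ≤ (a.1 : ℕ) ∧ (a.1 : ℕ) ≤ p := fun a => Finset.mem_Icc.1 a.1.2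
  have hone : ∀ r, 2 ≤ r → (1 : ℝ) ≤ r * (r - 1 : ℕ) := fun r hr => by
    have : 1 ≤ r * (r - 1) := Nat.mul_pos (by omega) (by omega)
    exact_mod_cast this
  have hnn : ∀ r ∈ Finset.Icc 2 p,
      β r ^ 2 * (‖x‖ ^ 2) ^ (r - 2) ≤ β r ^ 2 * (r * (r - 1 : ℕ) * (‖x‖ ^ 2) ^ (r - 2)) :=
    fun r hr => mul_le_mul_of_nonneg_left
      (le_mul_of_one_le_left (by positivity) (hone r (Finset.mem_Icc.1 hr).1)) (sq_nonneg _)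
  have hsum : ∑ r ∈ Finset.Icc 2 p, β r ^ 2 * (‖x‖ ^ 2) ^ (r - 2) ≤ 1 / (N : ℝ) :=
    (Finset.sum_le_sum hnn).trans_eq hβ
  -- A single term of a nonnegative sum bounded by `1 / N`; this makes each weight of order
  -- $N^{-1/2}$.
  have hsingle : ∀ r ∈ Finset.Icc 2 p, |β r| * ‖x‖ ^ (r - 2) ≤ 1 / √N := fun r hr => by
    rw [← Real.sqrt_one, ← Real.sqrt_div zero_le_one]
    refine Real.le_sqrt_of_sq_le ?_
    rw [mul_pow, sq_abs, ← pow_mul, mul_comm (r - 2), pow_mul]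
    exact (Finset.single_le_sum (f := fun r => β r ^ 2 * (‖x‖ ^ 2) ^ (r - 2))
      (fun r _ => by positivity) hr).trans hsum
  have hpos4 : (0 : ℝ) ≤ (p : ℝ) ^ 4 := by positivity
  have hpos2 : (0 : ℝ) ≤ (p : ℝ) ^ 2 := by positivity
  refine ⟨by linarith, fun a => hJ.measurable _ (hmem a).1 _, hJ.iIndepFun_spinIndex,
    fun a => hJ.mean_zero _ (hmem a).1 _, fun a => ?_, fun a k => (hM _ a.1.2 _ k).1,
    fun a k => (hM _ a.1.2 _ k).2, fun a => ?_, fun a => ?_, fun a X => ?_, fun a => ?_, ?_,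
    fun X Y => ?_⟩
  · rw [← hJ.variance_one _ (hmem a).1 a.2, variance_of_integral_eq_zero
      (hJ.measurable _ (hmem a).1 _).aemeasurable (hJ.mean_zero _ (hmem a).1 _)]
  · refine IsSelfAdjoint.smul (IsSelfAdjoint.all (β a.1)) ?_
    have := isHermitian_conjTranspose_mul_mul Q (monomialHessian_isHermitian a.2 x)
    rwa [hQ.isHermitian] at this
  · rw [norm_smul, Real.norm_eq_abs]
    gcongr
    exact (hQ.norm_mul_mul_le _).trans (norm_monomialHessian_le _ _)
  · rw [smul_mul_assoc, trace_smul, smul_eq_mul, abs_mul, mul_assoc |β _|]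
    refine mul_le_mul_of_nonneg_left ?_ (abs_nonneg _)
    have e : (Q * monomialHessian a.2 x * Q * X).trace =
        (monomialHessian a.2 x * (Q * X * Q)).trace := by
      rw [Matrix.mul_assoc, Matrix.mul_assoc, Matrix.trace_mul_comm]
      simp only [Matrix.mul_assoc]
    rw [e]
    exact (abs_trace_monomialHessian_mul_le _ _ _).trans
      (mul_le_mul_of_nonneg_left (hQ.norm_mul_mul_le X) (monomialWeight_nonneg _ _))
  · have hap : ((a.1 : ℕ) : ℝ) ≤ p := by exact_mod_cast (hmem a).2
    calc _ ≤ |β a.1| * (((a.1 : ℕ) : ℝ) ^ 2 * ‖x‖ ^ ((a.1 : ℕ) - 2)) := by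
          gcongr
          exact monomialWeight_le _ _
      _ = ((a.1 : ℕ) : ℝ) ^ 2 * (|β a.1| * ‖x‖ ^ ((a.1 : ℕ) - 2)) := by ring
      _ ≤ ((p : ℝ) ^ 4 + (p ^ 2 + 2)) * (1 / √N) := by
          refine mul_le_mul ?_ (hsingle _ a.1.2) (by positivity) (by positivity)
          have : ((a.1 : ℕ) : ℝ) ^ 2 ≤ (p : ℝ) ^ 2 := by gcongr
          linarith
      _ = _ := by ring
  · rw [sum_spinIndex (fun r i => (|β r| * monomialWeight i x) ^ 2)]
    have h1 : ∀ r ∈ Finset.Icc 2 p, ∑ i : Fin r → Fin N, (|β r| * monomialWeight i x) ^ 2 ≤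
        ((p : ℝ) ^ 4 * N ^ 2) * (β r ^ 2 * (‖x‖ ^ 2) ^ (r - 2)) := fun r hr => by
      have hrp : (r : ℝ) ≤ p := by exact_mod_cast (Finset.mem_Icc.1 hr).2
      simp only [mul_pow, sq_abs]
      rw [← Finset.mul_sum]
      calc _ ≤ β r ^ 2 * ((r : ℝ) ^ 4 * ((‖x‖ ^ 2) ^ (r - 2) * (N : ℝ) ^ 2)) := by
            gcongr
            exact sum_monomialWeight_sq_le (Finset.mem_Icc.1 hr).1 x
        _ ≤ β r ^ 2 * ((p : ℝ) ^ 4 * ((‖x‖ ^ 2) ^ (r - 2) * (N : ℝ) ^ 2)) := by gcongr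
        _ = _ := by ring
    refine (Finset.sum_le_sum h1).trans ?_
    rw [← Finset.mul_sum]
    calc _ ≤ ((p : ℝ) ^ 4 * N ^ 2) * (1 / N) := by gcongr
      _ = (p : ℝ) ^ 4 * N := by field_simp
      _ ≤ _ := by gcongr; linarith
  · exact (cov_spin hN hβ hQ X Y).trans
      (mul_le_mul_of_nonneg_right (by linarith) (by positivity))

end SpinSeries

/-! ### Normalization of the Hessian and its degenerate points. -/

section SpinHessian

open Matrix
open scoped Matrix.Norms.L2Operator

variable {N : ℕ}

theorem pureHessian_eq (r : ℕ) (J : (Fin r → Fin N) → ℝ) (x : EuclideanSpace ℝ (Fin N)) :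
    pureHessian r J x =
      (1 / (N : ℝ) ^ (((r : ℝ) - 1) / 2)) • ∑ i, J i • monomialHessian i x := by
  ext j k
  simp [pureHessian, monomialHessian, Matrix.sum_apply]

theorem xiSecond_eq (γ : ℕ → ℝ) (p : ℕ) (x : EuclideanSpace ℝ (Fin N)) :
    xiSecond γ p x =
      ∑ r ∈ Finset.Icc 2 p, γ r ^ 2 * (r * (r - 1 : ℕ) * (‖x‖ ^ 2 / N) ^ (r - 2)) := by
  rw [xiSecond, mixture, Polynomial.derivative_sum, Polynomial.derivative_sum,
    Polynomial.eval_finsetSum]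
  refine Finset.sum_congr rfl fun r _ => ?_
  rw [Polynomial.derivative_C_mul_X_pow, Polynomial.derivative_C_mul_X_pow]
  simp only [Polynomial.eval_mul, Polynomial.eval_C, Polynomial.eval_pow, Polynomial.eval_X]
  rw [Nat.sub_sub]
  ring

theorem xiSecond_nonneg (γ : ℕ → ℝ) (p : ℕ) (x : EuclideanSpace ℝ (Fin N)) :
    0 ≤ xiSecond γ p x := by
  rw [xiSecond_eq]
  positivity

theorem xiSecond_le (γ : ℕ → ℝ) (p : ℕ) {x : EuclideanSpace ℝ (Fin N)} (hx : x ∈ ball N) :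
    xiSecond γ p x ≤ ∑ r ∈ Finset.Icc 2 p, γ r ^ 2 * (r * (r - 1 : ℕ)) := by
  rw [xiSecond_eq]
  have h : ‖x‖ ^ 2 / N ≤ 1 := by
    refine div_le_one_of_le₀ ?_ (Nat.cast_nonneg _)
    calc ‖x‖ ^ 2 ≤ √N ^ 2 := pow_le_pow_left₀ (norm_nonneg _) hx 2
      _ = N := Real.sq_sqrt (Nat.cast_nonneg _)
  refine Finset.sum_le_sum fun r _ => mul_le_mul_of_nonneg_left ?_ (sq_nonneg _)
  exact mul_le_of_le_one_right (by positivity) (pow_le_one₀ (by positivity) h)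

/-- The coefficients of the Hessian, divided by `√ξ''`. -/
noncomputable def spinCoeff (γ : ℕ → ℝ) (p : ℕ) (x : EuclideanSpace ℝ (Fin N)) (r : ℕ) : ℝ :=
  γ r / √(xiSecond γ p x) * (1 / (N : ℝ) ^ (((r : ℝ) - 1) / 2))

/-- Of the factor $N^{-(r-1)}$, the part $N^{-(r-2)}$ turns powers of `‖x‖ ^ 2` into powers of
$\rho_x$, and one $N^{-1}$ is left over; the remaining sum is `xiSecond γ p x`, which cancels. -/
theorem sum_spinCoeff_sq (hN : 0 < N) {γ : ℕ → ℝ} {p : ℕ} {x : EuclideanSpace ℝ (Fin N)}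
    (hx : 0 < xiSecond γ p x) :
    ∑ r ∈ Finset.Icc 2 p, spinCoeff γ p x r ^ 2 * (r * (r - 1 : ℕ) * (‖x‖ ^ 2) ^ (r - 2)) =
      1 / (N : ℝ) := by
  have hN' : (0 : ℝ) < N := by exact_mod_cast hN
  have h : ∀ r ∈ Finset.Icc 2 p,
      spinCoeff γ p x r ^ 2 * (r * (r - 1 : ℕ) * (‖x‖ ^ 2) ^ (r - 2)) =
      (1 / (xiSecond γ p x * N)) * (γ r ^ 2 * (r * (r - 1 : ℕ) * (‖x‖ ^ 2 / N) ^ (r - 2))) := by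
    intro r hr
    have hr := (Finset.mem_Icc.1 hr).1
    have e : ((N : ℝ) ^ (((r : ℝ) - 1) / 2)) ^ 2 = (N : ℝ) ^ (r - 2) * N := by
      rw [← Real.rpow_natCast, ← Real.rpow_mul hN'.le, ← pow_succ, ← Real.rpow_natCast]
      congr 1
      have : r - 2 + 1 = r - 1 := by omega
      rw [this, Nat.cast_sub (by omega)]
      push_cast
      ring
    rw [spinCoeff, mul_pow, div_pow, div_pow, e, Real.sq_sqrt hx.le, div_pow]
    field_simp
  rw [Finset.sum_congr rfl h, ← Finset.mul_sum, ← xiSecond_eq]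
  field_simp

theorem mul_euclHessian_mul_eq {Ω : Type*} {γ : ℕ → ℝ} {p : ℕ} {x : EuclideanSpace ℝ (Fin N)}
    (hx : 0 < xiSecond γ p x) (J : (r : ℕ) → (Fin r → Fin N) → Ω → ℝ)
    (Q : Matrix (Fin N) (Fin N) ℝ) (ω : Ω) :
    Q * euclHessian γ p (fun r i => J r i ω) x * Q =
      √(xiSecond γ p x) • series (fun a : SpinIndex p N => J a.1 a.2)
        (fun a => spinCoeff γ p x a.1 • (Q * monomialHessian a.2 x * Q)) ω := by
  have h : series (fun a : SpinIndex p N => J a.1 a.2)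
        (fun a => spinCoeff γ p x a.1 • (Q * monomialHessian a.2 x * Q)) ω =
      ∑ r ∈ Finset.Icc 2 p, ∑ i : Fin r → Fin N,
        J r i ω • spinCoeff γ p x r • (Q * monomialHessian i x * Q) := by
    rw [series, Fintype.sum_sigma, ← Finset.sum_coe_sort (Finset.Icc 2 p)]
  have hs : √(xiSecond γ p x) ≠ 0 := (Real.sqrt_pos.2 hx).ne'
  rw [h, euclHessian, Finset.mul_sum, Finset.sum_mul, Finset.smul_sum]
  refine Finset.sum_congr rfl fun r _ => ?_
  rw [pureHessian_eq, mul_smul_comm, smul_mul_assoc, mul_smul_comm, smul_mul_assoc, smul_smul,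
    Finset.mul_sum, Finset.sum_mul, Finset.smul_sum, Finset.smul_sum]
  refine Finset.sum_congr rfl fun i _ => ?_
  rw [mul_smul_comm, smul_mul_assoc, smul_smul, smul_smul, smul_smul, spinCoeff]
  congr 1
  field_simp

theorem trMoment_smul (c : ℝ) (A : Matrix (Fin N) (Fin N) ℝ) (k : ℕ) :
    trMoment (c • A) k = c ^ k * trMoment A k := by
  rw [trMoment, trMoment, smul_pow, trace_smul, smul_eq_mul, mul_div_assoc]

/-- Convergence of the moments of the compressed Hessian, uniformly in the base point. -/
theorem exists_forall_abs_integral_trMoment_mul_sub_le {Ω : ℕ → Type*} [∀ N, MeasurableSpace (Ω N)]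
    (P : (N : ℕ) → Measure (Ω N)) [∀ N, IsProbabilityMeasure (P N)]
    (γ : ℕ → ℝ) (J : (N : ℕ) → (r : ℕ) → (Fin r → Fin N) → Ω N → ℝ)
    (hJ : ∀ N, IsDisorder (P N) N (J N)) (hM : HasUniformMoments P J) {p : ℕ} (hp : 2 ≤ p)
    (k : ℕ) {ε : ℝ} (hε : 0 < ε) :
    ∃ N₀ : ℕ, ∀ N, N₀ < N → ∀ (x : EuclideanSpace ℝ (Fin N)) (Q : Matrix (Fin N) (Fin N) ℝ),
      0 < xiSecond γ p x → IsCompression Q →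
      |∫ ω, trMoment (Q * euclHessian γ p (fun r i => J N r i ω) x * Q) k ∂(P N) -
        √(xiSecond γ p x) ^ k * semicircleMoment k| ≤ √(xiSecond γ p x) ^ k * ε := by
  choose M hM0 hM using hM p hp
  -- The constants depend on `p` and the moment bounds only, so one `N₀` serves every `x` and every
  -- `Q`.
  obtain ⟨N₀, h⟩ := IsWignerSeries.exists_forall_abs_integral_trMoment_sub_le
    ((p : ℝ) ^ 4 + (p ^ 2 + 2)) M k ε hε
  refine ⟨N₀, fun N hN x Q hx hQ => ?_⟩
  have hW := isWignerSeries_spin (Nat.zero_lt_of_lt hN) (hJ N)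
    (fun r hr i k => hM k N r (Finset.mem_Icc.1 hr).1 (Finset.mem_Icc.1 hr).2 i)
    (sum_spinCoeff_sq (Nat.zero_lt_of_lt hN) hx) hQ
  have := h (P N) hW hN
  simp only [mul_euclHessian_mul_eq hx, trMoment_smul]
  rw [integral_const_mul, ← mul_sub, abs_mul, abs_of_nonneg (by positivity)]
  gcongr

theorem sphHessian_eq (γ : ℕ → ℝ) (p : ℕ) (J : (r : ℕ) → (Fin r → Fin N) → ℝ)
    (x : EuclideanSpace ℝ (Fin N)) :
    sphHessian γ p J x = projPerp x * euclHessian γ p J x * projPerp x := by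
  rw [sphHessian, ← conjTranspose_eq_transpose_of_trivial, projPerp_isHermitian]

theorem euclHessian_isHermitian (γ : ℕ → ℝ) (p : ℕ) (J : (r : ℕ) → (Fin r → Fin N) → ℝ)
    (x : EuclideanSpace ℝ (Fin N)) : (euclHessian γ p J x).IsHermitian := by
  have h : ∀ (c : ℝ) {A : Matrix (Fin N) (Fin N) ℝ}, A.IsHermitian → (c • A).IsHermitian :=
    fun c _ hA => IsSelfAdjoint.smul (IsSelfAdjoint.all c) hA
  refine isSelfAdjoint_sum _ fun r _ => h _ ?_
  rw [pureHessian_eq]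
  exact h _ (isSelfAdjoint_sum _ fun i _ => h _ (monomialHessian_isHermitian i x))

theorem sphHessian_isHermitian (γ : ℕ → ℝ) (p : ℕ) (J : (r : ℕ) → (Fin r → Fin N) → ℝ)
    (x : EuclideanSpace ℝ (Fin N)) : (sphHessian γ p J x).IsHermitian := by
  have := isHermitian_conjTranspose_mul_mul (projPerp x) (euclHessian_isHermitian γ p J x)
  rwa [projPerp_isHermitian, ← sphHessian_eq] at this

variable {Ω : Type*} [MeasurableSpace Ω] {P : Measure Ω} [IsFiniteMeasure P]
  {J : (r : ℕ) → (Fin r → Fin N) → Ω → ℝ} {p : ℕ}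

theorem matrixHasMoments_euclHessian
    (hJ : ∀ r ∈ Finset.Icc 2 p, ∀ i : Fin r → Fin N, HasMoments P (J r i))
    (γ : ℕ → ℝ) (x : EuclideanSpace ℝ (Fin N)) :
    MatrixHasMoments P (fun ω => euclHessian γ p (fun r i => J r i ω) x) := fun j k => by
  simp only [euclHessian, pureHessian, Matrix.sum_apply, Matrix.smul_apply, of_apply, smul_eq_mul]
  exact HasMoments.sum _ fun r hr => (HasMoments.const _).mul <| (HasMoments.const _).mul <|
    HasMoments.sum _ fun i _ => (hJ r hr i).mul (HasMoments.const _)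

theorem matrixHasMoments_sphHessian
    (hJ : ∀ r ∈ Finset.Icc 2 p, ∀ i : Fin r → Fin N, HasMoments P (J r i))
    (γ : ℕ → ℝ) (x : EuclideanSpace ℝ (Fin N)) :
    MatrixHasMoments P (fun ω => sphHessian γ p (fun r i => J r i ω) x) := by
  simp only [sphHessian_eq]
  exact ((MatrixHasMoments.const _).mul (matrixHasMoments_euclHessian hJ γ x)).mul
    (MatrixHasMoments.const _)

/-- Every summand of `xiSecond` vanishes: either `γ r = 0`, or `r > 2` and `x = 0`, where the weight
bound kills the monomial Hessians. These points are excluded by the division by `√(xiSecond γ p x)`.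
-/
theorem euclHessian_eq_zero {γ : ℕ → ℝ} {p : ℕ} {x : EuclideanSpace ℝ (Fin N)}
    (hN : 0 < N) (hx : xiSecond γ p x = 0) (J : (r : ℕ) → (Fin r → Fin N) → ℝ) :
    euclHessian γ p J x = 0 := by
  have hN' : (0 : ℝ) < N := by exact_mod_cast hN
  rw [xiSecond_eq, Finset.sum_eq_zero_iff_of_nonneg fun r _ => by positivity] at hx
  refine Finset.sum_eq_zero fun r hr => ?_
  have h := hx r hr
  have hr2 := (Finset.mem_Icc.1 hr).1
  rcases mul_eq_zero.1 h with h | h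
  · rw [pow_eq_zero_iff two_ne_zero] at h
    rw [h, zero_smul]
  · have h1 : (r : ℝ) * (r - 1 : ℕ) ≠ 0 := by
      have : r * (r - 1) ≠ 0 := Nat.mul_ne_zero (by omega) (by omega)
      exact_mod_cast this
    have h2 : ‖x‖ ^ (r - 2) = 0 := by
      have h3 := (mul_eq_zero.1 h).resolve_left h1
      have h4 : r - 2 ≠ 0 := by
        intro h0
        simp [h0] at h3
      have h5 := (pow_eq_zero_iff h4).1 h3
      rw [div_eq_zero_iff, or_iff_left hN'.ne', pow_eq_zero_iff two_ne_zero] at h5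
      rw [h5, zero_pow h4]
    have h3 : ∀ i : Fin r → Fin N, monomialHessian i x = 0 := fun i => by
      have := (norm_monomialHessian_le i x).trans (monomialWeight_le i x)
      rw [h2, mul_zero] at this
      exact norm_le_zero_iff.1 this
    rw [pureHessian_eq]
    simp [h3]

end SpinHessian

/-! ### Quantitative moment method and measurability of random laws. -/

section MomentMethod

theorem integral_polynomial_eval {μ : Measure ℝ} (hμ : ∀ k : ℕ, Integrable (fun y => y ^ k) μ)
    (q : Polynomial ℝ) :
    Integrable (fun y => q.eval y) μ ∧
      ∫ y, q.eval y ∂μ = ∑ i ∈ q.support, q.coeff i * ∫ y, y ^ i ∂μ := by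
  simp only [Polynomial.eval_eq_sum, Polynomial.sum]
  refine ⟨integrable_finsetSum _ fun i _ => (hμ i).const_mul _, ?_⟩
  rw [integral_finsetSum _ fun i _ => (hμ i).const_mul _]
  simp only [integral_const_mul]

theorem integrable_pow_of_ae_abs_le {μ : Measure ℝ} [IsFiniteMeasure μ] {R : ℝ}
    (h : ∀ᵐ y ∂μ, |y| ≤ R) (k : ℕ) : Integrable (fun y => y ^ k) μ := by
  refine Integrable.of_bound (by fun_prop) (R ^ k) ?_
  filter_upwards [h] with y hy
  rw [Real.norm_eq_abs, abs_pow]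
  gcongr

theorem integrable_of_continuous_of_bound {μ : Measure ℝ} [IsFiniteMeasure μ] {f : ℝ → ℝ}
    (hf : Continuous f) {C : ℝ} (hC : ∀ y, |f y| ≤ C) : Integrable f μ :=
  Integrable.of_bound hf.aestronglyMeasurable C (ae_of_all _ hC)

/-- The moment method with uniform control: finitely many moments of `μ` determine `∫ f dμ` up to
`ε` if they are close to those of a law supported in `[-R, R]`. -/
theorem exists_abs_integral_sub_le_of_moments {f : ℝ → ℝ} (hf : Continuous f) {C : ℝ}
    (hC : ∀ y, |f y| ≤ C) {R : ℝ} (hR : 0 < R) {ε : ℝ} (hε : 0 < ε) :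
    ∃ (n : ℕ) (δ : ℝ), 0 < δ ∧ ∀ (μ ν : Measure ℝ) [IsProbabilityMeasure μ]
      [IsProbabilityMeasure ν], (∀ k : ℕ, Integrable (fun y => y ^ k) μ) →
      (∀ᵐ y ∂ν, |y| ≤ R) → (∀ k ≤ n, |∫ y, y ^ k ∂μ - ∫ y, y ^ k ∂ν| ≤ δ) →
      |∫ y, f y ∂μ - ∫ y, f y ∂ν| ≤ ε := by
  -- Approximation on twice the support radius leaves a gap that makes high normalized moments of
  -- `ν` exponentially small.
  obtain ⟨q, hq⟩ := exists_polynomial_near_of_continuousOn (-(2 * R)) (2 * R) f hf.continuousOn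
    (ε / 8) (by positivity)
  set S : ℝ := ∑ i ∈ q.support, |q.coeff i| with hS
  set T : ℝ := C + ∑ i ∈ q.support, |q.coeff i| * (2 * R) ^ i with hT
  have hS0 : 0 ≤ S := Finset.sum_nonneg fun _ _ => abs_nonneg _
  have hC0 : 0 ≤ C := (abs_nonneg _).trans (hC 0)
  have hT0 : 0 ≤ T := by positivity
  obtain ⟨m, hdm, hm⟩ : ∃ m, q.natDegree ≤ m ∧ T * (1 / 4) ^ m ≤ ε / 8 := by
    have h1 : Tendsto (fun m : ℕ => T * (1 / 4 : ℝ) ^ m) atTop (𝓝 (T * 0)) :=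
      (tendsto_pow_atTop_nhds_zero_of_lt_one (by norm_num) (by norm_num)).const_mul T
    rw [mul_zero] at h1
    exact ((eventually_ge_atTop q.natDegree).and
      (h1.eventually (eventually_le_nhds (by positivity)))).exists
  -- Outside the interval both functions are dominated by one even monomial, whose degree is at
  -- least that of `q`.
  have hdiff : ∀ y, |f y - q.eval y| ≤ ε / 8 + T * (y / (2 * R)) ^ (2 * m) := by
    intro y
    rw [pow_mul]
    rcases le_or_gt |y| (2 * R) with hy | hy
    · have := (hq y (abs_le.1 hy)).le
      rw [abs_sub_comm] at this
      have h2 : 0 ≤ T * ((y / (2 * R)) ^ 2) ^ m := by positivity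
      linarith
    · have h1 : 1 ≤ |y| / (2 * R) := (one_le_div (by positivity)).2 hy.le
      have h2 : ((y / (2 * R)) ^ 2) ^ m = (|y| / (2 * R)) ^ (2 * m) := by
        rw [← sq_abs, abs_div, abs_of_pos (show (0 : ℝ) < 2 * R by positivity), ← pow_mul]
      have h3 : ∀ i ∈ q.support, |q.coeff i * y ^ i| ≤
          |q.coeff i| * (2 * R) ^ i * (|y| / (2 * R)) ^ (2 * m) := fun i hi => by
        have hi2 : i ≤ 2 * m := by
          have := Polynomial.le_natDegree_of_mem_supp i hi
          omega
        calc |q.coeff i * y ^ i| = |q.coeff i| * (2 * R) ^ i * (|y| / (2 * R)) ^ i := by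
              rw [abs_mul, abs_pow, div_pow]
              field_simp
          _ ≤ _ := by gcongr
      rw [h2]
      have h4 : |q.eval y| ≤
          (∑ i ∈ q.support, |q.coeff i| * (2 * R) ^ i) * (|y| / (2 * R)) ^ (2 * m) := by
        rw [Polynomial.eval_eq_sum, Polynomial.sum, Finset.sum_mul]
        exact (Finset.abs_sum_le_sum_abs _ _).trans (Finset.sum_le_sum h3)
      have h5 : |f y| ≤ C * (|y| / (2 * R)) ^ (2 * m) :=
        (hC y).trans (le_mul_of_one_le_right hC0 (one_le_pow₀ h1))
      have h6 : |f y - q.eval y| ≤ |f y| + |q.eval y| := abs_sub _ _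
      rw [hT, add_mul]
      linarith
  have hint : ∀ (μ : Measure ℝ) [IsProbabilityMeasure μ],
      (∀ k : ℕ, Integrable (fun y => y ^ k) μ) →
      |∫ y, f y ∂μ - ∫ y, q.eval y ∂μ| ≤
        ε / 8 + T * ((∫ y, y ^ (2 * m) ∂μ) / (2 * R) ^ (2 * m)) := by
    intro μ _ hμ
    have i1 := integrable_of_continuous_of_bound (μ := μ) hf hC
    have i2 := (integral_polynomial_eval hμ q).1
    have i3 : Integrable (fun y => T * (y / (2 * R)) ^ (2 * m)) μ := by
      simp only [div_pow]
      exact ((hμ _).div_const _).const_mul _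
    rw [← integral_sub i1 i2]
    refine (abs_integral_le_integral_abs).trans ?_
    refine (integral_mono (i1.sub i2).abs ((integrable_const (ε / 8)).add i3) hdiff).trans ?_
    rw [integral_add' (integrable_const _) i3, integral_const_mul]
    simp only [div_pow]
    rw [integral_const, integral_div]
    simp
  set B : ℝ := 1 + T / (2 * R) ^ (2 * m) + S with hB
  have hB0 : 0 < B := by positivity
  -- Approximation and tails cost four times `ε / 8`; `B` is chosen so that the moment
  -- discrepancies, in the tail and in the polynomial, cost at most `ε / 2`.
  refine ⟨2 * m, ε / 2 / B, by positivity, fun μ ν _ _ hμ hν hmom => ?_⟩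
  set δ := ε / 2 / B with hδ
  have hν' := integrable_pow_of_ae_abs_le hν
  have k1 := hint μ hμ
  have k2 := hint ν hν'
  have hRm : (0 : ℝ) < (2 * R) ^ (2 * m) := by positivity
  have k3 : (∫ y, y ^ (2 * m) ∂ν) / (2 * R) ^ (2 * m) ≤ (1 / 4) ^ m := by
    have h1 : ∫ y, y ^ (2 * m) ∂ν ≤ R ^ (2 * m) := by
      have := integral_mono_ae (hν' (2 * m)) (integrable_const (R ^ (2 * m))) (by
        filter_upwards [hν] with y hy
        rw [← (even_two_mul m).pow_abs]
        gcongr)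
      simpa using this
    rw [div_le_iff₀ hRm]
    refine h1.trans (le_of_eq ?_)
    rw [mul_pow, pow_mul 2, ← mul_assoc, ← mul_pow]
    norm_num
  have k4 : (∫ y, y ^ (2 * m) ∂μ) / (2 * R) ^ (2 * m) ≤ (1 / 4) ^ m + δ / (2 * R) ^ (2 * m) := by
    refine le_trans ?_ (add_le_add_left k3 _)
    rw [← add_div]
    gcongr
    have := (abs_le.1 (hmom _ le_rfl)).2
    linarith
  have k5 : |∫ y, q.eval y ∂μ - ∫ y, q.eval y ∂ν| ≤ S * δ := by
    rw [(integral_polynomial_eval hμ q).2, (integral_polynomial_eval hν' q).2,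
      ← Finset.sum_sub_distrib, hS, Finset.sum_mul]
    refine (Finset.abs_sum_le_sum_abs _ _).trans (Finset.sum_le_sum fun i hi => ?_)
    rw [← mul_sub, abs_mul]
    refine mul_le_mul_of_nonneg_left (hmom i ?_) (abs_nonneg _)
    have := Polynomial.le_natDegree_of_mem_supp i hi
    omega
  have k6 : T * ((∫ y, y ^ (2 * m) ∂μ) / (2 * R) ^ (2 * m)) ≤
      ε / 8 + T * (δ / (2 * R) ^ (2 * m)) := by
    refine (mul_le_mul_of_nonneg_left k4 hT0).trans ?_
    rw [mul_add]
    linarith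
  have k7 : T * ((∫ y, y ^ (2 * m) ∂ν) / (2 * R) ^ (2 * m)) ≤ ε / 8 :=
    (mul_le_mul_of_nonneg_left k3 hT0).trans hm
  have k8 : T * (δ / (2 * R) ^ (2 * m)) + S * δ ≤ ε / 2 := by
    have : ε / 2 = B * δ := by rw [hδ]; field_simp
    have hδ0 : 0 ≤ δ := by positivity
    have h9 : B * δ = δ + (T * (δ / (2 * R) ^ (2 * m)) + S * δ) := by rw [hB]; ring
    linarith
  rw [abs_le] at k1 k2 k5 ⊢
  constructor <;> linarith

/-- A random compactly supported law with measurable moments is a measurable function. -/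
theorem measurable_of_measurable_moments {Ω : Type*} [MeasurableSpace Ω] {μ : Ω → Measure ℝ}
    [∀ ω, IsProbabilityMeasure (μ ω)] (hμ : ∀ ω, ∃ R : ℝ, ∀ᵐ y ∂μ ω, |y| ≤ R)
    (hm : ∀ k : ℕ, Measurable fun ω => ∫ y, y ^ k ∂μ ω) : Measurable μ := by
  -- Polynomials approximating `f` on growing intervals eventually cover the support of each `μ ω`,
  -- so the integral is a pointwise limit of combinations of moments.
  have hf : ∀ (f : ℝ → ℝ) (C : ℝ), Continuous f → (∀ y, |f y| ≤ C) →
      Measurable fun ω => ∫ y, f y ∂μ ω := by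
    intro f C hf hC
    choose q hq using fun n : ℕ => exists_polynomial_near_of_continuousOn (-n) n f
      hf.continuousOn (1 / ((n : ℝ) + 1)) (by positivity)
    have hint : ∀ n ω, Integrable (fun y => (q n).eval y) (μ ω) ∧ ∫ y, (q n).eval y ∂μ ω =
        ∑ i ∈ (q n).support, (q n).coeff i * ∫ y, y ^ i ∂μ ω := fun n ω => by
      obtain ⟨R, hR⟩ := hμ ω
      exact integral_polynomial_eval (integrable_pow_of_ae_abs_le hR) (q n)
    refine measurable_of_tendsto_metrizable (f := fun n ω => ∫ y, (q n).eval y ∂μ ω) (fun n => ?_)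
      (tendsto_pi_nhds.2 fun ω => ?_)
    · simp only [fun ω => (hint n ω).2]
      exact Finset.measurable_sum _ fun i _ => (hm i).const_mul _
    · obtain ⟨R, hR⟩ := hμ ω
      rw [tendsto_iff_dist_tendsto_zero]
      refine squeeze_zero' (Eventually.of_forall fun _ => dist_nonneg) ?_
        tendsto_one_div_add_atTop_nhds_zero_nat
      filter_upwards [eventually_ge_atTop ⌈R⌉₊] with n hn
      rw [Real.dist_eq, ← integral_sub (hint n ω).1 (integrable_of_continuous_of_bound hf hC)]
      have hb : ∀ᵐ y ∂μ ω, ‖(q n).eval y - f y‖ ≤ 1 / ((n : ℝ) + 1) := by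
        filter_upwards [hR] with y hy
        exact (hq n y (abs_le.1 (hy.trans (Nat.ceil_le.1 hn)))).le
      simpa using norm_integral_le_of_norm_le_const hb
  -- Closed sets generate the σ-algebra, and their indicators are limits of continuous thickened
  -- indicators.
  refine Measurable.measure_of_isPiSystem_of_isProbabilityMeasure
    ((BorelSpace.measurable_eq (α := ℝ)).trans borel_eq_generateFrom_isClosed) isPiSystem_isClosed
    fun F hF => ?_
  have hδ : ∀ n : ℕ, (0 : ℝ) < 1 / ((n : ℝ) + 1) := fun n => by positivity
  refine measurable_of_tendsto_metrizable
    (f := fun n ω => ∫⁻ y, (thickenedIndicator (hδ n) F y : ℝ≥0∞) ∂μ ω) (fun n => ?_)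
    (tendsto_pi_nhds.2 fun ω => tendsto_lintegral_thickenedIndicator_of_isClosed (μ ω) hF hδ
      tendsto_one_div_add_atTop_nhds_zero_nat)
  have hc : Continuous fun y => (thickenedIndicator (hδ n) F y : ℝ) := by fun_prop
  have hb : ∀ y, |(thickenedIndicator (hδ n) F y : ℝ)| ≤ 1 := fun y => by
    rw [abs_of_nonneg (NNReal.coe_nonneg _)]
    exact_mod_cast thickenedIndicator_le_one (hδ n) F y
  simp only [fun ω => lintegral_coe_eq_integral _ (integrable_of_continuous_of_bound (μ := μ ω) hc hb)]
  exact (hf _ 1 hc hb).ennreal_ofReal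

end MomentMethod

/-! ### Empirical spectral distributions and their means. -/

section EmpiricalSpectral

open Matrix

variable {N : ℕ}

theorem empiricalSpectral_eq {A : Matrix (Fin N) (Fin N) ℝ} (hA : A.IsHermitian) :
    empiricalSpectral A = (N : ℝ≥0∞)⁻¹ • ∑ i, Measure.dirac (hA.eigenvalues i) := by
  rw [empiricalSpectral, hA.roots_charpoly_eq_eigenvalues, Multiset.map_map]
  rfl

theorem isProbabilityMeasure_empiricalSpectral (hN : 0 < N) {A : Matrix (Fin N) (Fin N) ℝ}
    (hA : A.IsHermitian) : IsProbabilityMeasure (empiricalSpectral A) where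
  measure_univ := by
    rw [empiricalSpectral_eq hA]
    simp only [Measure.smul_apply, Measure.finsetSum_apply, measure_univ, Finset.sum_const,
      Finset.card_univ, Fintype.card_fin, nsmul_eq_mul, mul_one, smul_eq_mul]
    exact ENNReal.inv_mul_cancel (by exact_mod_cast hN.ne') (ENNReal.natCast_ne_top N)

theorem ae_abs_le_empiricalSpectral {A : Matrix (Fin N) (Fin N) ℝ} (hA : A.IsHermitian) :
    ∃ R : ℝ, ∀ᵐ y ∂empiricalSpectral A, |y| ≤ R := by
  refine ⟨∑ i, |hA.eigenvalues i|, ?_⟩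
  rw [empiricalSpectral_eq hA]
  refine Measure.ae_smul_measure ?_ _
  rw [← Measure.sum_fintype, Measure.ae_sum_iff]
  intro i
  rw [ae_dirac_eq]
  exact Finset.single_le_sum (f := fun i => |hA.eigenvalues i|) (fun _ _ => abs_nonneg _)
    (Finset.mem_univ i)

theorem trace_pow_eq_sum_eigenvalues {A : Matrix (Fin N) (Fin N) ℝ} (hA : A.IsHermitian) (k : ℕ) :
    (A ^ k).trace = ∑ i, hA.eigenvalues i ^ k := by
  conv_lhs => rw [hA.spectral_theorem, ← map_pow, Unitary.conjStarAlgAut_apply, diagonal_pow]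
  rw [Matrix.trace_mul_comm, ← Matrix.mul_assoc, Unitary.coe_star_mul_self, Matrix.one_mul,
    trace_diagonal]
  simp

theorem integral_pow_empiricalSpectral {A : Matrix (Fin N) (Fin N) ℝ} (hA : A.IsHermitian)
    (k : ℕ) : ∫ y, y ^ k ∂empiricalSpectral A = trMoment A k := by
  rw [empiricalSpectral_eq hA, integral_smul_measure, integral_finsetSum_measure, trMoment,
    trace_pow_eq_sum_eigenvalues hA]
  · simp [integral_dirac, div_eq_inv_mul]
  · intro i _
    exact integrable_dirac (by simp)

variable {Ω : Type*} [MeasurableSpace Ω] {P : Measure Ω} [IsProbabilityMeasure P]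
  {A : Ω → Matrix (Fin N) (Fin N) ℝ}

theorem measurable_empiricalSpectral (hN : 0 < N) (hA : ∀ ω, (A ω).IsHermitian)
    (hm : MatrixHasMoments P A) : Measurable fun ω => empiricalSpectral (A ω) := by
  have := fun ω => isProbabilityMeasure_empiricalSpectral hN (hA ω)
  refine measurable_of_measurable_moments (fun ω => ae_abs_le_empiricalSpectral (hA ω)) fun k => ?_
  simp only [fun ω => integral_pow_empiricalSpectral (hA ω)]
  exact (hm.trMoment k).measurable

theorem isProbabilityMeasure_meanEmpiricalSpectral (hN : 0 < N) (hA : ∀ ω, (A ω).IsHermitian)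
    (hm : MatrixHasMoments P A) : IsProbabilityMeasure (meanEmpiricalSpectral P A) where
  measure_univ := by
    have := fun ω => isProbabilityMeasure_empiricalSpectral hN (hA ω)
    rw [meanEmpiricalSpectral, Measure.bind_apply MeasurableSet.univ
      (measurable_empiricalSpectral hN hA hm).aemeasurable]
    simp

/-- The mean law is the composition of `P` with the kernel of empirical laws, so Fubini applies once
the absolute moment is dominated by one plus the moment of order `2 * k`, which has finite mean. -/
theorem integrable_pow_meanEmpiricalSpectral (hN : 0 < N) (hA : ∀ ω, (A ω).IsHermitian)
    (hm : MatrixHasMoments P A) (k : ℕ) :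
    Integrable (fun y => y ^ k) (meanEmpiricalSpectral P A) ∧
      ∫ y, y ^ k ∂meanEmpiricalSpectral P A = ∫ ω, trMoment (A ω) k ∂P := by
  have := fun ω => isProbabilityMeasure_empiricalSpectral hN (hA ω)
  let η : Kernel Ω ℝ := ⟨fun ω => empiricalSpectral (A ω), measurable_empiricalSpectral hN hA hm⟩
  have : IsMarkovKernel η := ⟨fun ω => isProbabilityMeasure_empiricalSpectral hN (hA ω)⟩
  have hη : meanEmpiricalSpectral P A = (η.comp (Kernel.const Unit P)) () := by
    rw [Kernel.comp_apply]
    rfl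
  have hpow : ∀ ω j, Integrable (fun y => y ^ j) (η ω) := fun ω j => by
    obtain ⟨R, hR⟩ := ae_abs_le_empiricalSpectral (hA ω)
    exact integrable_pow_of_ae_abs_le (μ := empiricalSpectral (A ω)) hR j
  have hint : Integrable (fun y => y ^ k) ((η.comp (Kernel.const Unit P)) ()) := by
    rw [integrable_comp_iff (by fun_prop)]
    refine ⟨ae_of_all _ fun ω => hpow ω k, ?_⟩
    have hs : StronglyMeasurable fun ω => ∫ y, ‖y ^ k‖ ∂η ω :=
      StronglyMeasurable.integral_kernel (by fun_prop)
    refine ((integrable_const 1).add (hm.trMoment (2 * k)).integrable).mono'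
      hs.aestronglyMeasurable (ae_of_all _ fun ω => ?_)
    rw [Real.norm_of_nonneg (integral_nonneg fun _ => norm_nonneg _)]
    have h2 : ∫ y, y ^ (2 * k) ∂η ω = trMoment (A ω) (2 * k) :=
      integral_pow_empiricalSpectral (hA ω) (2 * k)
    rw [Pi.add_apply, ← h2]
    have h3 : ∫ y, (1 + y ^ (2 * k)) ∂η ω = 1 + ∫ y, y ^ (2 * k) ∂η ω := by
      rw [integral_add (integrable_const _) (hpow ω _)]
      simp
    rw [← h3]
    refine integral_mono (hpow ω k).norm ((integrable_const _).add (hpow ω _)) fun y => ?_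
    simp only [Real.norm_eq_abs]
    rw [mul_comm 2 k, pow_mul, ← sq_abs]
    nlinarith [sq_nonneg (|y ^ k| - 1), abs_nonneg (y ^ k)]
  rw [hη]
  refine ⟨hint, ?_⟩
  rw [Kernel.integral_comp hint, Kernel.const_apply]
  exact integral_congr_ae (ae_of_all _ fun ω => integral_pow_empiricalSpectral (hA ω) k)

end EmpiricalSpectral

/-! ### Moments of the semicircular law. -/

section Semicircle

/-- Integrate the derivative of $y^{k+1}(1-y^2)^{3/2}$, which vanishes at both endpoints. -/
theorem integral_pow_mul_sqrt_add_two (k : ℕ) :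
    ((k : ℝ) + 4) * ∫ y in (-1 : ℝ)..1, y ^ (k + 2) * √(1 - y ^ 2) =
      (k + 1) * ∫ y in (-1 : ℝ)..1, y ^ k * √(1 - y ^ 2) := by
  have hd : ∀ y ∈ Set.Ioo (-1 : ℝ) 1,
      HasDerivAt (fun y => y ^ (k + 1) * (1 - y ^ 2) * √(1 - y ^ 2))
        ((k + 1) * (y ^ k * √(1 - y ^ 2)) - (k + 4) * (y ^ (k + 2) * √(1 - y ^ 2))) y := by
    intro y hy
    have hpos : 0 < 1 - y ^ 2 := by nlinarith [hy.1, hy.2]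
    have h1 : HasDerivAt (fun y : ℝ => 1 - y ^ 2) (-(2 * y)) y := by
      simpa using (hasDerivAt_pow 2 y).const_sub 1
    have h2 := ((hasDerivAt_pow (k + 1) y).mul h1).mul (h1.sqrt hpos.ne')
    refine h2.congr_deriv ?_
    have hs : √(1 - y ^ 2) ≠ 0 := (Real.sqrt_pos.2 hpos).ne'
    have e : (1 - y ^ 2) * (-(2 * y) / (2 * √(1 - y ^ 2))) = -(y * √(1 - y ^ 2)) := by
      nth_rewrite 1 [← Real.sq_sqrt hpos.le]
      field_simp
    rw [Pi.mul_apply, mul_assoc (y ^ (k + 1)), e]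
    push_cast
    ring
  have hc : ∀ j : ℕ, Continuous fun y : ℝ => y ^ j * √(1 - y ^ 2) := fun j => by fun_prop
  have h := intervalIntegral.integral_eq_sub_of_hasDerivAt_of_le (a := (-1 : ℝ)) (b := 1)
    (by norm_num) (Continuous.continuousOn (by fun_prop)) hd
    (Continuous.intervalIntegrable (by fun_prop) _ _)
  rw [intervalIntegral.integral_sub
    (((hc k).intervalIntegrable _ _).const_mul _) (((hc (k + 2)).intervalIntegrable _ _).const_mul _),
    intervalIntegral.integral_const_mul, intervalIntegral.integral_const_mul] at h
  norm_num at h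
  linarith

theorem semicircleMoment_add_two (k : ℕ) :
    ((k : ℝ) + 4) * semicircleMoment (k + 2) = 4 * (k + 1) * semicircleMoment k := by
  rcases Nat.even_or_odd' k with ⟨m, rfl | rfl⟩
  · rw [show 2 * m + 2 = 2 * (m + 1) by ring, semicircleMoment_two_mul, semicircleMoment_two_mul]
    have h1 : ((m : ℝ) + 1) * catalan m = m.centralBinom := by
      exact_mod_cast succ_mul_catalan_eq_centralBinom m
    have h2 : ((m : ℝ) + 1 + 1) * catalan (m + 1) = (m + 1).centralBinom := by
      exact_mod_cast succ_mul_catalan_eq_centralBinom (m + 1)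
    have h3 : ((m : ℝ) + 1) * (m + 1).centralBinom = 2 * (2 * m + 1) * m.centralBinom := by
      exact_mod_cast Nat.succ_mul_centralBinom_succ m
    have hm : (m : ℝ) + 1 ≠ 0 := by positivity
    refine mul_left_cancel₀ hm ?_
    push_cast
    rw [← h1, ← h2] at h3
    linarith
  · rw [show 2 * m + 1 + 2 = 2 * (m + 1) + 1 by ring, semicircleMoment_odd (by simp),
      semicircleMoment_odd (by simp)]
    simp

theorem integral_pow_mul_sqrt (k : ℕ) :
    ∫ y in (-1 : ℝ)..1, y ^ k * √(1 - y ^ 2) =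
      Real.pi / 2 * (semicircleMoment k / 2 ^ k) := by
  induction k using Nat.twoStepInduction with
  | zero => simp [integral_sqrt_one_sub_sq, semicircleMoment]
  | one =>
    have h := intervalIntegral.integral_comp_neg (a := (-1 : ℝ)) (b := 1)
      fun y => y ^ 1 * √(1 - y ^ 2)
    have h2 : semicircleMoment 1 = 0 := semicircleMoment_odd (by simp)
    simp only [pow_one, neg_sq, neg_mul, neg_neg, intervalIntegral.integral_neg] at h
    rw [h2]
    simp only [pow_one]
    linarith
  | more k ih _ =>
    have h1 := integral_pow_mul_sqrt_add_two k
    have h2 := semicircleMoment_add_two k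
    rw [ih] at h1
    have hk : (k : ℝ) + 4 ≠ 0 := by positivity
    refine mul_left_cancel₀ hk (h1.trans ?_)
    rw [show ((k : ℝ) + 4) * (Real.pi / 2 * (semicircleMoment (k + 2) / 2 ^ (k + 2))) =
      Real.pi / 2 * ((((k : ℝ) + 4) * semicircleMoment (k + 2)) / 2 ^ (k + 2)) by ring, h2, pow_add]
    ring

variable {R : ℝ}

theorem semicircle_of_pos (hR : 0 < R) : semicircle R = volume.withDensity fun y =>
    ENNReal.ofReal (2 / (Real.pi * R ^ 2) * √(R ^ 2 - y ^ 2)) := by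
  rw [semicircle, if_neg hR.ne']
  congr 1
  funext y
  split_ifs with h
  · rfl
  · rw [Real.sqrt_eq_zero_of_nonpos, mul_zero]
    nlinarith [sq_abs y, not_le.1 h]

theorem support_semicircle_density_subset (g : ℝ → ℝ) (hR : 0 < R) :
    (Function.support fun y => g y * (2 / (Real.pi * R ^ 2) * √(R ^ 2 - y ^ 2))) ⊆
      Set.Ioc (-R) R := by
  intro y hy
  have h : √(R ^ 2 - y ^ 2) ≠ 0 := fun h => hy (by simp [h])
  have h1 : 0 < R ^ 2 - y ^ 2 := Real.sqrt_ne_zero'.1 h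
  have h2 := abs_lt_of_sq_lt_sq (by linarith : y ^ 2 < R ^ 2) hR.le
  exact ⟨(abs_lt.1 h2).1, (abs_lt.1 h2).2.le⟩

theorem integral_semicircle_density (hR : 0 < R) (k : ℕ) :
    ∫ y, y ^ k * (2 / (Real.pi * R ^ 2) * √(R ^ 2 - y ^ 2)) =
      (R / 2) ^ k * semicircleMoment k := by
  rw [← intervalIntegral.integral_eq_integral_of_support_subset
    (support_semicircle_density_subset (fun y => y ^ k) hR)]
  have h := intervalIntegral.integral_comp_mul_left (a := (-1 : ℝ)) (b := 1)
    (fun y => y ^ k * (2 / (Real.pi * R ^ 2) * √(R ^ 2 - y ^ 2))) hR.ne'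
  rw [mul_neg, mul_one, smul_eq_mul] at h
  have h1 : ∀ y : ℝ, (R * y) ^ k * (2 / (Real.pi * R ^ 2) * √(R ^ 2 - (R * y) ^ 2)) =
      (R ^ k * (2 / (Real.pi * R ^ 2)) * R) * (y ^ k * √(1 - y ^ 2)) := fun y => by
    rw [show R ^ 2 - (R * y) ^ 2 = R ^ 2 * (1 - y ^ 2) by ring, Real.sqrt_mul (sq_nonneg R),
      Real.sqrt_sq hR.le]
    ring
  simp only [h1] at h
  rw [intervalIntegral.integral_const_mul, integral_pow_mul_sqrt] at h
  rw [eq_inv_mul_iff_mul_eq₀ hR.ne'] at h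
  rw [← h, div_pow]
  have := Real.pi_pos.ne'
  field_simp

theorem isProbabilityMeasure_semicircle (hR : 0 ≤ R) : IsProbabilityMeasure (semicircle R) := by
  rcases hR.eq_or_lt with rfl | hR
  · rw [semicircle, if_pos rfl]
    infer_instance
  · refine ⟨?_⟩
    have h1 := integral_semicircle_density hR 0
    have h2 : semicircleMoment 0 = 1 := by simp [semicircleMoment]
    simp only [pow_zero, one_mul, h2] at h1
    rw [semicircle_of_pos hR, withDensity_apply _ MeasurableSet.univ, Measure.restrict_univ,
      ← ofReal_integral_eq_lintegral_ofReal, h1, ENNReal.ofReal_one]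
    -- A non-integrable density would have integral `0` by convention, but `h1` gives `1`.
    · by_contra hni
      rw [integral_undef hni] at h1
      exact zero_ne_one h1
    · exact ae_of_all _ fun y => by positivity

theorem ae_abs_le_semicircle (hR : 0 ≤ R) : ∀ᵐ y ∂semicircle R, |y| ≤ R := by
  rcases hR.eq_or_lt with rfl | hR
  · rw [semicircle, if_pos rfl, ae_dirac_eq]
    change |(0 : ℝ)| ≤ 0
    rw [abs_zero]
  · rw [semicircle_of_pos hR, ae_withDensity_iff (by fun_prop)]
    refine ae_of_all _ fun y hy => ?_
    have := support_semicircle_density_subset (fun _ => 1) hR (a := y) fun h => hy (by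
      rw [← one_mul (_ * _)]
      exact ENNReal.ofReal_eq_zero.2 h.le)
    exact abs_le.2 ⟨this.1.le, this.2⟩

theorem integral_pow_semicircle (hR : 0 ≤ R) (k : ℕ) :
    ∫ y, y ^ k ∂semicircle R = (R / 2) ^ k * semicircleMoment k := by
  rcases hR.eq_or_lt with rfl | hR
  · rw [semicircle, if_pos rfl, integral_dirac]
    rcases k with _ | k
    · simp [semicircleMoment]
    · simp
  · rw [semicircle_of_pos hR, integral_withDensity_eq_integral_toReal_smul (by fun_prop)
      (ae_of_all _ fun _ => ENNReal.ofReal_lt_top), ← integral_semicircle_density hR]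
    refine integral_congr_ae (ae_of_all _ fun y => ?_)
    beta_reduce
    rw [ENNReal.toReal_ofReal (by positivity), smul_eq_mul, mul_comm]

end Semicircle

/-! ### Uniform limits over the ball. -/

section Limits

variable {Ω : ℕ → Type*} [∀ N, MeasurableSpace (Ω N)] {P : (N : ℕ) → Measure (Ω N)}
  {J : (N : ℕ) → (r : ℕ) → (Fin r → Fin N) → Ω N → ℝ} {p : ℕ}

theorem IsDisorder.hasMoments (hJ : ∀ N, IsDisorder (P N) N (J N)) (hM : HasUniformMoments P J)
    (hp : 2 ≤ p) (N : ℕ) : ∀ r ∈ Finset.Icc 2 p, ∀ i, HasMoments (P N) (J N r i) :=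
  fun r hr i => by
    obtain ⟨h2, hrp⟩ := Finset.mem_Icc.1 hr
    refine ⟨(hJ N).measurable r h2 i, fun k => ?_⟩
    obtain ⟨C, -, h⟩ := hM p hp k
    exact (h N r h2 hrp i).1

theorem tendsto_iSup_ofReal_of_forall_le {S : (N : ℕ) → Set (EuclideanSpace ℝ (Fin N))}
    {F : (N : ℕ) → EuclideanSpace ℝ (Fin N) → ℝ}
    (h : ∀ ε > 0, ∃ N₀ : ℕ, ∀ N, N₀ < N → ∀ x ∈ S N, F N x ≤ ε) :
    Tendsto (fun N : ℕ => ⨆ x ∈ S N, ENNReal.ofReal (F N x)) atTop (𝓝 0) := by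
  refine ENNReal.tendsto_nhds_zero.2 fun ε hε => ?_
  rcases eq_or_ne ε ⊤ with rfl | hε'
  · exact Eventually.of_forall fun _ => le_top
  · obtain ⟨N₀, h⟩ := h ε.toReal (ENNReal.toReal_pos hε.ne' hε')
    filter_upwards [eventually_gt_atTop N₀] with N hN
    exact iSup₂_le fun x hx => ENNReal.ofReal_le_of_le_toReal (h N hN x hx)

variable [∀ N, IsProbabilityMeasure (P N)]

theorem exists_forall_abs_moment_sub_le (γ : ℕ → ℝ)
    (hJ : ∀ N, IsDisorder (P N) N (J N)) (hM : HasUniformMoments P J) (hp : 2 ≤ p)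
    (k : ℕ) {ε : ℝ} (hε : 0 < ε) :
    ∃ N₀ : ℕ, ∀ N, N₀ < N → ∀ x : EuclideanSpace ℝ (Fin N), 0 < xiSecond γ p x →
      |1 / (xiSecond γ p x ^ ((k : ℝ) / 2) * (N : ℝ)) *
          ∫ ω, (euclHessian γ p (fun r i => J N r i ω) x ^ k).trace ∂(P N)
        - semicircleMoment k| ≤ ε := by
  obtain ⟨N₀, h⟩ := exists_forall_abs_integral_trMoment_mul_sub_le P γ J hJ hM hp k hε
  refine ⟨N₀, fun N hN x hx => ?_⟩
  have h1 := h N hN x 1 hx isCompression_one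
  simp only [one_mul, mul_one, trMoment, integral_div] at h1
  have hs : 0 < √(xiSecond γ p x) ^ k := pow_pos (Real.sqrt_pos.2 hx) k
  have e : xiSecond γ p x ^ ((k : ℝ) / 2) = √(xiSecond γ p x) ^ k := by
    rw [Real.sqrt_eq_rpow, ← Real.rpow_natCast, ← Real.rpow_mul hx.le]
    congr 1
    ring
  rw [e]
  set I := ∫ ω, (euclHessian γ p (fun r i => J N r i ω) x ^ k).trace ∂(P N)
  set s := √(xiSecond γ p x) ^ k
  have e2 : I / N - s * semicircleMoment k =
      s * (1 / (s * N) * I - semicircleMoment k) := by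
    field_simp
  rw [e2, abs_mul, abs_of_pos hs] at h1
  exact le_of_mul_le_mul_left h1 hs

/-- The error relative to a power of `√(xiSecond γ p x)` becomes absolute because that quantity is
bounded by `B` on the ball; at degenerate points both sides are explicit. -/
theorem exists_forall_abs_integral_trMoment_sphHessian_sub_le (γ : ℕ → ℝ)
    (hJ : ∀ N, IsDisorder (P N) N (J N)) (hM : HasUniformMoments P J) (hp : 2 ≤ p)
    (k : ℕ) {ε : ℝ} (hε : 0 < ε) :
    ∃ N₀ : ℕ, ∀ N, N₀ < N → ∀ x ∈ ball N,
      |∫ ω, trMoment (sphHessian γ p (fun r i => J N r i ω) x) k ∂(P N) -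
        √(xiSecond γ p x) ^ k * semicircleMoment k| ≤ ε := by
  set B : ℝ := 1 + √(∑ r ∈ Finset.Icc 2 p, γ r ^ 2 * (r * (r - 1 : ℕ))) with hB
  have hB0 : 0 < B := by positivity
  obtain ⟨N₀, h⟩ := exists_forall_abs_integral_trMoment_mul_sub_le P γ J hJ hM hp k
    (ε := ε / B ^ k) (by positivity)
  refine ⟨N₀, fun N hN x hx => ?_⟩
  have hN0 : 0 < N := Nat.zero_lt_of_lt hN
  rcases (xiSecond_nonneg γ p x).eq_or_lt with h0 | h0
  · have hz : ∀ ω, sphHessian γ p (fun r i => J N r i ω) x = 0 := fun ω => by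
      rw [sphHessian, euclHessian_eq_zero hN0 h0.symm, mul_zero, zero_mul]
    simp only [hz, ← h0, Real.sqrt_zero, trMoment]
    have hN' : (N : ℝ) ≠ 0 := by positivity
    rcases k with _ | k
    · simpa [semicircleMoment, hN'] using hε.le
    · simpa using hε.le
  · have h1 := h N hN x (projPerp x) h0 (isCompression_projPerp x)
    simp only [← sphHessian_eq] at h1
    refine h1.trans ?_
    have h2 : √(xiSecond γ p x) ≤ B :=
      (Real.sqrt_le_sqrt (xiSecond_le γ p hx)).trans (by linarith)
    calc _ ≤ B ^ k * (ε / B ^ k) := by gcongr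
      _ = ε := by field_simp

theorem exists_forall_abs_integral_meanEmpiricalSpectral_sub_le (γ : ℕ → ℝ)
    (hJ : ∀ N, IsDisorder (P N) N (J N)) (hM : HasUniformMoments P J) (hp : 2 ≤ p)
    {f : ℝ → ℝ} (hf : Continuous f) {C : ℝ} (hC : ∀ y, |f y| ≤ C) {ε : ℝ} (hε : 0 < ε) :
    ∃ N₀ : ℕ, ∀ N, N₀ < N → ∀ x ∈ ball N,
      |(∫ y, f y ∂(meanEmpiricalSpectral (P N) fun ω => sphHessian γ p (fun r i => J N r i ω) x))
        - ∫ y, f y ∂(semicircle (2 * xiSecond γ p x ^ ((1 : ℝ) / 2)))| ≤ ε := by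
  set B : ℝ := 1 + √(∑ r ∈ Finset.Icc 2 p, γ r ^ 2 * (r * (r - 1 : ℕ))) with hB
  have hB0 : 0 < B := by positivity
  -- The radius `2 * B` contains the supports of all limiting semicircles at once, so `n` and `δ` do
  -- not depend on `x` or `N`.
  obtain ⟨n, δ, hδ, h⟩ := exists_abs_integral_sub_le_of_moments hf hC (R := 2 * B)
    (by positivity) hε
  choose N₀ hN₀ using fun k =>
    exists_forall_abs_integral_trMoment_sphHessian_sub_le γ hJ hM hp k hδ
  refine ⟨(Finset.range (n + 1)).sup N₀, fun N hN x hx => ?_⟩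
  have hN0 : 0 < N := Nat.zero_lt_of_lt hN
  have hA := fun ω => sphHessian_isHermitian γ p (fun r i => J N r i ω) x
  have hm := matrixHasMoments_sphHessian (IsDisorder.hasMoments hJ hM hp N) γ x
  rw [← Real.sqrt_eq_rpow]
  have hR : 0 ≤ 2 * √(xiSecond γ p x) := by positivity
  have := isProbabilityMeasure_meanEmpiricalSpectral hN0 hA hm
  have := isProbabilityMeasure_semicircle hR
  refine h _ _ (fun k => (integrable_pow_meanEmpiricalSpectral hN0 hA hm k).1) ?_ fun k hk => ?_
  · filter_upwards [ae_abs_le_semicircle hR] with y hy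
    have h2 : √(xiSecond γ p x) ≤ B :=
      (Real.sqrt_le_sqrt (xiSecond_le γ p hx)).trans (by linarith)
    linarith
  · rw [(integrable_pow_meanEmpiricalSpectral hN0 hA hm k).2, integral_pow_semicircle hR,
      mul_div_cancel_left₀ _ (two_ne_zero' ℝ)]
    refine hN₀ k N (lt_of_le_of_lt ?_ hN) x hx
    exact Finset.le_sup (f := N₀) (Finset.mem_range.2 (by omega))

end Limits

end SphericalGlass

theorem proposition3p1 {Ω : ℕ → Type*} [∀ N, MeasurableSpace (Ω N)]
    (P : (N : ℕ) → Measure (Ω N)) [∀ N, IsProbabilityMeasure (P N)]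
    (γ : ℕ → ℝ) (J : (N : ℕ) → (r : ℕ) → (Fin r → Fin N) → Ω N → ℝ)
    (hJ : ∀ N, SphericalGlass.IsDisorder (P N) N (J N))
    (hM : SphericalGlass.HasUniformMoments P J)
    (p : ℕ) (hp : 2 ≤ p) :
    -- moments: the suprema are taken in `[0, ∞]`
    (∀ k : ℕ,
      (∀ (N : ℕ), ∀ x ∈ SphericalGlass.ball N,
        Integrable (fun ω =>
          (SphericalGlass.euclHessian γ p (fun r i => J N r i ω) x ^ k).trace) (P N)) ∧
      Tendsto (fun N : ℕ =>
        ⨆ x ∈ {x ∈ SphericalGlass.ball N | 0 < SphericalGlass.xiSecond γ p x},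
          ENNReal.ofReal
            |1 / (SphericalGlass.xiSecond γ p x ^ ((k : ℝ) / 2) * (N : ℝ)) *
                ∫ ω, (SphericalGlass.euclHessian γ p (fun r i => J N r i ω) x ^ k).trace ∂(P N)
              - SphericalGlass.semicircleMoment k|)
        atTop (𝓝 0)) ∧
    -- semicircular law
    (∀ f : ℝ → ℝ, LipschitzWith 1 f → (∃ C : ℝ, ∀ y, |f y| ≤ C) →
      Tendsto (fun N : ℕ =>
        ⨆ x ∈ SphericalGlass.ball N,
          ENNReal.ofReal
            |(∫ y, f y ∂(SphericalGlass.meanEmpiricalSpectral (P N) fun ω =>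
                  SphericalGlass.sphHessian γ p (fun r i => J N r i ω) x))
              - ∫ y, f y ∂(SphericalGlass.semicircle
                  (2 * SphericalGlass.xiSecond γ p x ^ ((1 : ℝ) / 2)))|)
        atTop (𝓝 0)) := by
  refine ⟨fun k => ⟨fun N x _ => ?_, ?_⟩, fun f hf ⟨C, hC⟩ => ?_⟩
  · exact ((SphericalGlass.matrixHasMoments_euclHessian
      (SphericalGlass.IsDisorder.hasMoments hJ hM hp N) γ x).pow k).trace.integrable
  · refine SphericalGlass.tendsto_iSup_ofReal_of_forall_le fun ε hε => ?_
    obtain ⟨N₀, h⟩ := SphericalGlass.exists_forall_abs_moment_sub_le γ hJ hM hp k hε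
    exact ⟨N₀, fun N hN x hx => h N hN x hx.2⟩
  · exact SphericalGlass.tendsto_iSup_ofReal_of_forall_le fun ε hε =>
      SphericalGlass.exists_forall_abs_integral_meanEmpiricalSpectral_sub_le γ hJ hM hp
        hf.continuous hC hε
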